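/- Let $n$ be an odd positive integer, let $C_n$ be the cyclic group of order $n$ with generator $t$, and for $d\mid n$ let $\Theta_d=C_n/\langle t^d\rangle$. Let $\mathcal B\underline{\mathbb Z}$ be the category with objects $\Theta_d$ ($d\mid n$) and morphisms $\mathcal B\underline{\mathbb Z}(\Theta_b,\Theta_c)=\mathrm{Hom}_{\mathbb Z[C_n]}(\mathbb Z\langle\Theta_b\rangle,\mathbb Z\langle\Theta_c\rangle)$. A $\underline{\mathbb Z}$-module is an additive contravariant functor from $\mathcal B\underline{\mathbb Z}$ to abelian groups; let $F_\Theta=\mathcal B\underline{\mathbb Z}(-,\Theta)$, $F_d=F_{\Theta_d}$ and $\underline{\mathbb Z}=F_1$, let $\Box$ be the box product (so that $F_\Theta\Box F_{\Theta'}=F_{\Theta\times\Theta'}$), and let $\mathcal D(\underline{\mathbb Z})$ be the derived category of $\underline{\mathbb Z}$-modules. For $d\mid n$ let $S^{\lambda_d}$ be the chain complex $$0\to F_d\xrightarrow{\ \mathrm{id}-t\ }F_d\xrightarrow{\ \pi\ }\underline{\mathbb Z}\to 0$$ in homological degrees $2,1,0$, where $\pi$ is induced by the projection $\Theta_d\to\Theta_1$.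 For $v=(v_d)_{d\mid n,\,d>1}$ with integers $v_d\ge 0$ put $S^v=\Box_{d}(S^{\lambda_d})^{\Box v_d}$ (factors in increasing order of $d$), and for $m\in\mathbb Z$ put $$\underline H^{\,m+\sum_d v_d\lambda_d}(\Theta)=\mathcal D(\underline{\mathbb Z})\bigl(\Sigma^{-m}F_\Theta,\;S^v\bigr),$$ which is a $\underline{\mathbb Z}$-module in $\Theta$. The positive cone of $\underline H^\star=\underline H^\star(pt;\underline{\mathbb Z})$ is the family of these $\underline{\mathbb Z}$-modules, over all $m\in\mathbb Z$ and all $v\ge 0$. It is a graded Mackey ring (graded $\underline{\mathbb Z}$-algebra): the product of two classes at $\Theta$ is the restriction along the diagonal $F_\Theta\to F_{\Theta\times\Theta}=F_\Theta\Box F_\Theta$ of the box product of the two maps, followed by the isomorphism $S^v\Box S^w\cong S^{v+w}$ that interchanges factors with the Koszul signs. For $d>1$ let $a_d\in\underline H^{\lambda_d}(\Theta_1)$ be the class of the inclusion $\underline{\mathbb Z}\to S^{\lambda_d}$ of the degree $0$ part, and let $u_d\in\underline H^{\lambda_d-2}(\Theta_1)$ be the class of the map $\Sigma^2\underline{\mathbb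 Z}\to S^{\lambda_d}$ that is the transfer $1\mapsto\sum_{x\in\Theta_d}x$ in degree $2$. Let $Q$ be the quotient of the graded Mackey ring $\underline{\mathbb Z}[a_d,u_d : d\mid n,\ d>1]$ (whose generators lie at $\Theta_1$, in degrees $|a_d|=\lambda_d$ and $|u_d|=\lambda_d-2$) by the Mackey ideal generated by the following relations: * (Euler class relations) for every $d\mid n$ with $d>1$, the restriction of $a_d$ to $\Theta_d$ is zero: $(p_{\Theta_d\to\Theta_1})^*(a_d)=0$; * (gold relations) for all $d,e\mid n$ with $d,e>1$, $\ \frac{d}{(d,e)}\,a_d u_e=\frac{e}{(d,e)}\,a_e u_d$ at $\Theta_1$. Then there is a unique map of graded $\underline{\mathbb Z}$-algebras from $Q$ to $\underline H^\star$ that sends each $a_d$ to $a_d$ and each $u_d$ to $u_d$, and this map is an isomorphism at every orbit $\Theta_e$, $e\mid n$, in every degree $m+\sum_d v_d\lambda_d$ with $m\in\mathbb Z$ and all $v_d\ge 0$. In other words, the positive cone of $\underline H^\star(pt;\underline{\mathbb Z})$ is $Q$. -/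

import Mathlib

open CategoryTheory
namespace Bredon
/-- The cyclic group `C_n`, written multiplicatively. -/
abbrev Cyc (n : ℕ) : Type := Multiplicative (ZMod n)
/-- The chosen generator of `C_n`. -/
def t (n : ℕ) : Cyc n := Multiplicative.ofAdd 1
/-- The orbit `Θ_d = C_n / ⟨t ^ d⟩`; for `d ∣ n` it has `d` elements. -/
abbrev Orb (n d : ℕ) : Type := Cyc n ⧸ Subgroup.zpowers (t n ^ d)

/-- The action of `C_n` on the free abelian group on a `C_n`-set `X`. -/
noncomputable def permRep (n : ℕ) (X : Type) [MulAction (Cyc n) X] :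
    Representation ℤ (Cyc n) (X →₀ ℤ) where
  toFun g := Finsupp.lmapDomain ℤ ℤ (g • ·)
  map_one' := by ext; simp
  map_mul' g h := by ext; simp [mul_smul]

/-- The permutation module `ℤ⟨X⟩` of a `C_n`-set `X`. -/
noncomputable abbrev perm (n : ℕ) (X : Type) [MulAction (Cyc n) X] : Rep.{0} ℤ (Cyc n) :=
  Rep.of (permRep n X)

/-- The category `𝓑ℤ`: its objects are the orbits `Θ_d`, `d ∣ n`, and the morphisms from `Θ_b` to `Θ_c`
are the `ℤ[C_n]`-linear maps `ℤ⟨Θ_b⟩ → ℤ⟨Θ_c⟩`. A map of orbits acts by restriction, and its transpose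
acts by transfer. -/
abbrev BZ (n : ℕ) : Type :=
  InducedCategory (Rep.{0} ℤ (Cyc n)) (fun d : n.divisors => perm n (Orb n d))

/-- `ℤ`-modules: additive contravariant functors from `𝓑ℤ` to abelian groups. -/
abbrev ZModule (n : ℕ) : Type 1 := (BZ n)ᵒᵖ ⥤+ AddCommGrpCat.{0}

section
open Limits
variable {C : Type} [Category.{0} C] [Preadditive C]

lemma additive_of_mono {F G : C ⥤ AddCommGrpCat.{0}} (i : F ⟶ G) [Mono i] (hG : G.Additive) :
    F.Additive where
  map_add {X Y f g} := by
    have : Mono (i.app Y) := inferInstance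
    rw [← cancel_mono (i.app Y)]
    simp [Preadditive.add_comp, NatTrans.naturality, Functor.map_add]

lemma additive_of_epi {F G : C ⥤ AddCommGrpCat.{0}} (i : F ⟶ G) [Epi i] (hF : F.Additive) :
    G.Additive where
  map_add {X Y f g} := by
    have : Epi (i.app X) := inferInstance
    rw [← cancel_epi (i.app X)]
    simp [Preadditive.comp_add, ← NatTrans.naturality, Functor.map_add]

instance : (additiveFunctor C AddCommGrpCat.{0}).IsClosedUnderSubobjects where
  prop_of_mono i _ h := additive_of_mono i h

instance : (additiveFunctor C AddCommGrpCat.{0}).IsClosedUnderQuotients where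
  prop_of_epi i _ h := additive_of_epi i h

instance : (additiveFunctor C AddCommGrpCat.{0}).ContainsZero where
  exists_zero := ⟨_, isZero_zero _, .of_isZero (isZero_zero _)⟩

instance : (additiveFunctor C AddCommGrpCat.{0}).IsClosedUnderFiniteProducts where
  isClosedUnderLimitsOfShape J _ :=
    { limitsOfShape_le := by
        rintro F ⟨h⟩
        refine ⟨fun {X Y f g} => ?_⟩
        have hl := isLimitOfPreserves ((evaluation C AddCommGrpCat.{0}).obj Y) h.isLimit
        refine hl.hom_ext fun j => ?_
        have hj : (h.diag.obj j).Additive := h.prop_diag_obj j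
        change F.map (f + g) ≫ (h.π.app j).app Y = (F.map f + F.map g) ≫ (h.π.app j).app Y
        simp only [Preadditive.add_comp, NatTrans.naturality, Functor.map_add,
          Preadditive.comp_add] }
end

noncomputable instance (n : ℕ) : Abelian (ZModule n) :=
  inferInstanceAs (Abelian (additiveFunctor (BZ n)ᵒᵖ AddCommGrpCat.{0}).FullSubcategory)
noncomputable instance (n : ℕ) : HasDerivedCategory.{1} (ZModule n) := HasDerivedCategory.standard _

/-- The `ℤ`-module `Θ ↦ Hom_{ℤ[C_n]}(ℤ⟨Θ⟩, V)`. On `V = ℤ⟨Θ_d⟩` it is the representable module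
`F_{Θ_d} = 𝓑ℤ(-, Θ_d)`, on `V = ℤ⟨X⟩` for a `C_n`-set `X` it is `F_X`, the sum of the `F_Θ` over the orbits
`Θ` of `X`; `F_{Θ_1}` is the constant module `ℤ`. -/
noncomputable def freeModule (n : ℕ) : Rep.{0} ℤ (Cyc n) ⥤ ZModule n :=
  ObjectProperty.lift _
    (preadditiveYoneda ⋙ (Functor.whiskeringLeft _ _ _).obj
      (inducedFunctor fun d : n.divisors => perm n (Orb n d)).op)
    (fun V => by
      rw [additiveFunctor_iff]; dsimp; infer_instance)
instance (n : ℕ): (freeModule n).Additive where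

section cells
variable (n : ℕ)

/-- Basis elements of the complex `S^{λ_d} = (F_{Θ_d} → F_{Θ_d} → ℤ)`, which sits in homological degrees
`2`, `1`, `0`: the point in degree `0`, the rays in degree `1` and the sectors in degree `2`. -/
inductive Cell (d : ℕ) : Type
  | pt : Cell d
  | ray (x : Orb n d) : Cell d
  | sec (x : Orb n d) : Cell d

variable {n}
namespace Cell
variable {d : ℕ}

def dim : Cell n d → ℕ
  | pt => 0
  | ray _ => 1
  | sec _ => 2

/-- The action of `C_n` on the basis. -/
def smul (g : Cyc n) : Cell n d → Cell n d
  | pt => pt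
  | ray x => ray (g • x)
  | sec x => sec (g • x)

instance : MulAction (Cyc n) (Cell n d) where
  smul := smul
  one_smul x := by cases x <;> simp [HSMul.hSMul, smul] <;> exact one_smul _ _
  mul_smul g h x := by cases x <;> simp [HSMul.hSMul, smul] <;> exact mul_smul _ _ _

@[simp] lemma smul_pt (g : Cyc n) : g • (pt : Cell n d) = pt := rfl
@[simp] lemma smul_ray (g : Cyc n) (x : Orb n d) : g • (ray x : Cell n d) = ray (g • x) := rfl
@[simp] lemma smul_sec (g : Cyc n) (x : Orb n d) : g • (sec x : Cell n d) = sec (g • x) := rfl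
@[simp] lemma dim_pt : (pt : Cell n d).dim = 0 := rfl
@[simp] lemma dim_ray (x : Orb n d) : (ray x : Cell n d).dim = 1 := rfl
@[simp] lemma dim_sec (x : Orb n d) : (sec x : Cell n d).dim = 2 := rfl
@[simp] lemma dim_smul (g : Cyc n) (x : Cell n d) : (g • x).dim = x.dim := by cases x <;> rfl

/-- The differential of `S^{λ_d}`: in degree `2` it is `id - t`, in degree `1` it is the projection to
`ℤ`. -/
noncomputable def bdry : Cell n d → (Cell n d →₀ ℤ)
  | pt => 0
  | ray _ => Finsupp.single pt 1
  | sec x => Finsupp.single (ray x) 1 - Finsupp.single (ray (t n • x)) 1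

lemma bdry_smul (g : Cyc n) (x : Cell n d) :
    bdry (g • x) = (bdry x).mapDomain (g • ·) := by
  cases x <;> simp [bdry, Finsupp.mapDomain_single, Finsupp.mapDomain_sub, smul_smul, mul_comm]

end Cell

/-- The divisors `d > 1` of `n`. -/
abbrev Dv (n : ℕ) : Type := ↥(n.divisors.erase 1)

/-- The box factors of `S^v`, where `v = ∑ v_d λ_d`: there are `v_d` factors `S^{λ_d}`. -/
abbrev Factors (v : Dv n → ℕ) : Type := Σ d : Dv n, Fin (v d)

/-- The basis of `S^v`: the product over all factors of the bases. This encodes the box product of the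
complexes `S^{λ_d}`, since the box product of `ℤ`-modules satisfies `F_X □ F_Y = F_{X × Y}`. -/
abbrev Cells (v : Dv n → ℕ) : Type := ∀ i : Factors v, Cell n i.1

/-- The total homological degree. -/
def Cells.dim {v : Dv n → ℕ} (x : Cells v) : ℕ := ∑ i, (x i).dim

/-- The order of the factors: increasing in the divisor `d`, then by the index. -/
def Before {v : Dv n → ℕ} (i j : Factors v) : Prop := i.1 < j.1 ∨ (i.1 = j.1 ∧ (i.2 : ℕ) < j.2)

instance {v : Dv n → ℕ} (i j : Factors v) : Decidable (Before i j) :=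
  inferInstanceAs (Decidable (_ ∨ _))

/-- The Koszul sign that a differential picks up when it moves past the factors before `i`. -/
def koszul {v : Dv n → ℕ} (i : Factors v) (x : Cells v) : ℤ :=
  ∏ j, if Before j i then (-1) ^ (x j).dim else 1

/-- The differential applied to the factor `i`, without sign. -/
noncomputable def faceMap {v : Dv n → ℕ} (i : Factors v) : (Cells v →₀ ℤ) →ₗ[ℤ] (Cells v →₀ ℤ) :=
  Finsupp.linearCombination ℤ fun x => (x i).bdry.mapDomain (Function.update x i)

/-- Multiplication of each basis element by its Koszul sign at the factor `i`. -/
noncomputable def koszulMap {v : Dv n → ℕ} (i : Factors v) :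
    (Cells v →₀ ℤ) →ₗ[ℤ] (Cells v →₀ ℤ) :=
  Finsupp.linearCombination ℤ fun x => Finsupp.single x (koszul i x)

/-- The differential of the tensor product of the complexes. -/
noncomputable def bd (v : Dv n → ℕ) : (Cells v →₀ ℤ) →ₗ[ℤ] (Cells v →₀ ℤ) :=
  ∑ i, faceMap i ∘ₗ koszulMap i

end cells

section chains
variable {n : ℕ} {v w : Dv n → ℕ}

lemma Cell.dim_of_mem_bdry {d : ℕ} {x c : Cell n d} (h : c ∈ x.bdry.support) :
    c.dim + 1 = x.dim := by
  classical
  cases x with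
  | pt => simp [Cell.bdry] at h
  | ray y =>
    have := Finsupp.support_single_subset h
    simp at this; subst this; rfl
  | sec y =>
    have h2 := Finsupp.support_sub h
    simp only [Finset.mem_union] at h2
    clear h
    rcases h2 with h | h
    all_goals
      have := Finsupp.support_single_subset h
      simp at this; subst this; rfl

lemma koszul_update (i j : Factors v) (x : Cells v) {c : Cell n j.1}
    (h : c.dim + 1 = (x j).dim) :
    koszul i (Function.update x j c) = (if Before j i then -1 else 1) * koszul i x := by
  unfold koszul
  rw [← Finset.mul_prod_erase _ _ (Finset.mem_univ j),
    ← Finset.mul_prod_erase (a := j) _ (fun k => if Before k i then (-1 : ℤ) ^ (x k).dim else 1)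
      (Finset.mem_univ j), ← mul_assoc]
  congr 1
  · rw [← h]; simp only [Function.update_self]; split_ifs <;> simp [pow_succ]
  · refine Finset.prod_congr rfl fun k hk => ?_
    rw [Function.update_of_ne (Finset.ne_of_mem_erase hk)]

lemma faceMap_single (i : Factors v) (x : Cells v) :
    faceMap i (Finsupp.single x 1) = (x i).bdry.mapDomain (Function.update x i) := by
  simp [faceMap]

lemma koszulMap_single (i : Factors v) (x : Cells v) (a : ℤ) :
    koszulMap i (Finsupp.single x a) = Finsupp.single x (a * koszul i x) := by
  simp [koszulMap]

lemma koszulMap_comp_faceMap (i j : Factors v) :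
    koszulMap i ∘ₗ faceMap j =
      (if Before j i then -1 else 1 : ℤ) • (faceMap j ∘ₗ koszulMap i) := by
  ext1 x
  ext1
  simp only [LinearMap.comp_apply, Finsupp.lsingle_apply, LinearMap.smul_apply, faceMap_single,
    koszulMap_single, one_mul]
  rw [show Finsupp.single x (koszul i x) = koszul i x • Finsupp.single x 1 by simp, map_smul,
    faceMap_single, Finsupp.mapDomain, map_finsuppSum, Finsupp.smul_sum, Finsupp.smul_sum]
  refine Finsupp.sum_congr fun c hc => ?_
  rw [koszulMap_single, koszul_update i j x (Cell.dim_of_mem_bdry hc)]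
  split_ifs <;> simp [mul_comm]

lemma koszulMap_comm (i j : Factors v) :
    koszulMap i ∘ₗ koszulMap j = koszulMap j ∘ₗ koszulMap i := by
  ext1 x
  ext1
  simp only [LinearMap.comp_apply, Finsupp.lsingle_apply, koszulMap_single, one_mul,
    mul_comm (koszul i x)]

lemma faceMap_comm {i j : Factors v} (h : i ≠ j) :
    faceMap i ∘ₗ faceMap j = faceMap j ∘ₗ faceMap i := by
  ext1 x
  ext1
  simp only [LinearMap.comp_apply, Finsupp.lsingle_apply, faceMap_single]
  cases hi : x i <;> cases hj : x j <;>
    simp [Cell.bdry, hi, hj, Finsupp.mapDomain_single, Finsupp.mapDomain_sub, map_sub,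
      faceMap_single, Function.update_of_ne h, Function.update_of_ne h.symm,
      Function.update_comm h, Finsupp.mapDomain_zero]
  abel

lemma faceMap_self (i : Factors v) : faceMap i ∘ₗ faceMap i = 0 := by
  ext1 x
  ext1
  simp only [LinearMap.comp_apply, Finsupp.lsingle_apply, faceMap_single]
  cases hi : x i <;>
    simp [Cell.bdry, Finsupp.mapDomain_single, Finsupp.mapDomain_sub, map_sub,
      faceMap_single, Finsupp.mapDomain_zero]

lemma before_asymm {i j : Factors v} (h : Before i j) : ¬ Before j i := by
  rintro h'
  rcases h with h | ⟨h, h2⟩ <;> rcases h' with h' | ⟨h', h2'⟩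
  · exact lt_asymm h h'
  · exact h.ne h'.symm
  · exact h'.ne h.symm
  · omega

lemma before_total {i j : Factors v} (h : i ≠ j) : Before i j ∨ Before j i := by
  obtain ⟨d, a⟩ := i
  obtain ⟨e, b⟩ := j
  rcases lt_trichotomy d e with hd | rfl | hd
  · exact Or.inl (Or.inl hd)
  · rcases lt_trichotomy (a : ℕ) b with hd | hd | hd
    · exact Or.inl (Or.inr ⟨rfl, hd⟩)
    · exact absurd (by rw [Fin.ext hd]) h
    · exact Or.inr (Or.inr ⟨rfl, hd⟩)
  · exact Or.inr (Or.inl hd)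

lemma bd_comp_bd : bd v ∘ₗ bd v = 0 := by
  classical
  have key : ∀ i j : Factors v, (faceMap i ∘ₗ koszulMap i) ∘ₗ (faceMap j ∘ₗ koszulMap j) +
      (faceMap j ∘ₗ koszulMap j) ∘ₗ (faceMap i ∘ₗ koszulMap i) = 0 := by
    intro i j
    have e : ∀ i j : Factors v, (faceMap i ∘ₗ koszulMap i) ∘ₗ (faceMap j ∘ₗ koszulMap j) =
        (if Before j i then -1 else 1 : ℤ) •
          ((faceMap i ∘ₗ faceMap j) ∘ₗ (koszulMap i ∘ₗ koszulMap j)) := by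
      intro i j
      have h := koszulMap_comp_faceMap i j
      refine LinearMap.ext fun x => ?_
      have h' := congr($h (koszulMap j x))
      simp only [LinearMap.comp_apply, LinearMap.smul_apply] at h' ⊢
      rw [h', map_smul]
    rw [e i j, e j i]
    rcases eq_or_ne i j with rfl | h
    · simp [faceMap_self]
    · rw [faceMap_comm h, koszulMap_comm i j]
      rcases before_total h with h' | h'
      · simp [h', before_asymm h']
      · simp [h', before_asymm h']
  have h2 : bd v ∘ₗ bd v + bd v ∘ₗ bd v = 0 := by
    have e : bd v ∘ₗ bd v = ∑ i, ∑ j, (faceMap i ∘ₗ koszulMap i) ∘ₗ (faceMap j ∘ₗ koszulMap j) := by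
      refine LinearMap.ext fun x => ?_
      simp only [bd, LinearMap.sum_apply, LinearMap.comp_apply, map_sum]
      exact Finset.sum_comm
    have e' := e
    rw [Finset.sum_comm] at e'
    nth_rewrite 1 [e]
    rw [e', ← Finset.sum_add_distrib]
    refine Finset.sum_eq_zero fun i _ => ?_
    rw [← Finset.sum_add_distrib]
    exact Finset.sum_eq_zero fun j _ => key i j
  ext x y
  have := congr($h2 (Finsupp.single x 1) y)
  simp only [LinearMap.add_apply, LinearMap.zero_apply, Finsupp.add_apply,
    Finsupp.zero_apply] at this
  simp only [LinearMap.comp_apply, Finsupp.lsingle_apply, LinearMap.zero_apply,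
    Finsupp.zero_apply] at this ⊢
  omega
end chains

section complex
variable {n : ℕ} {v w : Dv n → ℕ}

lemma Cells.dim_smul (g : Cyc n) (x : Cells v) : (g • x).dim = x.dim := by
  simp [Cells.dim]

/-- The basis elements of cohomological degree `m`, i.e. of homological degree `-m`. -/
abbrev CellsDeg (v : Dv n → ℕ) (m : ℤ) : Type := {x : Cells v // -(x.dim : ℤ) = m}

instance (v : Dv n → ℕ) (m : ℤ) : MulAction (Cyc n) (CellsDeg v m) where
  smul g x := ⟨g • x.1, by rw [Cells.dim_smul]; exact x.2⟩
  one_smul x := Subtype.ext (one_smul _ x.1)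
  mul_smul g h x := Subtype.ext (mul_smul g h x.1)

@[simp] lemma CellsDeg.coe_smul {m : ℤ} (g : Cyc n) (x : CellsDeg v m) :
    ((g • x : CellsDeg v m) : Cells v) = g • (x : Cells v) := rfl

/-- The inclusion of degree `m` into the total module. -/
noncomputable def incl (v : Dv n → ℕ) (m : ℤ) : (CellsDeg v m →₀ ℤ) →ₗ[ℤ] (Cells v →₀ ℤ) :=
  Finsupp.lmapDomain ℤ ℤ Subtype.val

/-- The projection of the total module onto degree `m`. -/
noncomputable def proj (v : Dv n → ℕ) (m : ℤ) : (Cells v →₀ ℤ) →ₗ[ℤ] (CellsDeg v m →₀ ℤ) :=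
  Finsupp.lcomapDomain Subtype.val Subtype.val_injective

lemma proj_apply (m : ℤ) (a : Cells v →₀ ℤ) (x : CellsDeg v m) : proj v m a x = a x.1 := rfl

lemma incl_single (m : ℤ) (x : CellsDeg v m) (r : ℤ) :
    incl v m (Finsupp.single x r) = Finsupp.single x.1 r := by
  simp [incl]

lemma proj_incl (m : ℤ) (a : CellsDeg v m →₀ ℤ) : proj v m (incl v m a) = a := by
  ext x
  rw [proj_apply]
  exact Finsupp.mapDomain_apply Subtype.val_injective _ _

lemma incl_proj {m : ℤ} {a : Cells v →₀ ℤ} (h : ∀ x ∈ a.support, -(x.dim : ℤ) = m) :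
    incl v m (proj v m a) = a := by
  exact Finsupp.mapDomain_comapDomain _ Subtype.val_injective _
    (fun x hx => ⟨⟨x, h x hx⟩, rfl⟩)

lemma proj_eq_zero {m : ℤ} {a : Cells v →₀ ℤ} (h : ∀ x ∈ a.support, -(x.dim : ℤ) ≠ m) :
    proj v m a = 0 := by
  ext x
  rw [proj_apply]
  by_contra hx
  exact h x.1 (Finsupp.mem_support_iff.2 hx) x.2

lemma incl_support {m : ℤ} (a : CellsDeg v m →₀ ℤ) {x : Cells v} (h : x ∈ (incl v m a).support) :
    -(x.dim : ℤ) = m := by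
  classical
  have := Finsupp.mapDomain_support h
  obtain ⟨y, -, rfl⟩ := Finset.mem_image.1 this
  exact y.2

lemma Cells.dim_update (x : Cells v) (i : Factors v) {c : Cell n i.1}
    (h : c.dim + 1 = (x i).dim) : Cells.dim (Function.update x i c) + 1 = x.dim := by
  unfold Cells.dim
  rw [← Finset.add_sum_erase _ _ (Finset.mem_univ i),
    ← Finset.add_sum_erase (a := i) _ (fun k => (x k).dim) (Finset.mem_univ i), ← h]
  rw [Finset.sum_congr rfl fun k hk => by
    rw [Function.update_of_ne (Finset.ne_of_mem_erase hk)]]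
  simp only [Function.update_self]
  omega

lemma bd_single_support (x : Cells v) {y : Cells v}
    (h : y ∈ (bd v (Finsupp.single x 1)).support) : y.dim + 1 = x.dim := by
  classical
  simp only [bd, LinearMap.sum_apply, LinearMap.comp_apply, koszulMap_single, one_mul] at h
  obtain ⟨i, -, hi⟩ := Finset.mem_biUnion.1 (Finsupp.support_finsetSum h)
  rw [show Finsupp.single x (koszul i x) = koszul i x • Finsupp.single x 1 by simp, map_smul,
    faceMap_single] at hi
  obtain ⟨c, hc, rfl⟩ := Finset.mem_image.1 (Finsupp.mapDomain_support (Finsupp.support_smul hi))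
  exact Cells.dim_update x i (Cell.dim_of_mem_bdry hc)

lemma bd_support {a : Cells v →₀ ℤ} {m : ℤ} (h : ∀ x ∈ a.support, -(x.dim : ℤ) = m)
    {y : Cells v} (hy : y ∈ (bd v a).support) : -(y.dim : ℤ) = m + 1 := by
  classical
  rw [← Finsupp.sum_single a, map_finsuppSum] at hy
  obtain ⟨x, hx, hi⟩ := Finset.mem_biUnion.1 (Finsupp.support_finsetSum hy)
  change y ∈ (bd v (Finsupp.single x (a x))).support at hi
  rw [show Finsupp.single x (a x) = a x • Finsupp.single x 1 by simp, map_smul] at hi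
  have := bd_single_support x (Finsupp.support_smul hi)
  have := h x hx
  omega

lemma permRep_single {X : Type} [MulAction (Cyc n) X] (g : Cyc n) (x : X) (r : ℤ) :
    permRep n X g (Finsupp.single x r) = Finsupp.single (g • x) r := by
  simp [permRep]

lemma koszul_smul (g : Cyc n) (i : Factors v) (x : Cells v) : koszul i (g • x) = koszul i x := by
  simp [koszul]

lemma bd_permRep (g : Cyc n) (a : Cells v →₀ ℤ) :
    bd v (permRep n (Cells v) g a) = permRep n (Cells v) g (bd v a) := by
  have : bd v ∘ₗ permRep n (Cells v) g = permRep n (Cells v) g ∘ₗ bd v := by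
    ext1 x
    ext1
    simp only [LinearMap.comp_apply, Finsupp.lsingle_apply, permRep_single]
    simp only [bd, LinearMap.sum_apply, LinearMap.comp_apply, koszulMap_single, one_mul, map_sum]
    refine Finset.sum_congr rfl fun i _ => ?_
    have e : ∀ y : Cells v, Finsupp.single y (koszul i y) = koszul i y • Finsupp.single y 1 := by
      simp
    rw [e, e, map_smul, map_smul, map_smul, koszul_smul, faceMap_single, faceMap_single]
    congr 1
    rw [Pi.smul_apply, Cell.bdry_smul]
    simp only [permRep, MonoidHom.coe_mk, OneHom.coe_mk, Finsupp.lmapDomain_apply]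
    rw [← Finsupp.mapDomain_comp, ← Finsupp.mapDomain_comp]
    congr 1
    funext c j
    by_cases hj : j = i
    · subst hj; simp
    · simp [Function.update_of_ne hj]
  exact congr($this a)

lemma incl_permRep (g : Cyc n) (m : ℤ) (a : CellsDeg v m →₀ ℤ) :
    incl v m (permRep n _ g a) = permRep n _ g (incl v m a) := by
  simp only [permRep, incl, MonoidHom.coe_mk, OneHom.coe_mk, Finsupp.lmapDomain_apply]
  rw [← Finsupp.mapDomain_comp, ← Finsupp.mapDomain_comp]
  rfl

lemma proj_permRep (g : Cyc n) (m : ℤ) (a : Cells v →₀ ℤ) :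
    proj v m (permRep n _ g a) = permRep n _ g (proj v m a) := by
  have h : ∀ (X : Type) [MulAction (Cyc n) X] (b : X →₀ ℤ) (x : X),
      permRep n X g b x = b (g⁻¹ • x) := by
    intro X _ b x
    have := Finsupp.mapDomain_apply (MulAction.injective g) b (g⁻¹ • x)
    rwa [smul_inv_smul] at this
  ext x
  rw [proj_apply, h, h, proj_apply]
  rfl

/-- The component of the differential from degree `m` to degree `m'`. -/
noncomputable def diff (v : Dv n → ℕ) (m m' : ℤ) :
    perm n (CellsDeg v m) ⟶ perm n (CellsDeg v m') :=
  Rep.ofHom ⟨proj v m' ∘ₗ bd v ∘ₗ incl v m, fun g => by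
    refine LinearMap.ext fun a => ?_
    simp only [LinearMap.comp_apply]
    rw [incl_permRep, bd_permRep, proj_permRep]⟩

lemma diff_apply (m m' : ℤ) (a : CellsDeg v m →₀ ℤ) :
    (diff v m m').hom a = proj v m' (bd v (incl v m a)) := rfl

lemma incl_diff (m : ℤ) (a : CellsDeg v m →₀ ℤ) :
    incl v (m + 1) ((diff v m (m + 1)).hom a) = bd v (incl v m a) :=
  incl_proj fun _ hx => bd_support (fun _ hy => incl_support a hy) hx

/-- The tensor product of the complexes `ℤ⟨Θ_d⟩ → ℤ⟨Θ_d⟩ → ℤ` over all factors of `v`, as a cochain complex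
of permutation modules (homological degree `k` is cohomological degree `-k`). -/
noncomputable def sphere (v : Dv n → ℕ) : CochainComplex (Rep.{0} ℤ (Cyc n)) ℤ where
  X m := perm n (CellsDeg v m)
  d m m' := diff v m m'
  shape m m' h := by
    ext1
    refine Representation.IntertwiningMap.ext (LinearMap.ext fun a => ?_)
    refine proj_eq_zero fun x hx hx' => h ?_
    rw [ComplexShape.up_Rel, ← hx', ← bd_support (fun _ hy => incl_support a hy) hx]
  d_comp_d' i j k hij hjk := by
    obtain rfl := hij
    obtain rfl := hjk
    ext1
    refine Representation.IntertwiningMap.ext (LinearMap.ext fun a => ?_)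
    change (diff v (i + 1) (i + 1 + 1)).hom ((diff v i (i + 1)).hom a) = 0
    rw [diff_apply, incl_diff]
    rw [show bd v (bd v (incl v i a)) = 0 from congr($(bd_comp_bd) _), map_zero]

end complex

section product
variable {n : ℕ} {v w : Dv n → ℕ}

/-- The basis element of `S^{v + w}` that corresponds to a pair of basis elements of `S^v` and `S^w`. -/
def merge (x : Cells v) (y : Cells w) : Cells (v + w) := fun i =>
  Fin.addCases (motive := fun _ => Cell n i.1) (fun a => x ⟨i.1, a⟩) (fun b => y ⟨i.1, b⟩) i.2

/-- The Koszul sign of the isomorphism `S^v □ S^w ≅ S^{v + w}` that interchanges the factors: each factor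
`i` of `S^v` is moved past the factors `j` of `S^w` that precede it in the order of the divisors. -/
def shuffleSign (x : Cells v) (y : Cells w) : ℤ :=
  ∏ i, ∏ j, if j.1 < i.1 then (-1) ^ ((x i).dim * (y j).dim) else 1

/-- The isomorphism `S^v □ S^w ≅ S^{v + w}` on basis elements. -/
noncomputable def mulTot (v w : Dv n → ℕ) :
    (Cells v →₀ ℤ) →ₗ[ℤ] (Cells w →₀ ℤ) →ₗ[ℤ] (Cells (v + w) →₀ ℤ) :=
  Finsupp.linearCombination ℤ fun x =>
    Finsupp.linearCombination ℤ fun y => Finsupp.single (merge x y) (shuffleSign x y)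

lemma mulTot_single (x : Cells v) (y : Cells w) (a b : ℤ) :
    mulTot v w (Finsupp.single x a) (Finsupp.single y b) =
      Finsupp.single (merge x y) (a * b * shuffleSign x y) := by
  simp only [mulTot, Finsupp.linearCombination_single, LinearMap.smul_apply, Finsupp.smul_single,
    smul_eq_mul, mul_assoc]

/-- A factor of `S^v`, as a factor of `S^{v + w}`. -/
abbrev inl (w : Dv n → ℕ) (i : Factors v) : Factors (v + w) := ⟨i.1, Fin.castAdd (w i.1) i.2⟩
/-- A factor of `S^w`, as a factor of `S^{v + w}`. -/
abbrev inr (v : Dv n → ℕ) (j : Factors w) : Factors (v + w) := ⟨j.1, Fin.natAdd (v j.1) j.2⟩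

@[simp] lemma merge_inl (x : Cells v) (y : Cells w) (i : Factors v) :
    merge x y (inl w i) = x i := by
  simp [merge, inl]

@[simp] lemma merge_inr (x : Cells v) (y : Cells w) (j : Factors w) :
    merge x y (inr v j) = y j := by
  simp [merge, inr]

lemma inl_or_inr (k : Factors (v + w)) : (∃ i, k = inl w i) ∨ ∃ j, k = inr v j := by
  obtain ⟨d, k⟩ := k
  refine Fin.addCases (m := v d) (n := w d) (fun a => ?_) (fun b => ?_) k
  · exact Or.inl ⟨⟨d, a⟩, rfl⟩
  · exact Or.inr ⟨⟨d, b⟩, rfl⟩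

lemma inl_injective : Function.Injective (inl w : Factors v → Factors (v + w)) := by
  rintro ⟨d, a⟩ ⟨e, b⟩ h
  obtain rfl : d = e := congrArg Sigma.fst h
  simpa [inl] using h

lemma inr_injective : Function.Injective (inr v : Factors w → Factors (v + w)) := by
  rintro ⟨d, a⟩ ⟨e, b⟩ h
  obtain rfl : d = e := congrArg Sigma.fst h
  simpa [inr] using h

lemma inl_ne_inr (i : Factors v) (j : Factors w) : inl w i ≠ inr v j := by
  obtain ⟨d, a⟩ := i
  obtain ⟨e, b⟩ := j
  intro h
  obtain rfl : d = e := congrArg Sigma.fst h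
  simp only [inl, inr, Sigma.mk.injEq, heq_eq_eq, true_and] at h
  have := congrArg Fin.val h
  simp only [Fin.val_castAdd, Fin.val_natAdd] at this
  have := a.2
  omega

lemma sum_factors {M : Type} [AddCommMonoid M] (f : Factors (v + w) → M) :
    ∑ k, f k = ∑ i, f (inl w i) + ∑ j, f (inr v j) := by
  rw [Fintype.sum_sigma, Fintype.sum_sigma, Fintype.sum_sigma, ← Finset.sum_add_distrib]
  exact Finset.sum_congr rfl fun d _ => Fin.sum_univ_add (a := v d) (b := w d) _

lemma prod_factors {M : Type} [CommMonoid M] (f : Factors (v + w) → M) :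
    ∏ k, f k = (∏ i, f (inl w i)) * ∏ j, f (inr v j) := by
  rw [Fintype.prod_sigma, Fintype.prod_sigma, Fintype.prod_sigma, ← Finset.prod_mul_distrib]
  exact Finset.prod_congr rfl fun d _ => Fin.prod_univ_add (a := v d) (b := w d) _

lemma Cells.dim_merge (x : Cells v) (y : Cells w) : (merge x y).dim = x.dim + y.dim := by
  simp [Cells.dim, sum_factors]

lemma merge_update_left (x : Cells v) (y : Cells w) (i : Factors v) (c : Cell n i.1) :
    Function.update (merge x y) (inl w i) c = merge (Function.update x i c) y := by
  funext k
  rcases inl_or_inr k with ⟨a, rfl⟩ | ⟨b, rfl⟩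
  · rw [merge_inl]
    by_cases h : a = i
    · subst h; simp
    · rw [Function.update_of_ne (inl_injective.ne h), Function.update_of_ne h, merge_inl]
  · rw [Function.update_of_ne (inl_ne_inr _ _).symm, merge_inr, merge_inr]

lemma merge_update_right (x : Cells v) (y : Cells w) (j : Factors w) (c : Cell n j.1) :
    Function.update (merge x y) (inr v j) c = merge x (Function.update y j c) := by
  funext k
  rcases inl_or_inr k with ⟨a, rfl⟩ | ⟨b, rfl⟩
  · rw [Function.update_of_ne (inl_ne_inr _ _), merge_inl, merge_inl]
  · rw [merge_inr]
    by_cases h : b = j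
    · subst h; simp
    · rw [Function.update_of_ne (inr_injective.ne h), Function.update_of_ne h, merge_inr]

lemma before_inl_inl (a i : Factors v) : Before (inl w a) (inl w i) ↔ Before a i := Iff.rfl

lemma before_inr_inr (a i : Factors w) : Before (inr v a) (inr v i) ↔ Before a i := by
  obtain ⟨d, a⟩ := a
  obtain ⟨e, b⟩ := i
  simp only [Before, inr, Fin.val_natAdd]
  constructor <;> rintro (h | ⟨h, h'⟩)
  · exact Or.inl h
  · subst h; exact Or.inr ⟨rfl, by omega⟩
  · exact Or.inl h
  · subst h; exact Or.inr ⟨rfl, by omega⟩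

lemma before_inr_inl (j : Factors w) (i : Factors v) :
    Before (inr v j) (inl w i) ↔ j.1 < i.1 := by
  obtain ⟨d, a⟩ := j
  obtain ⟨e, b⟩ := i
  simp only [Before, inr, inl, Fin.val_natAdd, Fin.val_castAdd]
  constructor
  · rintro (h | ⟨h, h'⟩)
    · exact h
    · subst h; have := b.2; omega
  · exact Or.inl

lemma before_inl_inr (i : Factors v) (j : Factors w) :
    Before (inl w i) (inr v j) ↔ i.1 ≤ j.1 := by
  obtain ⟨d, a⟩ := j
  obtain ⟨e, b⟩ := i
  simp only [Before, inr, inl, Fin.val_natAdd, Fin.val_castAdd]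
  constructor
  · rintro (h | ⟨h, h'⟩)
    · exact h.le
    · exact h.le
  · intro h
    rcases h.lt_or_eq with h | h
    · exact Or.inl h
    · subst h; have := b.2; exact Or.inr ⟨rfl, by omega⟩

lemma koszul_inl (x : Cells v) (y : Cells w) (i : Factors v) :
    koszul (inl w i) (merge x y) =
      koszul i x * ∏ j, if j.1 < i.1 then (-1) ^ (y j).dim else 1 := by
  simp only [koszul, prod_factors, merge_inl, merge_inr, before_inl_inl, before_inr_inl]

lemma koszul_inr (x : Cells v) (y : Cells w) (j : Factors w) :
    koszul (inr v j) (merge x y) =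
      (∏ i, if i.1 ≤ j.1 then (-1) ^ (x i).dim else 1) * koszul j y := by
  simp only [koszul, prod_factors, merge_inl, merge_inr, before_inl_inr, before_inr_inr]

lemma shuffleSign_update_left (x : Cells v) (y : Cells w) (i : Factors v) {c : Cell n i.1}
    (h : c.dim + 1 = (x i).dim) :
    shuffleSign (Function.update x i c) y =
      shuffleSign x y * ∏ j, if j.1 < i.1 then (-1) ^ (y j).dim else 1 := by
  unfold shuffleSign
  rw [← Finset.mul_prod_erase _ _ (Finset.mem_univ i),
    ← Finset.mul_prod_erase (a := i) _
      (fun i => ∏ j, if j.1 < i.1 then (-1 : ℤ) ^ ((x i).dim * (y j).dim) else 1)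
      (Finset.mem_univ i), mul_right_comm]
  congr 1
  · rw [← Finset.prod_mul_distrib, ← h]
    refine Finset.prod_congr rfl fun j _ => ?_
    simp only [Function.update_self]
    split_ifs
    · rw [add_mul, one_mul, pow_add, mul_assoc, ← pow_add, ← two_mul, pow_mul]
      simp
    · simp
  · refine Finset.prod_congr rfl fun k hk => ?_
    rw [Function.update_of_ne (Finset.ne_of_mem_erase hk)]

lemma shuffleSign_update_right (x : Cells v) (y : Cells w) (j : Factors w) {c : Cell n j.1}
    (h : c.dim + 1 = (y j).dim) :
    shuffleSign x (Function.update y j c) =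
      shuffleSign x y * ∏ i, if j.1 < i.1 then (-1) ^ (x i).dim else 1 := by
  unfold shuffleSign
  rw [← Finset.prod_mul_distrib]
  refine Finset.prod_congr rfl fun i _ => ?_
  rw [← Finset.mul_prod_erase _ _ (Finset.mem_univ j),
    ← Finset.mul_prod_erase (a := j) _
      (fun j => if j.1 < i.1 then (-1 : ℤ) ^ ((x i).dim * (y j).dim) else 1)
      (Finset.mem_univ j), mul_right_comm]
  congr 1
  · rw [← h]
    simp only [Function.update_self]
    split_ifs
    · rw [mul_add, mul_one, pow_add, mul_assoc, ← pow_add, ← two_mul, pow_mul (-1 : ℤ) 2]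
      simp
    · simp
  · refine Finset.prod_congr rfl fun k hk => ?_
    rw [Function.update_of_ne (Finset.ne_of_mem_erase hk)]

lemma single_eq_smul {X : Type} (x : X) (r : ℤ) :
    (Finsupp.single x r : X →₀ ℤ) = r • Finsupp.single x 1 := by simp

lemma bd_mulTot_single (x : Cells v) (y : Cells w) :
    bd (v + w) (mulTot v w (Finsupp.single x 1) (Finsupp.single y 1)) =
      mulTot v w (bd v (Finsupp.single x 1)) (Finsupp.single y 1) +
        (-1) ^ x.dim • mulTot v w (Finsupp.single x 1) (bd w (Finsupp.single y 1)) := by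
  rw [mulTot_single, one_mul, one_mul, single_eq_smul, map_smul]
  simp only [bd, LinearMap.sum_apply, sum_factors, LinearMap.comp_apply, koszulMap_single,
    one_mul, map_sum, LinearMap.add_apply]
  rw [smul_add, Finset.smul_sum, Finset.smul_sum, Finset.smul_sum]
  congr 1
  · refine Finset.sum_congr rfl fun i _ => ?_
    rw [single_eq_smul (merge x y), map_smul, single_eq_smul x, map_smul, map_smul,
      LinearMap.smul_apply, faceMap_single, faceMap_single, merge_inl]
    simp only [Finsupp.mapDomain, map_finsuppSum, Finsupp.smul_sum]
    rw [Finsupp.sum, Finsupp.sum, LinearMap.sum_apply, Finset.smul_sum]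
    refine Finset.sum_congr rfl fun c hc => ?_
    rw [mulTot_single, merge_update_left, shuffleSign_update_left x y i (Cell.dim_of_mem_bdry hc),
      koszul_inl]
    simp only [Finsupp.smul_single, smul_eq_mul]
    congr 1
    ring
  · refine Finset.sum_congr rfl fun j _ => ?_
    rw [single_eq_smul (merge x y), map_smul, single_eq_smul y, map_smul, map_smul,
      faceMap_single, faceMap_single, merge_inr]
    simp only [Finsupp.mapDomain, map_finsuppSum, Finsupp.smul_sum]
    refine Finset.sum_congr rfl fun c hc => ?_
    dsimp only
    rw [mulTot_single, merge_update_right,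
      shuffleSign_update_right x y j (Cell.dim_of_mem_bdry hc), koszul_inr]
    simp only [Finsupp.smul_single, smul_eq_mul]
    congr 1
    have hx : ((-1 : ℤ) ^ x.dim) = (∏ i, if i.1 ≤ j.1 then (-1) ^ (x i).dim else 1) *
        ∏ i, if j.1 < i.1 then (-1) ^ (x i).dim else 1 := by
      rw [Cells.dim, ← Finset.prod_pow_eq_pow_sum, ← Finset.prod_mul_distrib]
      refine Finset.prod_congr rfl fun i _ => ?_
      by_cases h : i.1 ≤ j.1
      · simp [h, not_lt.2 h]
      · simp [h, not_le.1 h]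
    have hR : (∏ i : Factors v, if j.1 < i.1 then (-1 : ℤ) ^ (x i).dim else 1) *
        (∏ i, if j.1 < i.1 then (-1) ^ (x i).dim else 1) = 1 := by
      rw [← Finset.prod_mul_distrib]
      refine Finset.prod_eq_one fun i _ => ?_
      split_ifs
      · rw [← pow_add, ← two_mul, pow_mul]; simp
      · simp
    rw [hx]
    linear_combination (-(shuffleSign x y * koszul j y * (y j).bdry c *
      (∏ i : Factors v, if i.1 ≤ j.1 then (-1 : ℤ) ^ (x i).dim else 1))) * hR

/-- The interchange isomorphism is a chain map (Leibniz rule). -/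
lemma bd_mulTot {m : ℤ} {a : Cells v →₀ ℤ} (ha : ∀ x ∈ a.support, -(x.dim : ℤ) = m)
    (b : Cells w →₀ ℤ) :
    bd (v + w) (mulTot v w a b) =
      mulTot v w (bd v a) b + (m.negOnePow : ℤ) • mulTot v w a (bd w b) := by
  have h1 : ∀ x ∈ a.support, bd (v + w) (mulTot v w (Finsupp.single x 1) b) =
      mulTot v w (bd v (Finsupp.single x 1)) b +
        (m.negOnePow : ℤ) • mulTot v w (Finsupp.single x 1) (bd w b) := by
    intro x hx
    have hs : ((-1 : ℤ) ^ x.dim) = (m.negOnePow : ℤ) := by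
      rw [← ha x hx, Int.negOnePow_neg]; simp [Int.negOnePow]
    induction b using Finsupp.induction_linear with
    | zero => simp
    | add f g hf hg => simp only [map_add, hf, hg, smul_add]; abel
    | single y r =>
      rw [single_eq_smul y]
      simp only [map_smul, bd_mulTot_single, hs, smul_add, smul_comm r]
  rw [← Finsupp.sum_single a]
  simp only [map_finsuppSum]
  simp only [Finsupp.sum, LinearMap.sum_apply, map_sum, Finset.smul_sum]
  rw [← Finset.sum_add_distrib]
  refine Finset.sum_congr rfl fun x hx => ?_
  rw [single_eq_smul]
  simp only [map_smul, LinearMap.smul_apply, h1 x hx, smul_add, smul_comm (a x)]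

lemma mulTot_support {m m' : ℤ} {a : Cells v →₀ ℤ} {b : Cells w →₀ ℤ}
    (ha : ∀ x ∈ a.support, -(x.dim : ℤ) = m) (hb : ∀ x ∈ b.support, -(x.dim : ℤ) = m')
    {z : Cells (v + w)} (hz : z ∈ (mulTot v w a b).support) : -(z.dim : ℤ) = m + m' := by
  classical
  rw [← Finsupp.sum_single a, ← Finsupp.sum_single b] at hz
  simp only [Finsupp.sum, LinearMap.sum_apply, map_sum, mulTot_single] at hz
  obtain ⟨x, hx, hi⟩ := Finset.mem_biUnion.1 (Finsupp.support_finsetSum hz)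
  obtain ⟨y, hy, hi⟩ := Finset.mem_biUnion.1 (Finsupp.support_finsetSum hi)
  obtain rfl := Finset.mem_singleton.1 (Finsupp.support_single_subset hi)
  have := ha _ ‹_›
  have := hb _ ‹_›
  rw [Cells.dim_merge]
  push_cast
  omega

lemma mulTot_permRep (g : Cyc n) (a : Cells v →₀ ℤ) (b : Cells w →₀ ℤ) :
    mulTot v w (permRep n _ g a) (permRep n _ g b) = permRep n _ g (mulTot v w a b) := by
  induction a using Finsupp.induction_linear with
  | zero => simp
  | add f h hf hg => simp only [map_add, LinearMap.add_apply, hf, hg]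
  | single x r =>
    induction b using Finsupp.induction_linear with
    | zero => simp
    | add f h hf hg => simp only [map_add, hf, hg]
    | single y s =>
      simp only [permRep_single, mulTot_single]
      congr 1
      · funext k
        rcases inl_or_inr k with ⟨a, rfl⟩ | ⟨b, rfl⟩ <;> simp
      · simp [shuffleSign]

end product

section derived
open Limits

section
variable {C : Type 1} [Category.{0} C] [Abelian C]

lemma single_isKProjective {P : C} [Projective P] (m : ℤ) :
    CochainComplex.IsKProjective
      ((HomologicalComplex.single C (ComplexShape.up ℤ) m).obj P) := by
  have : ∀ k, Projective (((HomologicalComplex.single C (ComplexShape.up ℤ) m).obj P).X k) := by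
    intro k
    by_cases h : k = m
    · subst h
      exact Projective.of_iso (HomologicalComplex.singleObjXSelf _ k P).symm inferInstance
    · exact ⟨fun f e _ => ⟨0, (HomologicalComplex.isZero_single_obj_X _ _ P k h).eq_of_src _ _⟩⟩
  have : CochainComplex.IsStrictlyLE
      ((HomologicalComplex.single C (ComplexShape.up ℤ) m).obj P) m := by
    rw [CochainComplex.isStrictlyLE_iff]
    intro k hk
    exact HomologicalComplex.isZero_single_obj_X _ _ P k hk.ne'
  exact CochainComplex.isKProjective_of_projective _ m

variable [HasDerivedCategory.{1} C]

lemma Q_map_eq_zero_iff {K L : CochainComplex C ℤ} [K.IsKProjective] (f : K ⟶ L) :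
    DerivedCategory.Q.map f = 0 ↔ (HomotopyCategory.quotient C _).map f = 0 := by
  have h := DerivedCategory.quotientCompQhIso_hom_naturality f
  constructor
  · intro hf
    apply (CochainComplex.IsKProjective.Qh_map_bijective K _).injective
    rw [← cancel_mono ((DerivedCategory.quotientCompQhIso C).hom.app L), Functor.map_zero,
      zero_comp]
    rw [hf, comp_zero] at h
    exact h
  · intro hf
    rw [hf, Functor.map_zero, zero_comp] at h
    rw [← cancel_epi ((DerivedCategory.quotientCompQhIso C).hom.app K), ← h, comp_zero]

lemma exists_rep {P : C} [Projective P] {K : CochainComplex C ℤ} {m : ℤ}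
    (x : DerivedCategory.Q.obj ((HomologicalComplex.single C (ComplexShape.up ℤ) m).obj P) ⟶
      DerivedCategory.Q.obj K) :
    ∃ (φ : P ⟶ K.X m) (h : ∀ j, (ComplexShape.up ℤ).Rel m j → φ ≫ K.d m j = 0),
      DerivedCategory.Q.map (HomologicalComplex.mkHomFromSingle φ h) = x := by
  have := single_isKProjective (P := P) m
  obtain ⟨g, hg⟩ := (CochainComplex.IsKProjective.Qh_map_bijective
    ((HomologicalComplex.single C (ComplexShape.up ℤ) m).obj P)
    ((HomotopyCategory.quotient C _).obj K)).surjective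
    ((DerivedCategory.quotientCompQhIso C).hom.app _ ≫ x ≫
      (DerivedCategory.quotientCompQhIso C).inv.app K)
  obtain ⟨f, rfl⟩ := (HomotopyCategory.quotient C _).map_surjective g
  have h := DerivedCategory.quotientCompQhIso_hom_naturality f
  rw [hg] at h
  refine ⟨(HomologicalComplex.singleObjXSelf (ComplexShape.up ℤ) m P).inv ≫ f.f m, ?_, ?_⟩
  · intro j _
    rw [Category.assoc, f.comm, HomologicalComplex.single_obj_d, zero_comp, comp_zero]
  · have e : HomologicalComplex.mkHomFromSingle
        ((HomologicalComplex.singleObjXSelf (ComplexShape.up ℤ) m P).inv ≫ f.f m) (by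
          intro j _
          rw [Category.assoc, f.comm, HomologicalComplex.single_obj_d, zero_comp,
            comp_zero]) = f :=
      HomologicalComplex.from_single_hom_ext (by simp)
    rw [e, ← cancel_epi ((DerivedCategory.quotientCompQhIso C).hom.app _), ← h]
    erw [Category.assoc, Category.assoc, Iso.inv_hom_id_app, Category.comp_id]

lemma map_eq_zero_iff {P : C} [Projective P] {K : CochainComplex C ℤ} {m m' : ℤ}
    (hm : m + 1 = m') (φ : P ⟶ K.X m')
    (h : ∀ j, (ComplexShape.up ℤ).Rel m' j → φ ≫ K.d m' j = 0) :
    DerivedCategory.Q.map (HomologicalComplex.mkHomFromSingle φ h) = 0 ↔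
      ∃ ψ : P ⟶ K.X m, φ = ψ ≫ K.d m m' := by
  have := single_isKProjective (P := P) m'
  have hr : (ComplexShape.up ℤ).Rel m m' := hm
  rw [Q_map_eq_zero_iff]
  constructor
  · intro h0
    have H := HomotopyCategory.homotopyOfEq (HomologicalComplex.mkHomFromSingle φ h) 0
      (by rw [h0, Functor.map_zero])
    have hc := H.comm m'
    rw [dNext_eq H.hom (i' := m' + 1) rfl, prevD_eq H.hom hr, HomologicalComplex.single_obj_d,
      zero_comp, zero_add, HomologicalComplex.zero_f, add_zero,
      HomologicalComplex.mkHomFromSingle_f] at hc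
    refine ⟨(HomologicalComplex.singleObjXSelf (ComplexShape.up ℤ) m' P).inv ≫ H.hom m' m, ?_⟩
    rw [Category.assoc, ← hc, Iso.inv_hom_id_assoc]
  · rintro ⟨ψ, rfl⟩
    rw [← Functor.map_zero (HomotopyCategory.quotient C _)]
    apply HomotopyCategory.eq_of_homotopy
    refine { hom := fun i j => if hij : i = m' ∧ j = m then
               (HomologicalComplex.singleObjXIsoOfEq _ _ P i hij.1).hom ≫ ψ ≫
                (K.XIsoOfEq hij.2).inv else 0
             zero := fun i j hij => dif_neg ?_
             comm := fun i => ?_ }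
    · rintro ⟨rfl, rfl⟩
      exact hij hr
    · by_cases hi : i = m'
      · subst hi
        rw [dNext_eq _ (i' := i + 1) rfl, prevD_eq _ hr, HomologicalComplex.single_obj_d, zero_comp,
          zero_add, HomologicalComplex.zero_f, add_zero, HomologicalComplex.mkHomFromSingle_f]
        simp
        rfl
      · exact (HomologicalComplex.isZero_single_obj_X _ _ P i hi).eq_of_src _ _
end

variable {n : ℕ}

lemma freeModule_full (e : n.divisors) (V : Rep.{0} ℤ (Cyc n))
    (φ : (freeModule n).obj (perm n (Orb n e)) ⟶ (freeModule n).obj V) :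
    ∃ f, (freeModule n).map f = φ := by
  let f : perm n (Orb n e) ⟶ V :=
    (φ.hom.app (Opposite.op (e : BZ n))).hom (𝟙 (perm n (Orb n e)))
  refine ⟨f, ?_⟩
  apply ObjectProperty.hom_ext
  ext b g
  change g ≫ f = _
  let g' : b.unop ⟶ (e : BZ n) := ⟨g⟩
  have h := congr(($(φ.hom.naturality g'.op)).hom (𝟙 (perm n (Orb n e))))
  change (φ.hom.app b).hom (g ≫ 𝟙 (perm n (Orb n e))) = g ≫ f at h
  rw [← h]
  exact congrArg _ (Category.comp_id (show perm n (Orb n b.unop.1) ⟶ perm n (Orb n e) from g)).symm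

lemma freeModule_faithful (e : n.divisors) {V : Rep.{0} ℤ (Cyc n)}
    {f g : perm n (Orb n e) ⟶ V} (h : (freeModule n).map f = (freeModule n).map g) : f = g := by
  have key := congr((($h).hom.app (Opposite.op (e : BZ n))).hom (𝟙 (perm n (Orb n e))))
  change 𝟙 (perm n (Orb n e)) ≫ f = 𝟙 (perm n (Orb n e)) ≫ g at key
  simpa only [Category.id_comp] using key

/-- The map from a representable `ℤ`-module given by an element. -/
noncomputable def ofElement (e : n.divisors) (E : ZModule n)
    (y : E.obj.obj (Opposite.op (e : BZ n))) : (freeModule n).obj (perm n (Orb n e)) ⟶ E :=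
  have := (additiveFunctor_iff _).1 E.property
  ObjectProperty.homMk
    { app b := AddCommGrpCat.ofHom
        { toFun g := (E.obj.map (Quiver.Hom.op (⟨g⟩ : b.unop ⟶ (e : BZ n)))).hom y
          map_zero' := congr(($(E.obj.map_zero (Opposite.op (e : BZ n)) b)).hom y)
          map_add' g h := congr(($(E.obj.map_add (f := Quiver.Hom.op (⟨g⟩ : b.unop ⟶ (e : BZ n)))
            (g := Quiver.Hom.op (⟨h⟩ : b.unop ⟶ (e : BZ n))))).hom y) }
      naturality b c f := by
        ext g
        exact congr(($(E.obj.map_comp (Quiver.Hom.op (⟨g⟩ : b.unop ⟶ (e : BZ n))) f)).hom y) }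

lemma ofElement_id (e : n.divisors) (E : ZModule n)
    (f : (freeModule n).obj (perm n (Orb n e)) ⟶ E) :
    ofElement e E ((f.hom.app (Opposite.op (e : BZ n))).hom (𝟙 (perm n (Orb n e)))) = f := by
  apply ObjectProperty.hom_ext
  ext b g
  let g' : b.unop ⟶ (e : BZ n) := ⟨g⟩
  have h := congr(($(f.hom.naturality g'.op)).hom (𝟙 (perm n (Orb n e))))
  exact h.symm.trans
    (congrArg _ (Category.comp_id (show perm n (Orb n b.unop.1) ⟶ perm n (Orb n e) from g)))

instance (e : n.divisors) : Projective ((freeModule n).obj (perm n (Orb n e))) where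
  factors {E X} φ q _ := by
    have : (additiveFunctor (BZ n)ᵒᵖ AddCommGrpCat.{0}).ι.PreservesEpimorphisms :=
      ObjectProperty.preservesEpimorphisms_ι_of_isNormalMonoCategory _
    have h1 : Epi q.hom := inferInstanceAs
      (Epi ((additiveFunctor (BZ n)ᵒᵖ AddCommGrpCat.{0}).ι.map q))
    have h2 : Epi (q.hom.app (Opposite.op (e : BZ n))) := inferInstance
    obtain ⟨y, hy⟩ := (AddCommGrpCat.epi_iff_surjective _).1 h2
      ((φ.hom.app (Opposite.op (e : BZ n))).hom (𝟙 (perm n (Orb n e))))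
    refine ⟨ofElement e _ y, ?_⟩
    rw [← ofElement_id e _ φ, ← ofElement_id e _ (ofElement e _ y ≫ q)]
    congr 1
    refine Eq.trans ?_ hy
    exact congrArg (q.hom.app (Opposite.op (e : BZ n))).hom
      congr(($(E.obj.map_id (Opposite.op (e : BZ n)))).hom y)

/-- The degrees `m + ∑ v_d λ_d` with `m ∈ ℤ` and all `v_d ≥ 0`: the positive cone. The sum is over the
divisors `d > 1` of `n`. -/
abbrev Deg (n : ℕ) : Type := ℤ × (Dv n → ℕ)

/-- The complex `S^v` of `ℤ`-modules, the box product of `v_d` copies of `S^{λ_d}` for all `d`. -/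
noncomputable abbrev repSphere (v : Dv n → ℕ) : CochainComplex (ZModule n) ℤ :=
  ((freeModule n).mapHomologicalComplex (ComplexShape.up ℤ)).obj (sphere v)

/-- The free `ℤ`-module `F_Θ` on the orbit `Θ = Θ_e`. -/
noncomputable abbrev freeOn (e : n.divisors) : ZModule n := (freeModule n).obj (perm n (Orb n e))

/-- `H^α(Θ) = D(ℤ)(Σ^{-m} F_Θ, S^v)` for `α = m + ∑ v_d λ_d` and `Θ = Θ_e`, as the group of morphisms in the
derived category of `ℤ`-modules. -/
noncomputable abbrev H (α : Deg n) (e : n.divisors) : Type 1 :=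
  DerivedCategory.Q.obj ((HomologicalComplex.single (ZModule n) (ComplexShape.up ℤ) α.1).obj (freeOn e)) ⟶
    DerivedCategory.Q.obj (repSphere α.2)

/-- The action of morphisms in `𝓑ℤ` on `H^α`, by precomposition. -/
noncomputable def Hpull (α : Deg n) {a b : BZ n} (f : a ⟶ b) : H α b →+ H α a where
  toFun x := DerivedCategory.Q.map ((HomologicalComplex.single (ZModule n) (ComplexShape.up ℤ) α.1).map
    ((freeModule n).map f.hom)) ≫ x
  map_zero' := comp_zero
  map_add' _ _ := Preadditive.comp_add _ _ _ _ _ _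

/-- Equivariant cocycles: they represent the chain maps `Σ^{-m} F_Θ → S^v`. -/
noncomputable def Cocycles (α : Deg n) (e : n.divisors) :
    AddSubgroup (perm n (Orb n e) ⟶ perm n (CellsDeg α.2 α.1)) where
  carrier := {z | z ≫ diff α.2 α.1 (α.1 + 1) = 0}
  zero_mem' := zero_comp
  add_mem' {x y} hx hy := by
    rw [Set.mem_ofPred_eq] at *
    rw [Preadditive.add_comp, hx, hy, add_zero]
  neg_mem' {x} hx := by
    rw [Set.mem_ofPred_eq] at *
    rw [Preadditive.neg_comp, hx, neg_zero]

/-- A morphism `F_e → S^v` in cochain degree `m`, given by a cochain. -/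
noncomputable def modMap (α : Deg n) {e : n.divisors}
    (z : perm n (Orb n e) ⟶ perm n (CellsDeg α.2 α.1)) : freeOn e ⟶ (repSphere α.2).X α.1 :=
  (freeModule n).map z

lemma modMap_comp (α : Deg n) {e : n.divisors} (m : ℤ)
    (z : perm n (Orb n e) ⟶ perm n (CellsDeg α.2 α.1)) :
    modMap α z ≫ (repSphere α.2).d α.1 m = modMap (m, α.2) (z ≫ diff α.2 α.1 m) :=
  ((freeModule n).map_comp _ _).symm

/-- The morphism in the derived category represented by a cocycle. -/
noncomputable def cls {α : Deg n} {e : n.divisors} (z : Cocycles α e) : H α e :=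
  DerivedCategory.Q.map (HomologicalComplex.mkHomFromSingle (modMap α z.1) (by
      rintro _ rfl
      rw [modMap_comp, z.2]
      exact (freeModule n).map_zero _ _))

/-- Every class is represented by a cocycle, as `F_Θ` is projective. -/
lemma cls_surjective {α : Deg n} {e : n.divisors} :
    Function.Surjective (cls : Cocycles α e → H α e) := by
  intro x
  obtain ⟨φ, h, rfl⟩ := exists_rep x
  obtain ⟨f, rfl⟩ := freeModule_full e _ φ
  refine ⟨⟨f, freeModule_faithful e ?_⟩, rfl⟩
  exact (modMap_comp α (α.1 + 1) f).symm.trans ((h _ rfl).trans ((freeModule n).map_zero _ _).symm)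

lemma cls_sub {α : Deg n} {e : n.divisors} (z z' : Cocycles α e) :
    cls (z - z') = cls z - cls z' := by
  rw [cls, cls, cls, ← Functor.map_sub]
  congr 1
  apply HomologicalComplex.from_single_hom_ext
  rw [HomologicalComplex.sub_f_apply]
  simp only [HomologicalComplex.mkHomFromSingle_f, ← Preadditive.comp_sub]
  congr 1

/-- A cocycle represents zero if and only if it is a coboundary. -/
lemma cls_eq_zero_iff {α : Deg n} {e : n.divisors} {m : ℤ} (hm : m + 1 = α.1) (z : Cocycles α e) :
    cls z = 0 ↔ ∃ y : perm n (Orb n e) ⟶ perm n (CellsDeg α.2 m), z.1 = y ≫ diff α.2 m α.1 := by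
  rw [cls, map_eq_zero_iff hm]
  constructor
  · rintro ⟨ψ, h⟩
    obtain ⟨y, rfl⟩ := freeModule_full e _ ψ
    exact ⟨y, freeModule_faithful e (h.trans (modMap_comp (m, α.2) α.1 y))⟩
  · rintro ⟨y, h⟩
    exact ⟨modMap (m, α.2) y, by rw [h, modMap_comp]⟩

end derived

section products
variable {n : ℕ} {v w : Dv n → ℕ}

lemma perm_hom_ext {X Y : Type} [MulAction (Cyc n) X] [MulAction (Cyc n) Y]
    {f g : perm n X ⟶ perm n Y}
    (h : ∀ x, f.hom (Finsupp.single x 1) = g.hom (Finsupp.single x 1)) : f = g := by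
  ext1
  refine Representation.IntertwiningMap.ext (Finsupp.lhom_ext' fun x => LinearMap.ext_ring ?_)
  exact h x

/-- The equivariant map out of a permutation module with given values on the basis. -/
noncomputable def permLift {X : Type} [MulAction (Cyc n) X] {Y : Type} [MulAction (Cyc n) Y]
    (f : X → (Y →₀ ℤ)) (hf : ∀ (g : Cyc n) x, f (g • x) = permRep n Y g (f x)) :
    perm n X ⟶ perm n Y :=
  Rep.ofHom ⟨Finsupp.linearCombination ℤ f, fun g => by
    refine Finsupp.lhom_ext' fun x => LinearMap.ext_ring ?_
    simp only [LinearMap.comp_apply, Finsupp.lsingle_apply, permRep_single,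
      Finsupp.linearCombination_single, one_smul, hf]⟩

lemma permLift_single {X : Type} [MulAction (Cyc n) X] {Y : Type} [MulAction (Cyc n) Y]
    (f : X → (Y →₀ ℤ)) (hf : ∀ (g : Cyc n) x, f (g • x) = permRep n Y g (f x)) (x : X) :
    (permLift f hf).hom (Finsupp.single x 1) = f x :=
  (Finsupp.linearCombination_single ℤ 1 x).trans (one_smul _ _)

lemma perm_hom_smul {X : Type} [MulAction (Cyc n) X] {Y : Type} [MulAction (Cyc n) Y]
    (f : perm n X ⟶ perm n Y) (g : Cyc n) (x : X) :
    f.hom (Finsupp.single (g • x) 1) = permRep n Y g (f.hom (Finsupp.single x 1)) := by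
  rw [← permRep_single]
  exact congr($(f.hom.isIntertwining' g) (Finsupp.single x 1))

/-- The product of cochains `z : F_Θ → (S^v)_m` and `z' : F_Θ → (S^w)_m'`: the diagonal of `Θ` gives
`F_Θ → F_{Θ × Θ} = F_Θ □ F_Θ`, then `z □ z'` and `S^v □ S^w ≅ S^{v + w}` are applied. -/
noncomputable def prodCochain {e : n.divisors} {m m' : ℤ}
    (z : perm n (Orb n e) ⟶ perm n (CellsDeg v m)) (z' : perm n (Orb n e) ⟶ perm n (CellsDeg w m')) :
    perm n (Orb n e) ⟶ perm n (CellsDeg (v + w) (m + m')) :=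
  permLift (fun s => proj (v + w) (m + m') (mulTot v w
      (incl v m (z.hom (Finsupp.single s 1))) (incl w m' (z'.hom (Finsupp.single s 1)))))
    fun g s => by
      rw [perm_hom_smul, perm_hom_smul, incl_permRep,
        incl_permRep, mulTot_permRep, proj_permRep]

variable {e : n.divisors} {m m' : ℤ}

lemma prodCochain_single (z : perm n (Orb n e) ⟶ perm n (CellsDeg v m))
    (z' : perm n (Orb n e) ⟶ perm n (CellsDeg w m')) (s : Orb n e) :
    (prodCochain z z').hom (Finsupp.single s 1) = proj (v + w) (m + m') (mulTot v w
      (incl v m (z.hom (Finsupp.single s 1))) (incl w m' (z'.hom (Finsupp.single s 1)))) :=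
  permLift_single _ _ _

/-- The Leibniz rule. -/
lemma prodCochain_diff {m₁ m₁' m₂ : ℤ} (h : m + 1 = m₁) (h' : m' + 1 = m₁') (h₂ : m + m' + 1 = m₂)
    (z : perm n (Orb n e) ⟶ perm n (CellsDeg v m))
    (z' : perm n (Orb n e) ⟶ perm n (CellsDeg w m')) (s : Orb n e) :
    (prodCochain z z' ≫ diff (v + w) (m + m') m₂).hom (Finsupp.single s 1) =
      proj (v + w) m₂
        (mulTot v w (incl v m₁ ((z ≫ diff v m m₁).hom (Finsupp.single s 1)))
            (incl w m' (z'.hom (Finsupp.single s 1))) +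
          (m.negOnePow : ℤ) • mulTot v w (incl v m (z.hom (Finsupp.single s 1)))
            (incl w m₁' ((z' ≫ diff w m' m₁').hom (Finsupp.single s 1)))) := by
  subst h h' h₂
  change (diff (v + w) (m + m') _).hom ((prodCochain z z').hom (Finsupp.single s 1)) =
    proj (v + w) (m + m' + 1)
        (mulTot v w (incl v (m + 1) ((diff v m (m + 1)).hom (z.hom (Finsupp.single s 1))))
            (incl w m' (z'.hom (Finsupp.single s 1))) +
          (m.negOnePow : ℤ) • mulTot v w (incl v m (z.hom (Finsupp.single s 1)))
            (incl w (m' + 1) ((diff w m' (m' + 1)).hom (z'.hom (Finsupp.single s 1)))))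
  rw [incl_diff, incl_diff, ← bd_mulTot fun _ hx => incl_support _ hx, prodCochain_single,
    diff_apply, incl_proj]
  exact fun _ hx => mulTot_support (fun _ hy => incl_support _ hy) (fun _ hy => incl_support _ hy) hx

/-- The product of cocycles. -/
noncomputable def prodCocycle {α β : Deg n} (z : Cocycles α e) (z' : Cocycles β e) :
    Cocycles (α + β) e :=
  ⟨prodCochain z.1 z'.1, perm_hom_ext fun s => by
    refine (prodCochain_diff rfl rfl rfl z.1 z'.1 s).trans ?_
    rw [show z.1 ≫ _ = 0 from z.2, show z'.1 ≫ _ = 0 from z'.2]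
    change proj _ _ (mulTot _ _ (incl _ _ 0) _ + _ • mulTot _ _ _ (incl _ _ 0)) = 0
    simp⟩

/-- The product `H^α(Θ) × H^β(Θ) → H^{α + β}(Θ)`; see `mul_cls` for the independence of representatives. -/
noncomputable def mul {α β : Deg n} (x : H α e) (y : H β e) : H (α + β) e :=
  cls (prodCocycle (Function.surjInv cls_surjective x) (Function.surjInv cls_surjective y))

/-- Coboundaries form an ideal. -/
lemma cls_prodCocycle_eq_zero_left {α β : Deg n} {z : Cocycles α e} (z' : Cocycles β e)
    (h : cls z = 0) : cls (prodCocycle z z') = 0 := by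
  obtain ⟨a, v⟩ := α
  obtain ⟨b, w⟩ := β
  rw [cls_eq_zero_iff (m := a - 1) (by simp)] at h
  obtain ⟨y, hy⟩ := h
  rw [cls_eq_zero_iff (m := (a - 1) + b) (by change _ = a + b; ring)]
  refine ⟨prodCochain y z'.1, perm_hom_ext fun s => ?_⟩
  refine Eq.trans ?_ (prodCochain_diff (sub_add_cancel a 1) rfl (by change _ = a + b; ring) y z'.1 s).symm
  rw [z'.2, ← hy]
  change _ = proj _ _ (_ + _ • mulTot _ _ _ (incl _ _ 0))
  rw [map_zero, map_zero, smul_zero, add_zero]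
  exact prodCochain_single _ _ _

lemma cls_prodCocycle_eq_zero_right {α β : Deg n} (z : Cocycles α e) {z' : Cocycles β e}
    (h : cls z' = 0) : cls (prodCocycle z z') = 0 := by
  obtain ⟨a, v⟩ := α
  obtain ⟨b, w⟩ := β
  rw [cls_eq_zero_iff (m := b - 1) (by simp)] at h
  obtain ⟨y, hy⟩ := h
  rw [cls_eq_zero_iff (m := a + (b - 1)) (by change _ = a + b; ring)]
  refine ⟨(a.negOnePow : ℤ) • prodCochain z.1 y, perm_hom_ext fun s => ?_⟩
  rw [Preadditive.zsmul_comp]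
  refine Eq.trans ?_ (congrArg ((a.negOnePow : ℤ) • ·)
    (prodCochain_diff rfl (sub_add_cancel b 1) (by change _ = a + b; ring) z.1 y s).symm)
  rw [z.2, ← hy]
  change _ = _ • proj _ _ (mulTot _ _ (incl _ _ 0) _ + _)
  rw [map_zero, map_zero, LinearMap.zero_apply, zero_add, map_smul, smul_smul]
  rw [show (a.negOnePow : ℤ) * (a.negOnePow : ℤ) = 1 by
    rcases Int.even_or_odd a with h | h
    · simp [Int.negOnePow_even _ h]
    · simp [Int.negOnePow_odd _ h], one_smul]
  exact prodCochain_single _ _ _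

lemma prodCocycle_sub_left {α β : Deg n} (z₁ z₂ : Cocycles α e) (z' : Cocycles β e) :
    prodCocycle (z₁ - z₂) z' = prodCocycle z₁ z' - prodCocycle z₂ z' := by
  refine Subtype.ext (perm_hom_ext fun s => ?_)
  refine (prodCochain_single _ _ _).trans (Eq.trans ?_
    (congrArg₂ (· - ·) (prodCochain_single _ _ _) (prodCochain_single _ _ _)).symm)
  rw [← map_sub, ← LinearMap.sub_apply, ← map_sub, ← map_sub]
  rfl

lemma prodCocycle_sub_right {α β : Deg n} (z : Cocycles α e) (z₁ z₂ : Cocycles β e) :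
    prodCocycle z (z₁ - z₂) = prodCocycle z z₁ - prodCocycle z z₂ := by
  refine Subtype.ext (perm_hom_ext fun s => ?_)
  refine (prodCochain_single _ _ _).trans (Eq.trans ?_
    (congrArg₂ (· - ·) (prodCochain_single _ _ _) (prodCochain_single _ _ _)).symm)
  rw [← map_sub, ← map_sub, ← map_sub]
  rfl

/-- The product does not depend on the chosen cocycles. -/
lemma mul_cls {α β : Deg n} (z : Cocycles α e) (z' : Cocycles β e) :
    mul (cls z) (cls z') = cls (prodCocycle z z') := by
  have h := Function.surjInv_eq cls_surjective (cls z)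
  have h' := Function.surjInv_eq cls_surjective (cls z')
  rw [mul]
  generalize Function.surjInv cls_surjective (cls z) = y at *
  generalize Function.surjInv cls_surjective (cls z') = y' at *
  trans cls (prodCocycle z y')
  · rw [← sub_eq_zero, ← cls_sub] at h ⊢
    rw [← prodCocycle_sub_left]
    exact cls_prodCocycle_eq_zero_left _ h
  · rw [← sub_eq_zero, ← cls_sub] at h' ⊢
    rw [← prodCocycle_sub_right]
    exact cls_prodCocycle_eq_zero_right _ h'

end products

section generators
variable {n : ℕ}

lemma bd_single_pt (v : Dv n → ℕ) (r : ℤ) :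
    bd v (Finsupp.single (fun _ => Cell.pt) r) = 0 := by
  simp only [bd, LinearMap.sum_apply, LinearMap.comp_apply, koszulMap_single]
  refine Finset.sum_eq_zero fun i _ => ?_
  rw [single_eq_smul, map_smul, faceMap_single]
  simp [Cell.bdry]

/-- The inclusion `ℤ → S^v` of the degree `0` part, restricted to `Θ_e`. -/
noncomputable def pointCocycle (v : Dv n → ℕ) (e : n.divisors) : Cocycles (0, v) e :=
  ⟨permLift (fun _ => Finsupp.single ⟨fun _ => Cell.pt, by simp [Cells.dim]⟩ 1) fun g x => by
      rw [permRep_single]; rfl,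
    perm_hom_ext fun s => by
      refine (congrArg (diff v 0 (0 + 1)).hom (permLift_single _ _ s)).trans ?_
      rw [diff_apply, incl_single, bd_single_pt, map_zero]
      rfl⟩

instance [NeZero n] (d : ℕ) : Finite (Cell n d) :=
  Finite.of_injective (β := Unit ⊕ Orb n d ⊕ Orb n d)
    (fun c => match c with
      | .pt => .inl ()
      | .ray x => .inr (.inl x)
      | .sec x => .inr (.inr x))
    (by rintro (_ | _ | _) (_ | _ | _) h <;> simp_all)

lemma permRep_const (X : Type) [Finite X] [MulAction (Cyc n) X] (g : Cyc n) :
    permRep n X g (Finsupp.equivFunOnFinite.symm fun _ => 1) =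
      Finsupp.equivFunOnFinite.symm fun _ => 1 := by
  ext x
  have := Finsupp.mapDomain_apply (MulAction.injective g)
    (Finsupp.equivFunOnFinite.symm fun _ => (1 : ℤ) : X →₀ ℤ) (g⁻¹ • x)
  rw [smul_inv_smul] at this
  exact this

instance (d : Dv n) : Unique (Factors (Pi.single d 1)) where
  default := ⟨d, ⟨0, by simp⟩⟩
  uniq := by
    rintro ⟨d', i⟩
    obtain rfl : d' = d := by
      by_contra h
      exact absurd i.2 (by simp [Pi.single_eq_of_ne h])
    have : (i : ℕ) < 1 := i.2.trans_eq (Pi.single_eq_same _ _)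
    congr 1
    exact Fin.ext (by change (i : ℕ) = 0; omega)

/-- A sector, replaced by its initial ray. -/
def Cell.toRay {d : ℕ} : Cell n d → Cell n d
  | sec x => ray x
  | c => c

lemma bd_top {d : Dv n} (x : CellsDeg (Pi.single d 1) (-2)) :
    bd (Pi.single d 1) (Finsupp.single x.1 1) =
      Finsupp.single (fun i => (x.1 i).toRay) 1 -
        Finsupp.single (fun i => ((t n • x).1 i).toRay) 1 := by
  have hx : (x.1 default).dim = 2 := by
    have := x.2
    simp only [Cells.dim, Fintype.sum_unique] at this
    omega
  have hk : koszul default x.1 = 1 := by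
    simp [koszul, Before]
  have hu : ∀ (c : Cell n (default : Factors (Pi.single d 1 : Dv n → ℕ)).1)
      (y : Cells (Pi.single d 1 : Dv n → ℕ)), y default = c →
      Function.update x.1 default c = y := by
    rintro c y rfl
    funext i
    obtain rfl := Subsingleton.elim i default
    simp
  simp only [bd, Fintype.sum_unique, LinearMap.comp_apply, koszulMap_single, hk, one_mul,
    faceMap_single]
  cases h : x.1 default with
  | pt => simp [h] at hx
  | ray y => simp [h] at hx
  | sec y =>
    simp only [Cell.bdry, Finsupp.mapDomain_sub,
      Finsupp.mapDomain_single]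
    rw [hu (.ray y) (fun i => (x.1 i).toRay) (by simp [h, Cell.toRay]),
      hu (.ray (t n • y)) (fun i => ((t n • x).1 i).toRay) (by simp [h, Cell.toRay])]

lemma bd_sum_top [NeZero n] (d : Dv n) :
    bd (Pi.single d 1) (incl (Pi.single d 1) (-2) (Finsupp.equivFunOnFinite.symm fun _ => 1)) =
      0 := by
  have := Fintype.ofFinite (CellsDeg (Pi.single d 1 : Dv n → ℕ) (-2))
  have e : (Finsupp.equivFunOnFinite.symm fun _ => 1 :
      CellsDeg (Pi.single d 1 : Dv n → ℕ) (-2) →₀ ℤ) = ∑ x, Finsupp.single x 1 := by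
    classical
    ext x
    simp [Finsupp.finsetSum_apply, Finsupp.single_apply]
  rw [e]
  simp only [map_sum, incl_single, bd_top]
  rw [Finset.sum_sub_distrib, sub_eq_zero]
  exact (Equiv.sum_comp (MulAction.toPerm (t n))
    fun x : CellsDeg (Pi.single d 1 : Dv n → ℕ) (-2) =>
      (Finsupp.single (fun i => (x.1 i).toRay) 1 : Cells (Pi.single d 1 : Dv n → ℕ) →₀ ℤ)).symm

/-- The transfer `ℤ → F_{Θ_d}` into the degree `2` part of `S^{λ_d}`, restricted to `Θ_e`: the sum of all
sectors. -/
noncomputable def topCocycle [NeZero n] (d : Dv n) (e : n.divisors) :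
    Cocycles (-2, Pi.single d 1) e :=
  ⟨permLift (fun _ => Finsupp.equivFunOnFinite.symm fun _ => 1) fun g x => by rw [permRep_const],
    perm_hom_ext fun s => by
      refine (congrArg (diff _ (-2) (-2 + 1)).hom (permLift_single _ _ s)).trans ?_
      rw [diff_apply, bd_sum_top, map_zero]
      rfl⟩

end generators

section classes
variable (n : ℕ) [NeZero n]

/-- The one-point orbit `Θ_1`. -/
def onePoint : n.divisors := ⟨1, Nat.one_mem_divisors.2 (NeZero.ne n)⟩

variable {n}

/-- A divisor `d > 1`, as a divisor. -/
def Dv.toDivisor (d : Dv n) : n.divisors := ⟨d.1, Finset.mem_of_mem_erase d.2⟩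

/-- The unit of `H^⋆(Θ_e)`. -/
noncomputable def oneClass (e : n.divisors) : H (0 : Deg n) e := cls (pointCocycle 0 e)

/-- The Euler class `a_d ∈ H^{λ_d}(Θ_1)`, given by the inclusion `ℤ → S^{λ_d}`. -/
noncomputable def aClass (d : Dv n) : H (0, Pi.single d 1) (onePoint n) :=
  cls (pointCocycle _ _)

/-- The orientation class `u_d ∈ H^{λ_d - 2}(Θ_1)`, given by `Σ² ℤ → S^{λ_d}`. -/
noncomputable def uClass (d : Dv n) : H (-2, Pi.single d 1) (onePoint n) :=
  cls (topCocycle _ _)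

end classes

section presentation
variable {n : ℕ}

/-- The ring `ℤ[a_d, u_d : d ∣ n, d > 1]`; `Sum.inl d` is the index of `a_d`, and `Sum.inr d` that of `u_d`.
The free graded Mackey ring on these generators has this value at all orbits. -/
abbrev Poly (n : ℕ) : Type := MvPolynomial (Dv n ⊕ Dv n) ℤ

/-- The generator `a_d`. -/
noncomputable abbrev polyA (d : Dv n) : Poly n := MvPolynomial.X (Sum.inl d)
/-- The generator `u_d`. -/
noncomputable abbrev polyU (d : Dv n) : Poly n := MvPolynomial.X (Sum.inr d)

/-- The degrees `|a_d| = λ_d` and `|u_d| = λ_d - 2`. -/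
def wt : Dv n ⊕ Dv n → Deg n
  | .inl d => (0, Pi.single d 1)
  | .inr d => (-2, Pi.single d 1)

/-- The integer by which a morphism in `𝓑ℤ` acts on the constant module `ℤ`: the common sum of the
coefficients of the images of the basis elements. It is `1` for restrictions and the index for
transfers. -/
noncomputable def deg {a b : BZ n} (f : a ⟶ b) : ℤ :=
  (show Orb n b.1 →₀ ℤ from f.hom.hom (Finsupp.single ((1 : Cyc n) : Orb n a.1) 1)).sum fun _ c => c

/-- The Mackey ideal of `ℤ[a_d, u_d]` generated by the Euler class relations, that the restriction of
`a_d` to `Θ_d` is zero, and by the gold relations at `Θ_1`. -/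
inductive MemJ [NeZero n] : BZ n → Poly n → Prop
  | zero (e) : MemJ e 0
  | add {e p q} : MemJ e p → MemJ e q → MemJ e (p + q)
  | mul {e} (p) {q} : MemJ e q → MemJ e (p * q)
  | pull {a b} (f : a ⟶ b) {p} : MemJ b p → MemJ a (deg f • p)
  | euler (d : Dv n) : MemJ d.toDivisor (polyA d)
  | gold (d d' : Dv n) : MemJ (onePoint n)
      (((d.1 / Nat.gcd d.1 d'.1 : ℕ) : ℤ) • (polyA d * polyU d') -
        ((d'.1 / Nat.gcd d.1 d'.1 : ℕ) : ℤ) • (polyA d' * polyU d))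

variable [NeZero n]

/-- The value at `Θ_e` of the Mackey ideal of relations. -/
def J (e : BZ n) : Ideal (Poly n) where
  carrier := {p | MemJ e p}
  zero_mem' := .zero e
  add_mem' := .add
  smul_mem' p _ := .mul p

/-- The value at `Θ_e` of the quotient Mackey ring. -/
abbrev QRing (e : BZ n) : Type := Poly n ⧸ J e

/-- The part of degree `α` of the quotient Mackey ring at `Θ_e`. -/
noncomputable def QDeg (α : Deg n) (e : BZ n) : AddSubgroup (QRing e) :=
  ((MvPolynomial.weightedHomogeneousSubmodule ℤ wt α).toAddSubgroup).map
    (Ideal.Quotient.mk (J e)).toAddMonoidHom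

/-- The action of morphisms in `𝓑ℤ` on the quotient Mackey ring. -/
noncomputable def QPull (α : Deg n) {a b : BZ n} (f : a ⟶ b) : QDeg α b →+ QDeg α a :=
  AddMonoidHom.codRestrict ((QuotientAddGroup.map (J b).toAddSubgroup (J a).toAddSubgroup
    (deg f • AddMonoidHom.id (Poly n)) fun p hp => .pull f hp).comp (QDeg α b).subtype) _ (by
      rintro ⟨_, p, hp, rfl⟩
      exact ⟨deg f • p, Submodule.smul_mem _ _ hp, rfl⟩)

lemma QDeg_mul {α β : Deg n} {e : BZ n} (x : QDeg α e) (y : QDeg β e) :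
    x.1 * y.1 ∈ QDeg (α + β) e := by
  obtain ⟨_, p, hp, rfl⟩ := x
  obtain ⟨_, q, hq, rfl⟩ := y
  exact ⟨p * q, MvPolynomial.IsWeightedHomogeneous.mul hp hq, map_mul (Ideal.Quotient.mk (J e)) _ _⟩

/-- The product in the quotient Mackey ring. -/
noncomputable def QMul {α β : Deg n} {e : BZ n} (x : QDeg α e) (y : QDeg β e) : QDeg (α + β) e :=
  ⟨x.1 * y.1, QDeg_mul x y⟩

/-- The unit of the quotient Mackey ring. -/
noncomputable def QOne (e : BZ n) : QDeg (0 : Deg n) e :=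
  ⟨1, 1, MvPolynomial.isWeightedHomogeneous_one _ _, map_one (Ideal.Quotient.mk (J e))⟩

/-- The class of `a_d`. -/
noncomputable def QA (d : Dv n) : QDeg (0, Pi.single d 1) (onePoint n) :=
  ⟨_, polyA d, MvPolynomial.isWeightedHomogeneous_X _ _ _, rfl⟩

/-- The class of `u_d`. -/
noncomputable def QU (d : Dv n) : QDeg (-2, Pi.single d 1) (onePoint n) :=
  ⟨_, polyU d, MvPolynomial.isWeightedHomogeneous_X _ _ _, rfl⟩

/-- `φ` is a map of graded Mackey rings (graded `ℤ`-algebras) from the quotient ring to the positive cone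
of `H^⋆` that sends `a_d` to `a_d` and `u_d` to `u_d`. -/
structure IsGradedMap (φ : ∀ (α : Deg n) (e : n.divisors), QDeg α e →+ H α e) : Prop where
  pull (α : Deg n) {a b : BZ n} (f : a ⟶ b) (x : QDeg α b) :
    φ α a (QPull α f x) = Hpull α f (φ α b x)
  one (e : n.divisors) : φ 0 e (QOne e) = oneClass e
  mul (α β : Deg n) (e : n.divisors) (x : QDeg α e) (y : QDeg β e) :
    φ (α + β) e (QMul x y) = mul (φ α e x) (φ β e y)
  a (d : Dv n) : φ (0, Pi.single d 1) (onePoint n) (QA d) = aClass d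
  u (d : Dv n) : φ (-2, Pi.single d 1) (onePoint n) (QU d) = uClass d

end presentation

end Bredon

/-! Since F_Θ is projective, `H α e` is a homology group of the chains of S^v fixed by t^e.
Evaluation at the base point of Θ_e turns cocycles into cycles in `inv e v`, and a class vanishes
exactly when this cycle lies in `bnd e v` (`cls_eq_zero_iff_mem_bnd`). A monomial in the a_d and u_d
corresponds under `Phi` to a product of points (one for each a_d) and of full sums of sectors (one
for each u_d). The theorem thus says that these cycles generate the homology of the fixed points,
and that a homogeneous polynomial with bounding cycle lies in `J e`.

The relations hold for geometric reasons (`Phi_mem_bnd`). Over Θ_d the point of S^{λ_d} bounds a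
fixed ray. The gold relation is bounded by a sum over the diagonal t-orbit in Θ_d × Θ_{d'}, of
length lcm(d, d') (`gold_mem_bnd`). The case d = d' shows that the order of equal factors does not
matter (`theta_sub_mem_bnd`), so `Phi` is multiplicative up to boundaries.

For the converse, one prime p is treated at a time. When n = e·p^c, the group generated by t^e is a
p-group, and the factors λ_d can be added in the order of the p-adic valuation of d. Then the
stabilizers of the points of the last Θ_d act trivially on the earlier factors S^w
(`stabilizer_trivial`), which permits equivariant choices over Θ_d. Because the underlying homology
of S^w is ℤ, generated by the sum of its top cells (`exists_eq_smul_theta_top`),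
`cone_decomposition` yields two facts, both in `chain_decomposition`. A fixed cycle of S^w □ S^{λ_d}
is, up to boundaries, a cycle of S^w times the point plus a multiple of the top class. If a cycle ξ
of S^w becomes a boundary after multiplication by the point, then ξ is, up to a boundary, a multiple
of d/(d,e) times the top class of S^w.

Generation follows by induction (`exists_Phi_of_cycle`). For injectivity, the gold relations rewrite
a polynomial, up to an integer prime to p, as q'·a_d plus a multiple of the product of the u's
(`exists_reduction`). If it bounds, that multiple is zero and the cycle of q' is a multiple of
d/(d,e) times the top class, and d/(d,e)·a_d is in `J e`, being a transfer of the Euler relation.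
This gives `exists_smul_mem_J`. Transfers from the Sylow p-subgroup, of index prime to p, and
`mem_of_forall_prime` assemble the primes. Uniqueness holds because restrictions of the generators
generate at every orbit. -/

namespace Bredon

/-! ### Orbits of the cyclic group and functions on them -/

section orbits
variable {n d : ℕ}

/-- The point `t ^ i` of the orbit `Θ_d`. -/
def orbPt (n d i : ℕ) : Orb n d := ((t n ^ i : Cyc n) : Orb n d)

lemma t_pow_eq_one_iff (k : ℕ) : t n ^ k = 1 ↔ n ∣ k := by
  rw [t, ← ofAdd_nsmul, ofAdd_eq_one, nsmul_one, ZMod.natCast_eq_zero_iff]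

lemma exists_t_pow [NeZero n] (g : Cyc n) : ∃ i : ℕ, t n ^ i = g :=
  ⟨(Multiplicative.toAdd g).val, by
    rw [t, ← ofAdd_nsmul, nsmul_one, ZMod.natCast_zmod_val, ofAdd_toAdd]⟩

lemma smul_orbPt (k i : ℕ) : t n ^ k • orbPt n d i = orbPt n d (k + i) := by
  rw [orbPt, orbPt, pow_add]; rfl

lemma t_smul_orbPt (i : ℕ) : t n • orbPt n d i = orbPt n d (i + 1) := by
  rw [add_comm, ← smul_orbPt, pow_one]

lemma orbPt_surjective [NeZero n] (o : Orb n d) : ∃ i, orbPt n d i = o := by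
  obtain ⟨g, rfl⟩ := QuotientGroup.mk_surjective o
  obtain ⟨i, rfl⟩ := exists_t_pow g
  exact ⟨i, rfl⟩

lemma t_pow_smul_of_dvd [NeZero n] {k : ℕ} (h : d ∣ k) (o : Orb n d) : t n ^ k • o = o := by
  obtain ⟨i, rfl⟩ := orbPt_surjective o
  obtain ⟨j, rfl⟩ := h
  rw [smul_orbPt, orbPt, orbPt, QuotientGroup.eq]
  refine ⟨-j, ?_⟩
  rw [add_comm, pow_add, pow_mul]
  simp

lemma orbPt_eq_of_modEq [NeZero n] {i j : ℕ} (h : i ≡ j [MOD d]) : orbPt n d i = orbPt n d j := by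
  wlog hij : i ≤ j generalizing i j
  · exact (this h.symm (le_of_not_ge hij)).symm
  obtain ⟨k, rfl⟩ := Nat.exists_eq_add_of_le hij
  rw [add_comm, ← smul_orbPt, t_pow_smul_of_dvd]
  simpa using (Nat.modEq_iff_dvd' hij).1 h

lemma orbPt_eq_zero_iff (hd : d ∣ n) {k : ℕ} : orbPt n d k = orbPt n d 0 ↔ d ∣ k := by
  rw [orbPt, orbPt, eq_comm, QuotientGroup.eq, pow_zero, inv_one, one_mul]
  constructor
  · rintro ⟨j, hj⟩
    have h2 : (d : ℤ) * j ≡ k [ZMOD n] := by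
      have h3 := congrArg Multiplicative.toAdd hj
      simp only [t, toAdd_zpow, toAdd_pow, toAdd_ofAdd, nsmul_one, zsmul_eq_mul] at h3
      rw [← ZMod.intCast_eq_intCast_iff]
      push_cast
      rw [mul_comm]
      exact h3
    have h3 := h2.of_dvd (Int.natCast_dvd_natCast.2 hd)
    exact Int.natCast_dvd_natCast.1
      ((Int.modEq_zero_iff_dvd).1 (h3.symm.trans (Int.modEq_zero_iff_dvd.2 (dvd_mul_right _ _))))
  · rintro ⟨j, rfl⟩
    exact ⟨j, by simp [pow_mul]⟩

lemma t_pow_smul_orbPt_eq_iff (hd : d ∣ n) {k i : ℕ} :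
    t n ^ k • orbPt n d i = orbPt n d i ↔ d ∣ k := by
  rw [smul_orbPt, add_comm, ← smul_orbPt, ← orbPt_eq_zero_iff hd]
  constructor
  · intro h
    have : t n ^ i • orbPt n d k = t n ^ i • orbPt n d 0 := by
      rw [h.symm.symm, smul_orbPt] at *
      exact h
    exact (MulAction.injective _) this
  · intro h
    rw [h, smul_orbPt]; rfl

lemma orbPt_eq_iff [NeZero n] (hd : d ∣ n) {i j : ℕ} :
    orbPt n d i = orbPt n d j ↔ i ≡ j [MOD d] := by
  refine ⟨fun h => ?_, orbPt_eq_of_modEq⟩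
  wlog hij : i ≤ j generalizing i j
  · exact (this h.symm (le_of_not_ge hij)).symm
  obtain ⟨k, rfl⟩ := Nat.exists_eq_add_of_le hij
  rw [add_comm, ← smul_orbPt] at h
  exact (Nat.modEq_iff_dvd' hij).2 (by simpa using (t_pow_smul_orbPt_eq_iff hd).1 h.symm)

noncomputable instance [NeZero n] (d : ℕ) : Fintype (Orb n d) := Fintype.ofFinite _

lemma sum_orb [NeZero n] (hd : d ∣ n) {M : Type*} [AddCommMonoid M] (f : Orb n d → M) :
    ∑ o, f o = ∑ i ∈ Finset.range d, f (orbPt n d i) := by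
  symm
  refine Finset.sum_bij (fun i _ => orbPt n d i) (fun _ _ => Finset.mem_univ _) ?_ ?_ fun _ _ => rfl
  · intro i hi j hj h
    have := (orbPt_eq_iff hd).1 h
    rwa [Nat.ModEq, Nat.mod_eq_of_lt (Finset.mem_range.1 hi),
      Nat.mod_eq_of_lt (Finset.mem_range.1 hj)] at this
  · intro o _
    obtain ⟨i, rfl⟩ := orbPt_surjective o
    have : 0 < d := Nat.pos_of_dvd_of_pos hd (NeZero.pos n)
    exact ⟨i % d, Finset.mem_range.2 (Nat.mod_lt _ this), orbPt_eq_of_modEq (Nat.mod_modEq _ _)⟩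

/-- Sums over a whole number of turns around an orbit. -/
lemma sum_range_mul_orb [NeZero n] (hd : d ∣ n) {M : Type*} [AddCommMonoid M] (f : Orb n d → M)
    (k : ℕ) : ∑ i ∈ Finset.range (d * k), f (orbPt n d i) = k • ∑ o, f o := by
  induction k with
  | zero => simp
  | succ k ih =>
    rw [Nat.mul_succ, Finset.sum_range_add, ih, succ_nsmul, sum_orb hd]
    congr 1
    refine Finset.sum_congr rfl fun i _ => ?_
    rw [orbPt_eq_of_modEq (j := i) (by simp [Nat.ModEq])]

/-- Cyclic reindexing: it makes sums over a closed t-orbit invariant and makes telescoping sums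
around it vanish. -/
lemma sum_range_succ_eq {M : Type*} [AddCommGroup M] (f : ℕ → M) {k : ℕ} (h : f k = f 0) :
    ∑ i ∈ Finset.range k, f (i + 1) = ∑ i ∈ Finset.range k, f i := by
  have h1 := Finset.sum_range_succ' f k
  rw [Finset.sum_range_succ, h] at h1
  exact (add_right_cancel h1).symm

open Classical in
/-- The indicator function of the `⟨t ^ e⟩`-orbit of the base point of `Θ_d`. -/
noncomputable def mark (n d e : ℕ) (o : Orb n d) : ℤ :=
  if ∃ i, orbPt n d (Nat.gcd d e * i) = o then 1 else 0

lemma mark_orbPt [NeZero n] (hd : d ∣ n) (e i : ℕ) :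
    mark n d e (orbPt n d i) = if Nat.gcd d e ∣ i then 1 else 0 := by
  have hg := Nat.gcd_dvd_left d e
  classical
  unfold mark
  refine if_congr ⟨?_, ?_⟩ rfl rfl
  · rintro ⟨j, hj⟩
    have h := ((orbPt_eq_iff hd).1 hj).of_dvd hg
    exact (Nat.modEq_zero_iff_dvd).1 (h.symm.trans (Nat.modEq_zero_iff_dvd.2 (dvd_mul_right _ _)))
  · rintro ⟨j, rfl⟩
    exact ⟨j, rfl⟩

lemma mark_smul [NeZero n] (hd : d ∣ n) (e : ℕ) (o : Orb n d) :
    mark n d e (t n ^ e • o) = mark n d e o := by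
  obtain ⟨i, rfl⟩ := orbPt_surjective o
  rw [smul_orbPt, mark_orbPt hd, mark_orbPt hd]
  exact if_congr (Nat.dvd_add_right (Nat.gcd_dvd_right d e)) rfl rfl

/-- This is the length of a ⟨t^e⟩-orbit in Θ_d. The same integer annihilates a_d at Θ_e, which is
what makes the injectivity argument close up. -/
lemma sum_mark [NeZero n] (hd : d ∣ n) (e : ℕ) :
    ∑ o, mark n d e o = ((d / Nat.gcd d e : ℕ) : ℤ) := by
  rw [sum_orb hd]
  simp only [mark_orbPt hd]
  have hg := Nat.gcd_dvd_left d e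
  have hpos : 0 < d := Nat.pos_of_dvd_of_pos hd (NeZero.pos n)
  have hgpos : 0 < Nat.gcd d e := Nat.gcd_pos_of_pos_left _ hpos
  generalize Nat.gcd d e = g at *
  obtain ⟨k, rfl⟩ := hg
  rw [Nat.mul_div_cancel_left _ hgpos, Finset.sum_boole]
  congr 1
  have : (Finset.range (g * k)).filter (g ∣ ·) = (Finset.range k).image (g * ·) := by
    ext i
    simp only [Finset.mem_filter, Finset.mem_range, Finset.mem_image]
    constructor
    · rintro ⟨h, j, rfl⟩
      exact ⟨j, lt_of_mul_lt_mul_left h (Nat.zero_le _), rfl⟩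
    · rintro ⟨j, hj, rfl⟩
      exact ⟨(Nat.mul_lt_mul_left hgpos).2 hj, dvd_mul_right _ _⟩
  rw [this, Finset.card_image_of_injective _ (mul_right_injective₀ hgpos.ne'), Finset.card_range]

/-- A function constant on `⟨t ^ e⟩`-orbits is a difference up to a multiple of `mark`. -/
lemma exists_sub_eq_of_invariant [NeZero n] (hd : d ∣ n) (e : ℕ) (c : Orb n d → ℤ)
    (hc : ∀ o, c (t n ^ e • o) = c o) :
    ∃ (C : ℤ) (f : Orb n d → ℤ), (∀ o, f (t n ^ e • o) = f o) ∧
      ∀ o, c (t n • o) = C * mark n d e (t n • o) + f (t n • o) - f o := by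
  have hpos : 0 < d := Nat.pos_of_dvd_of_pos hd (NeZero.pos n)
  have hgpos : 0 < Nat.gcd d e := Nat.gcd_pos_of_pos_left _ hpos
  have hg := Nat.gcd_dvd_left d e
  have hge := Nat.gcd_dvd_right d e
  -- Periods d and e give the period gcd(d, e) by Bézout; the Bézout coefficient of e is reduced mod
  -- d so that it becomes a natural number.
  have hper : ∀ i, c (orbPt n d (i + Nat.gcd d e)) = c (orbPt n d i) := by
    have h1 : ∀ k i, c (orbPt n d (i + e * k)) = c (orbPt n d i) := by
      intro k
      induction k with
      | zero => simp
      | succ k ih => intro i; rw [Nat.mul_succ, ← add_assoc, add_comm, ← smul_orbPt, hc, ih]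
    intro i
    obtain ⟨k, hk⟩ : ∃ k, e * k ≡ Nat.gcd d e [MOD d] := by
      have := Nat.gcd_eq_gcd_ab d e
      have h2 : (e : ℤ) * ((Nat.gcdB d e) % d) ≡ Nat.gcd d e [ZMOD d] := by
        rw [this]
        have h3 : (e : ℤ) * ((Nat.gcdB d e) % d) ≡ e * Nat.gcdB d e [ZMOD d] :=
          (Int.mod_modEq _ _).mul_left _
        refine h3.trans ?_
        have := (Int.modEq_zero_iff_dvd.2 (dvd_mul_right (d : ℤ) (Nat.gcdA d e))).add_right
          ((e : ℤ) * Nat.gcdB d e)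
        rw [zero_add] at this
        exact this.symm
      refine ⟨((Nat.gcdB d e) % d).toNat, ?_⟩
      rw [← Int.natCast_modEq_iff]
      rw [Nat.cast_mul, Int.toNat_of_nonneg (Int.emod_nonneg _ (by exact_mod_cast hpos.ne'))]
      exact h2
    rw [← h1 k i]
    exact congrArg c (orbPt_eq_of_modEq (hk.symm.add_left i))
  generalize hG : Nat.gcd d e = g at *
  have hmod : ∀ i, c (orbPt n d (i % g)) = c (orbPt n d i) := by
    have h1 : ∀ k i, c (orbPt n d (i + g * k)) = c (orbPt n d i) := by
      intro k
      induction k with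
      | zero => simp
      | succ k ih => intro i; rw [Nat.mul_succ, ← add_assoc, hper, ih]
    intro i
    conv_rhs => rw [← Nat.mod_add_div i g]
    rw [h1]
  -- Partial sums of `c` that restart at each multiple of g. The restart loses the sum over one full
  -- period, and this is the constant C; it happens exactly where `mark` is 1.
  let F : ℕ → ℤ := fun i => ∑ j ∈ Finset.range (i % g), c (orbPt n d (j + 1))
  choose idx hidx using orbPt_surjective (n := n) (d := d)
  have hF : ∀ i, F (idx (orbPt n d i)) = F i := by
    intro i
    have := ((orbPt_eq_iff hd).1 (hidx (orbPt n d i))).of_dvd hg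
    simp only [F]
    rw [this]
  refine ⟨∑ j ∈ Finset.range g, c (orbPt n d (j + 1)), fun o => F (idx o), ?_, ?_⟩
  · intro o
    obtain ⟨i, rfl⟩ := orbPt_surjective o
    beta_reduce
    rw [smul_orbPt, hF, hF]
    simp only [F]
    rw [Nat.add_mod, Nat.mod_eq_zero_of_dvd hge, zero_add, Nat.mod_mod]
  · intro o
    obtain ⟨i, rfl⟩ := orbPt_surjective o
    beta_reduce
    rw [t_smul_orbPt, hF, hF, mark_orbPt hd, hG, ← hmod (i + 1)]
    simp only [F]
    have hlt := Nat.mod_lt i hgpos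
    by_cases h : i % g + 1 = g
    · have hdiv : g ∣ i + 1 := by
        rw [Nat.dvd_iff_mod_eq_zero, Nat.add_mod, ← Nat.add_mod_mod, Nat.mod_mod,
          Nat.mod_add_mod, Nat.add_mod_mod, ← Nat.mod_add_mod, h, Nat.mod_self]
      rw [if_pos hdiv, Nat.mod_eq_zero_of_dvd hdiv]
      have h0 := hper 0
      rw [zero_add] at h0
      rw [← h0, ← h, Finset.sum_range_succ]
      simp only [h]
      simp
    · have hm : (i + 1) % g = i % g + 1 := by
        rw [← Nat.mod_add_mod, Nat.mod_eq_of_lt (by omega)]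
      have hdiv : ¬ g ∣ i + 1 := by
        rw [Nat.dvd_iff_mod_eq_zero, hm]; omega
      rw [if_neg hdiv, hm, Finset.sum_range_succ]
      ring

/-- Equivariant choice over an orbit, when the stabilizers act trivially. -/
lemma exists_equivariant_choice [NeZero n] (hd : d ∣ n) (e : ℕ) {M : Type*} [AddCommGroup M]
    (ρ : Representation ℤ (Cyc n) M) (hstab : ∀ k, d ∣ e * k → ∀ x, ρ (t n ^ (e * k)) x = x)
    (P : Orb n d → M → Prop) (hP : ∀ o x, P o x → P (t n ^ e • o) (ρ (t n ^ e) x))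
    (hex : ∀ o, ∃ x, P o x) :
    ∃ w : Orb n d → M, (∀ o, P o (w o)) ∧ ∀ o, w (t n ^ e • o) = ρ (t n ^ e) (w o) := by
  have hPk : ∀ k o x, P o x → P (t n ^ (e * k) • o) (ρ (t n ^ (e * k)) x) := by
    intro k
    induction k with
    | zero => intro o x h; simpa using h
    | succ k ih =>
      intro o x h
      have := hP _ _ (ih _ _ h)
      rwa [smul_smul, ← pow_add, ← Module.End.mul_apply, ← map_mul, ← pow_add, add_comm,
        ← Nat.mul_succ] at this
  let S : Setoid (Orb n d) :=
    { r := fun o o' => ∃ k, t n ^ (e * k) • o = o'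
      iseqv :=
        { refl := fun o => ⟨0, by simp⟩
          symm := by
            rintro o _ ⟨k, rfl⟩
            -- As t^n = 1, the complement of k in a multiple of n serves as a natural exponent for
            -- the inverse.
            obtain ⟨m, hm⟩ : ∃ m, k + m = n * k :=
              ⟨n * k - k, Nat.add_sub_cancel' (Nat.le_mul_of_pos_left _ (NeZero.pos n))⟩
            refine ⟨m, ?_⟩
            rw [smul_smul, ← pow_add, ← mul_add, add_comm, hm,
              (t_pow_eq_one_iff _).2 ((dvd_mul_right n k).mul_left e), one_smul]
          trans := by
            rintro o _ _ ⟨k, rfl⟩ ⟨l, rfl⟩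
            exact ⟨l + k, by rw [smul_smul, ← pow_add, mul_add]⟩ } }
  choose w₀ hw₀ using hex
  have hrep : ∀ o : Orb n d, ∃ k, t n ^ (e * k) • (Quotient.mk S o).out = o :=
    fun o => Quotient.mk_out (s := S) o
  choose k hk using hrep
  refine ⟨fun o => ρ (t n ^ (e * k o)) (w₀ (Quotient.mk S o).out), fun o => ?_, fun o => ?_⟩
  · have := hPk (k o) _ _ (hw₀ (Quotient.mk S o).out)
    rwa [hk] at this
  · have hq : Quotient.mk S (t n ^ e • o) = Quotient.mk S o :=
      (Quotient.sound (s := S) ⟨1, by rw [mul_one]⟩).symm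
    have h1 := hk (t n ^ e • o)
    rw [hq] at h1
    beta_reduce
    rw [hq, ← Module.End.mul_apply, ← map_mul, ← pow_add, ← mul_one_add]
    have h2 := hk o
    generalize (Quotient.mk S o).out = o' at *
    generalize k (t n ^ e • o) = a at *
    generalize k o = b at *
    have h3 : t n ^ (e * a) • o' = t n ^ (e * (1 + b)) • o' := by
      rw [h1, mul_one_add, pow_add, mul_smul, h2]
    obtain ⟨m, hm⟩ : ∃ m, (1 + b) + m = n * (1 + b) :=
      ⟨n * (1 + b) - (1 + b), Nat.add_sub_cancel' (Nat.le_mul_of_pos_left _ (NeZero.pos n))⟩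
    have hone : t n ^ (e * (1 + b + m)) = 1 := by
      rw [hm, (t_pow_eq_one_iff _).2 ((dvd_mul_right n _).mul_left e)]
    -- The exponents a and 1 + b move the representative to the same point, so they differ by a
    -- stabilizer element. By `hstab` this element acts trivially on M, hence the transported value
    -- is well defined.
    have h4 : t n ^ (e * (a + m)) • o' = o' := by
      rw [mul_add, add_comm, pow_add, mul_smul, h3, smul_smul, ← pow_add, ← mul_add, add_comm, hone,
        one_smul]
    obtain ⟨i, rfl⟩ := orbPt_surjective o'
    have h5 := hstab _ ((t_pow_smul_orbPt_eq_iff hd).1 h4) (w₀ (orbPt n d i))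
    conv_rhs => rw [← h5]
    rw [← Module.End.mul_apply, ← map_mul, ← pow_add, ← mul_add,
      show 1 + b + (a + m) = (1 + b + m) + a by ring, mul_add, pow_add, hone, one_mul]

end orbits

/-! ### Equivariant chains over an orbit with values in a complex with homology ℤ -/

section cone
variable {n d : ℕ}

/-- Cycles `(x, r, s)` of the total complex of `M^Θ → M^Θ → M` over an orbit `Θ` are, up to equivariant
boundaries, determined by few invariants when the homology of `M` is generated by the class of `τ`. -/
theorem cone_decomposition [NeZero n] (hd : d ∣ n) (e : ℕ) {M : Type*} [AddCommGroup M]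
    (ρ : Representation ℤ (Cyc n) M) (hstab : ∀ k, d ∣ e * k → ∀ x, ρ (t n ^ (e * k)) x = x)
    (δ : M →ₗ[ℤ] M) (hδ : ∀ g x, δ (ρ g x) = ρ g (δ x)) (τ : M) (hτ : ∀ g, ρ g τ = τ)
    (ev : M →ₗ[ℤ] ℤ) (hev : ∀ x, ev (δ x) = 0) (hevτ : ev τ = 1)
    (hM : ∀ x, δ x = 0 → ∃ (c : ℤ) (y : M), x = c • τ + δ y) (hδτ : δ τ = 0)
    (r s : Orb n d → M) (hr : ∀ o, r (t n ^ e • o) = ρ (t n ^ e) (r o))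
    (hs : ∀ o, s (t n ^ e • o) = ρ (t n ^ e) (s o)) (hsδ : ∀ o, δ (s o) = 0)
    (hrδ : ∀ o, δ (r (t n • o)) = s (t n • o) - s o) :
    ∃ (c C : ℤ) (p q : Orb n d → M), (∀ o, p (t n ^ e • o) = ρ (t n ^ e) (p o)) ∧
      (∀ o, q (t n ^ e • o) = ρ (t n ^ e) (q o)) ∧ (∀ o, s o = c • τ + δ (q o)) ∧
      ∀ o, r (t n • o) =
        (C * mark n d e (t n • o)) • τ - δ (p (t n • o)) + q (t n • o) - q o := by
  have hcoef : ∀ (x : M) (c : ℤ) (y : M), x = c • τ + δ y → ev x = c := by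
    rintro x c y rfl
    simp [hev, hevτ]
  have hM' : ∀ x, δ x = 0 → ∃ y, x - ev x • τ = δ y := by
    intro x hx
    obtain ⟨c, y, h⟩ := hM x hx
    exact ⟨y, by rw [hcoef x c y h, h]; abel⟩
  -- The functional `ev` is not assumed invariant; on cycles it is, because it reads off the
  -- coefficient of the invariant class τ.
  have hevρ : ∀ g x, δ x = 0 → ev (ρ g x) = ev x := by
    intro g x hx
    obtain ⟨c, y, h⟩ := hM x hx
    rw [hcoef x c y h]
    refine hcoef _ c (ρ g y) ?_
    rw [h, map_add, map_zsmul, hτ, hδ]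
  have hstep : ∀ o, ev (s (t n • o)) = ev (s o) := by
    intro o
    have := hev (r (t n • o))
    rw [hrδ, map_sub] at this
    linarith
  have hconst : ∀ o, ev (s o) = ev (s (orbPt n d 0)) := by
    intro o
    obtain ⟨i, rfl⟩ := orbPt_surjective o
    induction i with
    | zero => rfl
    | succ i ih => rw [← t_smul_orbPt, hstep, ih]
  -- The values of s are homologous along the orbit by `hrδ`, so a single coefficient of τ serves
  -- for all points, and the bounding chains can be chosen equivariantly.
  obtain ⟨w, hw, hwe⟩ := exists_equivariant_choice hd e ρ hstab
    (fun o x => s o - ev (s (orbPt n d 0)) • τ = δ x)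
    (by
      intro o x h
      rw [hδ, ← h, hs, map_sub, map_zsmul, hτ])
    (by
      intro o
      rw [← hconst o]
      exact hM' _ (hsδ o))
  have hr' : ∀ o, δ (r (t n • o) - w (t n • o) + w o) = 0 := by
    intro o
    rw [map_add, map_sub, hrδ, ← hw, ← hw]
    abel
  -- This correction by w turns r into a family of cycles, each of which is a multiple of τ up to a
  -- boundary.
  let u : Orb n d → M := fun o => r o - w o + w ((t n)⁻¹ • o)
  have hut : ∀ o, u (t n • o) = r (t n • o) - w (t n • o) + w o := by
    intro o
    simp [u]
  have huδ : ∀ o, δ (u o) = 0 := by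
    intro o
    rw [← smul_inv_smul (t n) o, hut]
    exact hr' _
  have hue : ∀ o, u (t n ^ e • o) = ρ (t n ^ e) (u o) := by
    intro o
    simp only [u]
    rw [smul_smul, mul_comm, ← smul_smul, hr, hwe, hwe, map_add, map_sub]
  obtain ⟨w', hw', hwe'⟩ := exists_equivariant_choice hd e ρ hstab
    (fun o x => u o - ev (u o) • τ = δ x)
    (by
      intro o x h
      rw [hδ, ← h, hue, map_sub, map_zsmul, hτ, hevρ _ _ (huδ o)])
    (fun o => hM' _ (huδ o))
  -- The multiples of τ form a ⟨t^e⟩-invariant function on the orbit. Its difference part f is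
  -- absorbed into q as f·τ, which is harmless for s since τ is a cycle; only C survives.
  obtain ⟨C, f, hf, hC⟩ := exists_sub_eq_of_invariant hd e (fun o => ev (u o))
    (fun o => by rw [hue, hevρ _ _ (huδ o)])
  refine ⟨ev (s (orbPt n d 0)), C, fun o => - w' o, fun o => w o + f o • τ, ?_, ?_, ?_, ?_⟩
  · intro o
    beta_reduce
    rw [hwe', map_neg]
  · intro o
    beta_reduce
    rw [hwe, hf, map_add, map_zsmul, hτ]
  · intro o
    rw [map_add, map_zsmul, hδτ, smul_zero, add_zero, ← hw]
    abel
  · intro o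
    have h1 := hut o
    have h2 := hw' (t n • o)
    have h3 : ev (u (t n • o)) = _ := hC o
    rw [map_neg, ← h2, h3, h1]
    module

end cone

/-! ### Fixed chains, their boundaries and products -/

section chains
variable {n : ℕ} {v w : Dv n → ℕ}

/-- The elements of the total module fixed by `t ^ e`. -/
noncomputable def inv (e : ℕ) (v : Dv n → ℕ) : Submodule ℤ (Cells v →₀ ℤ) :=
  LinearMap.ker (permRep n (Cells v) (t n ^ e) - LinearMap.id)

/-- The boundaries of the elements fixed by `t ^ e`. -/
noncomputable def bnd (e : ℕ) (v : Dv n → ℕ) : Submodule ℤ (Cells v →₀ ℤ) := (inv e v).map (bd v)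

lemma mem_inv {e : ℕ} {x : Cells v →₀ ℤ} : x ∈ inv e v ↔ permRep n (Cells v) (t n ^ e) x = x := by
  simp [inv, sub_eq_zero]

lemma inv_mono {e e' : ℕ} (h : e ∣ e') : inv e v ≤ inv e' v := by
  obtain ⟨k, rfl⟩ := h
  intro x hx
  rw [mem_inv] at *
  induction k with
  | zero => simp
  | succ k ih => rw [Nat.mul_succ, pow_add, map_mul, Module.End.mul_apply, hx, ih]

lemma bnd_mono {e e' : ℕ} (h : e ∣ e') : bnd e v ≤ bnd e' v := Submodule.map_mono (inv_mono h)

lemma inv_of_inv_one {e : ℕ} {x : Cells v →₀ ℤ} (h : x ∈ inv 1 v) : x ∈ inv e v :=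
  inv_mono (one_dvd e) h

/-- At the free orbit e = n the fixed-point condition is empty, so the underlying complex is a
special case of the equivariant one. -/
lemma mem_inv_of_zero [NeZero n] (x : Cells v →₀ ℤ) : x ∈ inv n v := by
  rw [mem_inv, (t_pow_eq_one_iff n).2 dvd_rfl, map_one, Module.End.one_apply]

lemma mulTot_mem_inv {e : ℕ} {a : Cells v →₀ ℤ} {b : Cells w →₀ ℤ} (ha : a ∈ inv e v)
    (hb : b ∈ inv e w) : mulTot v w a b ∈ inv e (v + w) := by
  rw [mem_inv] at *
  rw [← mulTot_permRep, ha, hb]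

lemma permRep_eq_of_inv_one [NeZero n] {x : Cells v →₀ ℤ} (h : x ∈ inv 1 v) (g : Cyc n) :
    permRep n (Cells v) g x = x := by
  obtain ⟨i, rfl⟩ := exists_t_pow g
  exact mem_inv.1 (inv_of_inv_one h)

/-- The sign operator of the grading. -/
noncomputable def eps (v : Dv n → ℕ) : (Cells v →₀ ℤ) →ₗ[ℤ] (Cells v →₀ ℤ) :=
  Finsupp.linearCombination ℤ fun x => Finsupp.single x ((-1) ^ x.dim)

lemma eps_single (x : Cells v) (a : ℤ) :
    eps v (Finsupp.single x a) = Finsupp.single x ((-1) ^ x.dim * a) := by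
  simp [eps, mul_comm]

lemma eps_eps (x : Cells v →₀ ℤ) : eps v (eps v x) = x := by
  induction x using Finsupp.induction_linear with
  | zero => simp
  | add f g hf hg => rw [map_add, map_add, hf, hg]
  | single x a =>
    rw [eps_single, eps_single, ← mul_assoc, ← pow_add, ← two_mul, pow_mul]
    simp

lemma eps_permRep (g : Cyc n) (x : Cells v →₀ ℤ) :
    eps v (permRep n _ g x) = permRep n _ g (eps v x) := by
  induction x using Finsupp.induction_linear with
  | zero => simp
  | add f g hf hg => simp only [map_add, hf, hg]
  | single x a => rw [permRep_single, eps_single, eps_single, permRep_single, Cells.dim_smul]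

/-- The Leibniz rule, with the sign operator. -/
lemma bd_mulTot_eps (a : Cells v →₀ ℤ) (b : Cells w →₀ ℤ) :
    bd (v + w) (mulTot v w a b) = mulTot v w (bd v a) b + mulTot v w (eps v a) (bd w b) := by
  induction a using Finsupp.induction_linear with
  | zero => simp
  | add f g hf hg => simp only [map_add, LinearMap.add_apply, hf, hg]; abel
  | single x r =>
    induction b using Finsupp.induction_linear with
    | zero => simp
    | add f g hf hg => simp only [map_add, hf, hg]; abel
    | single y s =>
      rw [eps_single, single_eq_smul x r, single_eq_smul y s, single_eq_smul x (_ * r)]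
      simp only [map_smul, LinearMap.smul_apply, bd_mulTot_single]
      module

lemma bd_eps (a : Cells v →₀ ℤ) : bd v (eps v a) = - eps v (bd v a) := by
  classical
  induction a using Finsupp.induction_linear with
  | zero => simp
  | add f g hf hg => simp only [map_add, hf, hg]; abel
  | single x r =>
    rw [eps_single, single_eq_smul x r, single_eq_smul, map_smul, map_smul, map_smul]
    have h : eps v (bd v (Finsupp.single x 1)) = - ((-1) ^ x.dim • bd v (Finsupp.single x 1)) := by
      have hs : ∀ y ∈ (bd v (Finsupp.single x 1)).support, y.dim + 1 = x.dim :=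
        fun y hy => bd_single_support x hy
      conv_rhs => rw [← Finsupp.sum_single (bd v (Finsupp.single x 1))]
      rw [eps, Finsupp.linearCombination_apply, Finsupp.sum, Finsupp.sum, Finset.smul_sum,
        ← Finset.sum_neg_distrib]
      refine Finset.sum_congr rfl fun y hy => ?_
      rw [← hs y hy, Finsupp.smul_single, Finsupp.smul_single, ← Finsupp.single_neg]
      congr 1
      simp only [smul_eq_mul]
      ring
    rw [h]
    module

lemma bd_mulTot_of_even {a : Cells v →₀ ℤ} (ha : eps v a = a) (hc : bd v a = 0)
    (b : Cells w →₀ ℤ) : bd (v + w) (mulTot v w a b) = mulTot v w a (bd w b) := by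
  rw [bd_mulTot_eps, ha, hc, map_zero, LinearMap.zero_apply, zero_add]

lemma mulTot_mem_bnd_left {e : ℕ} {a : Cells v →₀ ℤ} {b : Cells w →₀ ℤ} (ha : a ∈ bnd e v)
    (hb : b ∈ inv e w) (hbc : bd w b = 0) : mulTot v w a b ∈ bnd e (v + w) := by
  obtain ⟨y, hy, rfl⟩ := ha
  exact ⟨_, mulTot_mem_inv hy hb, by rw [bd_mulTot_eps, hbc, map_zero, add_zero]⟩

/-- The differential passes `a` at the cost of the operator `eps`; evenness of `a` removes this
sign. -/
lemma mulTot_mem_bnd_right {e : ℕ} {a : Cells v →₀ ℤ} {b : Cells w →₀ ℤ} (ha : a ∈ inv e v)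
    (hac : bd v a = 0) (hae : eps v a = a) (hb : b ∈ bnd e w) : mulTot v w a b ∈ bnd e (v + w) := by
  obtain ⟨y, hy, rfl⟩ := hb
  exact ⟨_, mulTot_mem_inv ha hy, by rw [bd_mulTot_of_even hae hac]⟩

end chains

/-! ### Coordinates on products and induction on the number of factors -/

section cells
variable {n : ℕ} {v w : Dv n → ℕ}

lemma permRep_apply {X : Type} [MulAction (Cyc n) X] (g : Cyc n) (b : X →₀ ℤ) (x : X) :
    permRep n X g b x = b (g⁻¹ • x) := by
  have := Finsupp.mapDomain_apply (MulAction.injective g) b (g⁻¹ • x)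
  rwa [smul_inv_smul] at this

lemma eps_apply (a : Cells v →₀ ℤ) (x : Cells v) : eps v a x = (-1) ^ x.dim * a x := by
  induction a using Finsupp.induction_linear with
  | zero => simp
  | add f g hf hg => rw [map_add, Finsupp.add_apply, hf, hg, Finsupp.add_apply, mul_add]
  | single y r =>
    classical
    rw [eps_single, Finsupp.single_apply, Finsupp.single_apply]
    split_ifs with h
    · rw [h]
    · simp

lemma merge_injective {x x' : Cells v} {y y' : Cells w} (h : merge x y = merge x' y') :
    x = x' ∧ y = y' := by
  constructor <;> funext i
  · rw [← merge_inl x y, h, merge_inl]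
  · rw [← merge_inr x y, h, merge_inr]

lemma merge_eta (z : Cells (v + w)) :
    merge (fun i => z (inl w i)) (fun j => z (inr v j)) = z := by
  funext k
  rcases inl_or_inr k with ⟨a, rfl⟩ | ⟨b, rfl⟩
  · rw [merge_inl]
  · rw [merge_inr]

lemma exists_merge (z : Cells (v + w)) : ∃ x y, merge x y = z := ⟨_, _, merge_eta z⟩

lemma mulTot_apply (a : Cells v →₀ ℤ) (b : Cells w →₀ ℤ) (x : Cells v) (y : Cells w) :
    mulTot v w a b (merge x y) = a x * b y * shuffleSign x y := by
  classical
  induction a using Finsupp.induction_linear with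
  | zero => simp
  | add f g hf hg => simp only [map_add, LinearMap.add_apply, Finsupp.add_apply, hf, hg]; ring
  | single x' r =>
    induction b using Finsupp.induction_linear with
    | zero => simp
    | add f g hf hg => simp only [map_add, Finsupp.add_apply, hf, hg]; ring
    | single y' s =>
      rw [mulTot_single, Finsupp.single_apply, Finsupp.single_apply, Finsupp.single_apply]
      by_cases hx : x' = x
      · by_cases hy : y' = y
        · subst hx hy; simp
        · rw [if_neg fun h => hy (merge_injective h).2, if_neg hy]; simp
      · rw [if_neg fun h => hx (merge_injective h).1, if_neg hx]; simp

lemma eps_mulTot (a : Cells v →₀ ℤ) (b : Cells w →₀ ℤ) :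
    eps (v + w) (mulTot v w a b) = mulTot v w (eps v a) (eps w b) := by
  ext z
  obtain ⟨x, y, rfl⟩ := exists_merge z
  rw [eps_apply, mulTot_apply, mulTot_apply, eps_apply, eps_apply, Cells.dim_merge, pow_add]
  ring

lemma mulTot_sub_left (a a' : Cells v →₀ ℤ) (b : Cells w →₀ ℤ) :
    mulTot v w (a - a') b = mulTot v w a b - mulTot v w a' b := by
  rw [map_sub, LinearMap.sub_apply]

lemma mulTot_sub_right (a : Cells v →₀ ℤ) (b b' : Cells w →₀ ℤ) :
    mulTot v w a (b - b') = mulTot v w a b - mulTot v w a b' :=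
  map_sub _ _ _

/-- Induction on `v` by adding one factor at a time. -/
lemma factor_induction {P : (Dv n → ℕ) → Prop} (h0 : P 0)
    (h : ∀ w d, P w → P (w + Pi.single d 1)) (v : Dv n → ℕ) : P v := by
  induction hN : ∑ d, v d generalizing v with
  | zero =>
    have : v = 0 := by
      funext d
      exact (Finset.sum_eq_zero_iff.1 hN) d (Finset.mem_univ d)
    rwa [this]
  | succ N ih =>
    obtain ⟨d, -, hd⟩ : ∃ d ∈ Finset.univ, v d ≠ 0 := by
      by_contra! h
      rw [Finset.sum_eq_zero h] at hN
      omega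
    have hv : v - Pi.single d 1 + Pi.single d 1 = v := by
      funext d'
      by_cases h : d' = d
      · subst h; simp; omega
      · simp [h]
    rw [← hv]
    refine h _ _ (ih _ ?_)
    rw [← hv] at hN
    simp only [Pi.add_apply, Finset.sum_add_distrib] at hN
    rw [Finset.sum_pi_single'] at hN
    simp at hN
    simpa using hN

/-- The union of a set of factors of `S^v` and a set of factors of `S^w`. -/
def joinS (S : Factors v → Bool) (T : Factors w → Bool) : Factors (v + w) → Bool := fun k =>
  Fin.addCases (motive := fun _ => Bool) (fun a => S ⟨k.1, a⟩) (fun b => T ⟨k.1, b⟩) k.2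

@[simp] lemma joinS_inl (S : Factors v → Bool) (T : Factors w → Bool) (i : Factors v) :
    joinS S T (inl w i) = S i := by simp [joinS, inl]

@[simp] lemma joinS_inr (S : Factors v → Bool) (T : Factors w → Bool) (j : Factors w) :
    joinS S T (inr v j) = T j := by simp [joinS, inr]

lemma joinS_eta (S : Factors (v + w) → Bool) :
    joinS (fun i => S (inl w i)) (fun j => S (inr v j)) = S := by
  funext k
  rcases inl_or_inr k with ⟨a, rfl⟩ | ⟨b, rfl⟩
  · rw [joinS_inl]
  · rw [joinS_inr]

lemma forall_factors {P : Factors (v + w) → Prop} :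
    (∀ k, P k) ↔ (∀ i, P (inl w i)) ∧ ∀ j, P (inr v j) :=
  ⟨fun h => ⟨fun _ => h _, fun _ => h _⟩, fun h k => by
    rcases inl_or_inr k with ⟨a, rfl⟩ | ⟨b, rfl⟩
    exacts [h.1 _, h.2 _]⟩

end cells

/-! ### The basic cycles: products of points and sector sums -/

section theta
variable {n : ℕ} [NeZero n] {v w : Dv n → ℕ}

/-- The product over all factors of the sum of all sectors (for the factors in `S`) and of the point (for
the other factors). -/
noncomputable def theta (v : Dv n → ℕ) (S : Factors v → Bool) : Cells v →₀ ℤ :=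
  Finsupp.equivFunOnFinite.symm fun x => if ∀ i, (x i).dim = if S i then 2 else 0 then 1 else 0

lemma theta_apply (S : Factors v → Bool) (x : Cells v) :
    theta v S x = if ∀ i, (x i).dim = if S i then 2 else 0 then 1 else 0 := rfl

lemma theta_mem_inv (S : Factors v → Bool) : theta v S ∈ inv 1 v := by
  rw [mem_inv]
  ext x
  rw [permRep_apply, theta_apply, theta_apply]
  simp

/-- Only cells whose factors have dimension 0 or 2 occur, so no Koszul sign ever appears when these
cycles are multiplied or moved. -/
lemma eps_theta (S : Factors v → Bool) : eps v (theta v S) = theta v S := by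
  ext x
  rw [eps_apply, theta_apply]
  split_ifs with h
  · have : Even x.dim := by
      unfold Cells.dim
      refine Finset.even_sum _ fun i _ => ?_
      rw [h i]
      split_ifs <;> decide
    rw [this.neg_one_pow, one_mul]
  · simp

/-- On the cells in question all dimensions are even, so the shuffle sign is 1 and the product is
strict, not just up to a boundary. -/
lemma mulTot_theta (S : Factors v → Bool) (T : Factors w → Bool) :
    mulTot v w (theta v S) (theta w T) = theta (v + w) (joinS S T) := by
  ext z
  obtain ⟨x, y, rfl⟩ := exists_merge z
  rw [mulTot_apply, theta_apply, theta_apply, theta_apply]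
  simp only [forall_factors, merge_inl, merge_inr, joinS_inl, joinS_inr]
  by_cases hx : ∀ i, (x i).dim = if S i then 2 else 0
  · by_cases hy : ∀ i, (y i).dim = if T i then 2 else 0
    · have hs : shuffleSign x y = 1 := by
        refine Finset.prod_eq_one fun i _ => Finset.prod_eq_one fun j _ => ?_
        rw [hx i]
        split_ifs <;> simp
      simp [hx, hy, hs]
    · simp only [and_false, hy]
      simp
  · simp only [hx, false_and]
    simp

end theta

/-! ### The complex of a single factor and the gold relation -/

section onefactor
variable {n : ℕ} {w : Dv n → ℕ}

/-- A cell of `S^{λ_d}`, as a family with one member. -/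
def cellFun (d : Dv n) (c : Cell n d) : Cells (Pi.single d 1 : Dv n → ℕ) :=
  uniqueElim (ι := Factors (Pi.single d 1 : Dv n → ℕ)) (α := fun i => Cell n i.1) c

lemma cellFun_eta (d : Dv n) (x : Cells (Pi.single d 1 : Dv n → ℕ)) :
    cellFun d (x default) = x := by
  funext i
  obtain rfl := Subsingleton.elim default i
  rfl

lemma eq_cellFun_iff {d : Dv n} {c : Cell n d} {x : Cells (Pi.single d 1 : Dv n → ℕ)} :
    x = cellFun d c ↔ x default = c :=
  ⟨fun h => by rw [h]; rfl, fun h => by rw [← h, cellFun_eta]⟩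

lemma cellFun_injective (d : Dv n) : Function.Injective (cellFun d) := fun c c' h => by
  have := congrFun h default
  exact this

lemma dim_cellFun (d : Dv n) (c : Cell n d) : (cellFun d c).dim = c.dim := by
  simp only [Cells.dim, Fintype.sum_unique]
  rfl

lemma smul_cellFun (d : Dv n) (g : Cyc n) (c : Cell n d) : g • cellFun d c = cellFun d (g • c) :=
  eq_cellFun_iff.2 rfl

/-- The basis element of `S^{λ_d}` given by a cell. -/
noncomputable def cellOf (d : Dv n) (c : Cell n d) : Cells (Pi.single d 1 : Dv n → ℕ) →₀ ℤ :=
  Finsupp.single (cellFun d c) 1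

lemma permRep_cellOf (d : Dv n) (g : Cyc n) (c : Cell n d) :
    permRep n _ g (cellOf d c) = cellOf d (g • c) := by
  rw [cellOf, permRep_single, smul_cellFun, cellOf]

lemma eps_cellOf (d : Dv n) (c : Cell n d) : eps _ (cellOf d c) = (-1) ^ c.dim • cellOf d c := by
  rw [cellOf, eps_single, dim_cellFun, Finsupp.smul_single]
  rfl

lemma bd_cellOf (d : Dv n) (c : Cell n d) :
    bd _ (cellOf d c) = c.bdry.mapDomain (cellFun d) := by
  have hk : koszul default (cellFun d c) = 1 := by simp [koszul, Before]
  simp only [cellOf, bd, Fintype.sum_unique, LinearMap.comp_apply, koszulMap_single, hk, one_mul,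
    faceMap_single]
  refine Finsupp.mapDomain_congr fun c' _ => ?_
  rw [eq_cellFun_iff, Function.update_self]

lemma bd_cellOf_pt (d : Dv n) : bd _ (cellOf d .pt) = 0 := by
  rw [bd_cellOf, Cell.bdry, Finsupp.mapDomain_zero]

lemma bd_cellOf_ray (d : Dv n) (o : Orb n d) : bd _ (cellOf d (.ray o)) = cellOf d .pt := by
  rw [bd_cellOf, Cell.bdry, Finsupp.mapDomain_single, cellOf]

lemma bd_cellOf_sec (d : Dv n) (o : Orb n d) :
    bd _ (cellOf d (.sec o)) = cellOf d (.ray o) - cellOf d (.ray (t n • o)) := by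
  rw [bd_cellOf, Cell.bdry, Finsupp.mapDomain_sub, Finsupp.mapDomain_single,
    Finsupp.mapDomain_single, cellOf, cellOf]

variable [NeZero n]

lemma theta_single_false (d : Dv n) (S : Factors (Pi.single d 1) → Bool) (hS : S default = false) :
    theta (Pi.single d 1) S = cellOf d .pt := by
  classical
  ext x
  rw [theta_apply, cellOf, Finsupp.single_apply]
  refine if_congr ?_ rfl rfl
  rw [eq_comm (b := x), eq_cellFun_iff, Unique.forall_iff, hS]
  cases x default <;> simp

lemma theta_single_true (d : Dv n) (S : Factors (Pi.single d 1) → Bool) (hS : S default = true) :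
    theta (Pi.single d 1) S = ∑ o, cellOf d (.sec o) := by
  classical
  ext x
  rw [theta_apply, Finsupp.finsetSum_apply]
  simp only [cellOf, Finsupp.single_apply, eq_comm (b := x), eq_cellFun_iff]
  simp only [Unique.forall_iff, hS]
  cases h : x default <;> simp

/-- Each ray is the initial ray of one sector and the final ray of another, so the boundary of the
sum of all sectors cancels. -/
lemma bd_theta_single (d : Dv n) (S : Factors (Pi.single d 1) → Bool) :
    bd _ (theta (Pi.single d 1) S) = 0 := by
  cases h : S default with
  | false => rw [theta_single_false d S h, bd_cellOf_pt]
  | true =>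
    rw [theta_single_true d S h, map_sum]
    simp only [bd_cellOf_sec, Finset.sum_sub_distrib]
    rw [sub_eq_zero]
    exact (Equiv.sum_comp (MulAction.toPerm (t n)) fun o : Orb n d => cellOf d (.ray o)).symm

lemma bd_theta (v : Dv n → ℕ) (S : Factors v → Bool) : bd v (theta v S) = 0 := by
  induction v using factor_induction with
  | h0 =>
    have : IsEmpty (Factors (0 : Dv n → ℕ)) := ⟨fun i => i.2.elim0⟩
    simp [bd]
  | h w d ih =>
    rw [← joinS_eta S, ← mulTot_theta, bd_mulTot_eps, ih, bd_theta_single]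
    simp

/-- The gold relation, up to a boundary, with a factor in front. -/
lemma gold_mem_bnd {m : Cells w →₀ ℤ} (hm : m ∈ inv 1 w) (hc : bd w m = 0) (he : eps w m = m)
    (d d' : Dv n) :
    ((d.1 / Nat.gcd d.1 d'.1 : ℕ) : ℤ) •
        mulTot _ _ (mulTot _ _ m (cellOf d .pt)) (∑ o, cellOf d' (.sec o)) -
      ((d'.1 / Nat.gcd d.1 d'.1 : ℕ) : ℤ) •
        mulTot _ _ (mulTot _ _ m (∑ o, cellOf d (.sec o))) (cellOf d' .pt) ∈
      bnd 1 (w + Pi.single d 1 + Pi.single d' 1) := by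
  have hd : d.1 ∣ n := Nat.dvd_of_mem_divisors (Finset.mem_of_mem_erase d.2)
  have hd' : d'.1 ∣ n := Nat.dvd_of_mem_divisors (Finset.mem_of_mem_erase d'.2)
  let A : ℕ → Cells (Pi.single d 1 : Dv n → ℕ) →₀ ℤ := fun i => cellOf d (.ray (orbPt n d i))
  let A' : ℕ → Cells (Pi.single d' 1 : Dv n → ℕ) →₀ ℤ := fun i => cellOf d' (.ray (orbPt n d' i))
  let B : ℕ → Cells (Pi.single d 1 : Dv n → ℕ) →₀ ℤ := fun i => cellOf d (.sec (orbPt n d i))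
  let B' : ℕ → Cells (Pi.single d' 1 : Dv n → ℕ) →₀ ℤ := fun i => cellOf d' (.sec (orbPt n d' i))
  have hA : ∀ i, bd _ (A i) = cellOf d .pt := fun i => bd_cellOf_ray d _
  have hA' : ∀ i, bd _ (A' i) = cellOf d' .pt := fun i => bd_cellOf_ray d' _
  have hB : ∀ i, bd _ (B i) = A i - A (i + 1) := fun i => by
    simp only [A, B, bd_cellOf_sec, t_smul_orbPt]
  have hB' : ∀ i, bd _ (B' i) = A' i - A' (i + 1) := fun i => by
    simp only [A', B', bd_cellOf_sec, t_smul_orbPt]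
  have eA : ∀ i, eps _ (A i) = - A i := fun i => by simp [A, eps_cellOf]
  have eB : ∀ i, eps _ (B i) = B i := fun i => by simp [B, eps_cellOf]
  have gA : ∀ i, permRep n _ (t n) (A i) = A (i + 1) := fun i => by
    simp only [A, permRep_cellOf, Cell.smul_ray, t_smul_orbPt]
  have gA' : ∀ i, permRep n _ (t n) (A' i) = A' (i + 1) := fun i => by
    simp only [A', permRep_cellOf, Cell.smul_ray, t_smul_orbPt]
  have gB : ∀ i, permRep n _ (t n) (B i) = B (i + 1) := fun i => by
    simp only [B, permRep_cellOf, Cell.smul_sec, t_smul_orbPt]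
  have gB' : ∀ i, permRep n _ (t n) (B' i) = B' (i + 1) := fun i => by
    simp only [B', permRep_cellOf, Cell.smul_sec, t_smul_orbPt]
  have hm' : permRep n _ (t n) m = m := by simpa using mem_inv.1 hm
  -- L is the length of the t-orbit of the pair of base points in Θ_d × Θ_{d'}. Going round it
  -- covers Θ_d exactly d'/(d,d') times and Θ_{d'} exactly d/(d,d') times, which are the
  -- coefficients of the relation.
  let L := Nat.lcm d.1 d'.1
  have hLd : d.1 * (d'.1 / Nat.gcd d.1 d'.1) = L := (Nat.mul_div_assoc _ (Nat.gcd_dvd_right _ _)).symm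
  have hLd' : d'.1 * (d.1 / Nat.gcd d.1 d'.1) = L := by
    rw [← Nat.mul_div_assoc _ (Nat.gcd_dvd_left _ _), mul_comm]; rfl
  have pd : ∀ i, orbPt n d (L + i) = orbPt n d i := fun i =>
    orbPt_eq_of_modEq (by simp [← hLd, Nat.ModEq])
  have pd' : ∀ i, orbPt n d' (L + i) = orbPt n d' i := fun i =>
    orbPt_eq_of_modEq (by simp [← hLd', Nat.ModEq])
  have sB : ∑ i ∈ Finset.range L, B i =
      ((d'.1 / Nat.gcd d.1 d'.1 : ℕ) : ℤ) • ∑ o, cellOf d (.sec o) := by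
    rw [← hLd, sum_range_mul_orb hd (fun o => cellOf d (.sec o)), natCast_zsmul]
  have sB' : ∑ i ∈ Finset.range L, B' i =
      ((d.1 / Nat.gcd d.1 d'.1 : ℕ) : ℤ) • ∑ o, cellOf d' (.sec o) := by
    rw [← hLd', sum_range_mul_orb hd' (fun o => cellOf d' (.sec o)), natCast_zsmul]
  -- A ray times a sector minus a sector times a ray. With the shift i + 1 in the second term the
  -- mixed products A_i·A'_{i+1} cancel in the boundary, and the remaining products of two rays
  -- telescope.
  let f : ℕ → Cells (w + Pi.single d 1 + Pi.single d' 1) →₀ ℤ := fun i =>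
    mulTot _ _ (mulTot _ _ m (A i)) (B' i) - mulTot _ _ (mulTot _ _ m (B i)) (A' (i + 1))
  let r : ℕ → Cells (w + Pi.single d 1 + Pi.single d' 1) →₀ ℤ := fun i =>
    mulTot _ _ (mulTot _ _ m (A i)) (A' i)
  have hf : ∀ i, bd _ (f i) = mulTot _ _ (mulTot _ _ m (cellOf d .pt)) (B' i) -
      mulTot _ _ (mulTot _ _ m (B i)) (cellOf d' .pt) + (r (i + 1) - r i) := by
    intro i
    rw [map_sub]
    simp only [r, bd_mulTot_eps, hc, he, eps_mulTot, hA, hA', hB, hB', eA, eB, map_neg,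
      LinearMap.neg_apply, mulTot_sub_left, mulTot_sub_right, map_zero, LinearMap.zero_apply, zero_add]
    abel
  refine ⟨∑ i ∈ Finset.range L, f i, ?_, ?_⟩
  · change _ ∈ inv 1 _
    -- Applying t shifts the index by one, and f has period L.
    rw [mem_inv, pow_one, map_sum, ← sum_range_succ_eq f]
    · refine Finset.sum_congr rfl fun i _ => ?_
      simp only [f, map_sub, ← mulTot_permRep, gA, gA', gB, gB', hm']
    · simp only [f, A, A', B, B']
      rw [pd', ← pd 0, ← pd' 0, add_zero]
  · rw [map_sum]
    simp only [hf]
    rw [Finset.sum_add_distrib, Finset.sum_sub_distrib, Finset.sum_sub_distrib,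
      sum_range_succ_eq r, sub_self, add_zero, ← map_sum, sB', map_smul]
    · congr 1
      simp only [← LinearMap.sum_apply, ← map_sum]
      rw [sB, map_smul, map_smul, LinearMap.smul_apply]
    · simp only [r, A, A']
      rw [← add_zero L, pd, pd']

end onefactor

/-! ### Dependence of the basic cycles on the number of sector factors only -/

section counts
variable {n : ℕ} {v w : Dv n → ℕ}

/-- The number of elements of `S` among the factors `S^{λ_d}`, for each `d`. -/
def cnt (S : Factors v → Bool) (d : Dv n) : ℕ := ∑ j : Fin (v d), if S ⟨d, j⟩ then 1 else 0

/-- The first `U d` factors `S^{λ_d}`, for each `d`. -/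
def stdS (v U : Dv n → ℕ) : Factors v → Bool := fun i => decide ((i.2 : ℕ) < U i.1)

lemma cnt_joinS (S : Factors v → Bool) (T : Factors w → Bool) :
    cnt (joinS S T) = cnt S + cnt T := by
  funext d
  change cnt _ d = cnt S d + cnt T d
  unfold cnt
  refine (Fin.sum_univ_add (a := v d) (b := w d) _).trans ?_
  congr 1
  · refine Finset.sum_congr rfl fun j _ => ?_
    rw [← joinS_inl S T ⟨d, j⟩]
  · refine Finset.sum_congr rfl fun j _ => ?_
    rw [← joinS_inr S T ⟨d, j⟩]

lemma cnt_le (S : Factors v → Bool) : cnt S ≤ v := by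
  intro d
  unfold cnt
  refine (Finset.sum_le_card_nsmul _ _ 1 fun j _ => ?_).trans (by simp)
  split_ifs <;> simp

lemma cnt_stdS {U : Dv n → ℕ} (h : U ≤ v) : cnt (stdS v U) = U := by
  funext d
  simp only [cnt, stdS, decide_eq_true_eq]
  rw [Fin.sum_univ_eq_sum_range (fun j => if j < U d then 1 else 0), Finset.sum_boole]
  have : (Finset.range (v d)).filter (· < U d) = Finset.range (U d) := by
    ext j
    have : U d ≤ v d := h d
    simp only [Finset.mem_filter, Finset.mem_range]
    omega
  rw [this]
  simp

lemma cnt_single {d : Dv n} (T : Factors (Pi.single d 1 : Dv n → ℕ) → Bool) :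
    cnt T = Pi.single d (if T default then 1 else 0) := by
  funext d'
  by_cases h : d' = d
  · subst h
    have e : (Pi.single d' 1 : Dv n → ℕ) d' = 1 := Pi.single_eq_same _ _
    rw [Pi.single_eq_same]
    unfold cnt
    have : ∀ j : Fin ((Pi.single d' 1 : Dv n → ℕ) d'),
        (⟨d', j⟩ : Factors (Pi.single d' 1 : Dv n → ℕ)) = default := fun j => Subsingleton.elim _ _
    simp only [this, Finset.sum_const, Finset.card_univ, Fintype.card_fin, e, one_smul]
  · rw [Pi.single_eq_of_ne h]
    have : cnt T d' ≤ (Pi.single d 1 : Dv n → ℕ) d' := cnt_le T d'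
    rw [Pi.single_eq_of_ne h] at this
    omega

variable [NeZero n]

/-- This trades a sector sum in the last factor for one in an earlier factor of the same type. By
`ih` an earlier factor S^{λ_d} may be taken to be the one next to last, and then the gold relation
for d = d', with both coefficients 1, exchanges the two. -/
lemma theta_exchange_mem_bnd (ih : ∀ S S' : Factors w → Bool, cnt S = cnt S' →
      theta w S - theta w S' ∈ bnd 1 w) (d : Dv n) (S S' : Factors w → Bool)
    (h : cnt S + Pi.single d 1 = cnt S') :
    mulTot _ _ (theta w S) (∑ o, cellOf d (.sec o)) - mulTot _ _ (theta w S') (cellOf d .pt) ∈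
      bnd 1 (w + Pi.single d 1) := by
  -- The set S' has at least one factor S^{λ_d}, so w contains such a factor and it can be split
  -- off.
  obtain ⟨w', rfl⟩ : ∃ w', w = w' + Pi.single d 1 := by
    refine ⟨w - Pi.single d 1, (tsub_add_cancel_of_le ?_).symm⟩
    have h2 := cnt_le S'
    rw [← h] at h2
    exact le_add_self.trans h2
  have hU : cnt S ≤ w' := by
    have h2 := cnt_le S'
    rw [← h] at h2
    exact le_of_add_le_add_right h2
  have hR := cnt_stdS hU
  set R := stdS w' (cnt S)
  -- Both sets are brought to the form "R on w', plus a choice on the split factor", with the same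
  -- R.
  have h1 := ih S (joinS R fun _ => false) (by rw [cnt_joinS, hR, cnt_single]; simp)
  have h2 := ih S' (joinS R fun _ => true) (by rw [cnt_joinS, hR, cnt_single, ← h]; simp)
  rw [← mulTot_theta, theta_single_false _ _ rfl] at h1
  rw [← mulTot_theta, theta_single_true _ _ rfl] at h2
  have hg := gold_mem_bnd (theta_mem_inv R) (bd_theta w' R) (eps_theta R) d d
  have hpos : 0 < d.1 := Nat.pos_of_dvd_of_pos
    (Nat.dvd_of_mem_divisors (Finset.mem_of_mem_erase d.2)) (NeZero.pos n)
  rw [Nat.gcd_self, Nat.div_self hpos, Nat.cast_one, one_smul, one_smul] at hg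
  have htop := theta_single_true d (fun _ => true) rfl
  have e1 : (∑ o, cellOf d (.sec o)) ∈ inv 1 _ := htop ▸ theta_mem_inv _
  have e2 : bd _ (∑ o, cellOf d (.sec o)) = 0 := htop ▸ bd_theta _ _
  have e3 : cellOf d .pt ∈ inv 1 _ := theta_single_false d (fun _ => false) rfl ▸ theta_mem_inv _
  have h1' := mulTot_mem_bnd_left h1 e1 e2
  have h2' := mulTot_mem_bnd_left h2 e3 (bd_cellOf_pt d)
  rw [mulTot_sub_left] at h1' h2'
  have := add_mem (sub_mem h1' h2') hg
  convert this using 1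
  abel

/-- Up to boundaries, `theta` depends only on the number of factors `S^{λ_d}` in `S`, for each `d`. -/
lemma theta_sub_mem_bnd (v : Dv n → ℕ) (S S' : Factors v → Bool) (h : cnt S = cnt S') :
    theta v S - theta v S' ∈ bnd 1 v := by
  induction v using factor_induction with
  | h0 =>
    have : S = S' := funext fun i => i.2.elim0
    rw [this, sub_self]
    exact zero_mem _
  | h w d ih =>
    obtain ⟨S₁, T₁, rfl⟩ : ∃ S₁ T₁, joinS S₁ T₁ = S := ⟨_, _, joinS_eta S⟩
    obtain ⟨S₂, T₂, rfl⟩ : ∃ S₂ T₂, joinS S₂ T₂ = S' := ⟨_, _, joinS_eta S'⟩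
    rw [cnt_joinS, cnt_joinS, cnt_single, cnt_single] at h
    rw [← mulTot_theta, ← mulTot_theta]
    cases h1 : T₁ default <;> cases h2 : T₂ default <;> simp only [h1, h2] at h
    · have := mulTot_mem_bnd_left (ih S₁ S₂ (by simpa using h)) (theta_mem_inv T₁) (bd_theta _ T₁)
      rw [mulTot_sub_left] at this
      rw [theta_single_false d _ h1] at this ⊢
      rw [theta_single_false d _ h2]
      exact this
    · rw [theta_single_false d _ h1, theta_single_true d _ h2, ← neg_sub]
      exact neg_mem (theta_exchange_mem_bnd ih d S₂ S₁ (by simpa using h.symm))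
    · rw [theta_single_true d _ h1, theta_single_false d _ h2]
      exact theta_exchange_mem_bnd ih d S₁ S₂ (by simpa using h)
    · have := mulTot_mem_bnd_left (ih S₁ S₂ (by simpa using h)) (theta_mem_inv T₁) (bd_theta _ T₁)
      rw [mulTot_sub_left] at this
      rw [theta_single_true d _ h1] at this ⊢
      rw [theta_single_true d _ h2]
      exact this

end counts

/-! ### Exponents of monomials -/

section exponents
variable {n : ℕ}

/-- The exponents of the `a_d` in a monomial. -/
def expA (s : (Dv n ⊕ Dv n) →₀ ℕ) : Dv n → ℕ := fun d => s (.inl d)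
/-- The exponents of the `u_d` in a monomial. -/
def expU (s : (Dv n ⊕ Dv n) →₀ ℕ) : Dv n → ℕ := fun d => s (.inr d)

lemma expA_add (s s' : (Dv n ⊕ Dv n) →₀ ℕ) : expA (s + s') = expA s + expA s' := rfl
lemma expU_add (s s' : (Dv n ⊕ Dv n) →₀ ℕ) : expU (s + s') = expU s + expU s' := rfl

lemma expA_inl (d : Dv n) : expA (Finsupp.single (.inl d) 1) = Pi.single d 1 := by
  funext d'
  classical
  simp [expA, Finsupp.single_apply, Pi.single_apply, eq_comm]
lemma expA_inr (d : Dv n) : expA (Finsupp.single (.inr d) 1) = 0 := by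
  funext d'
  simp [expA]
lemma expU_inl (d : Dv n) : expU (Finsupp.single (.inl d) 1) = 0 := by
  funext d'
  simp [expU]
lemma expU_inr (d : Dv n) : expU (Finsupp.single (.inr d) 1) = Pi.single d 1 := by
  funext d'
  classical
  simp [expU, Finsupp.single_apply, Pi.single_apply, eq_comm]

lemma polyA_mul_polyU (d d' : Dv n) : polyA d * polyU d' =
    MvPolynomial.monomial (Finsupp.single (.inl d) 1 + Finsupp.single (.inr d') 1) (1 : ℤ) := by
  rw [← one_mul (1 : ℤ), ← MvPolynomial.monomial_mul]
  rfl

lemma BZ.dvd (b : BZ n) : b.1 ∣ n := Nat.dvd_of_mem_divisors b.2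

end exponents

/-! ### The cycle of a polynomial -/

section polynomials
variable {n : ℕ} [NeZero n] {v w : Dv n → ℕ}

/-- The cycle in `S^v` given by a monomial; it is zero if the monomial does not have degree `v`. -/
noncomputable def phiMon (v : Dv n → ℕ) (s : (Dv n ⊕ Dv n) →₀ ℕ) : Cells v →₀ ℤ :=
  if expA s + expU s = v then theta v (stdS v (expU s)) else 0

/-- The cycle in `S^v` given by a polynomial. -/
noncomputable def Phi (v : Dv n → ℕ) : Poly n →ₗ[ℤ] (Cells v →₀ ℤ) :=
  (MvPolynomial.basisMonomials _ ℤ).constr ℤ (phiMon v)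

lemma Phi_monomial (s : (Dv n ⊕ Dv n) →₀ ℕ) (c : ℤ) :
    Phi v (MvPolynomial.monomial s c) = c • phiMon v s := by
  have h : Phi v (MvPolynomial.monomial s 1) = phiMon v s := by
    have := (MvPolynomial.basisMonomials (Dv n ⊕ Dv n) ℤ).constr_basis ℤ (phiMon v) s
    rwa [MvPolynomial.coe_basisMonomials] at this
  rw [← h, ← map_smul, MvPolynomial.smul_monomial, smul_eq_mul, mul_one]

lemma Phi_mem (N : Submodule ℤ (Cells v →₀ ℤ)) (h : ∀ S, theta v S ∈ N) (p : Poly n) :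
    Phi v p ∈ N := by
  induction p using MvPolynomial.induction_on' with
  | monomial s c =>
    rw [Phi_monomial, phiMon]
    refine N.smul_mem _ ?_
    split_ifs
    exacts [h _, N.zero_mem]
  | add p q hp hq => rw [map_add]; exact add_mem hp hq

lemma Phi_mem_inv (p : Poly n) : Phi v p ∈ inv 1 v := Phi_mem _ theta_mem_inv p
lemma bd_Phi (p : Poly n) : bd v (Phi v p) = 0 := Phi_mem (LinearMap.ker (bd v)) (bd_theta v) p
lemma eps_Phi (p : Poly n) : eps v (Phi v p) = Phi v p := by
  have := Phi_mem (LinearMap.ker (eps v - LinearMap.id))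
    (fun S => by simp [eps_theta]) p
  simpa [sub_eq_zero] using this

lemma theta_sub_phiMon_mem_bnd {s : (Dv n ⊕ Dv n) →₀ ℕ} (hs : expA s + expU s = v)
    {S : Factors v → Bool} (hS : cnt S = expU s) : theta v S - phiMon v s ∈ bnd 1 v := by
  rw [phiMon, if_pos hs]
  exact theta_sub_mem_bnd _ _ _ (by rw [hS, cnt_stdS (hs ▸ le_add_self)])

/-- The two sides can place the sector sums in different factors, but equally many for each d, so
they differ by a boundary. -/
lemma mulTot_phiMon (s s' : (Dv n ⊕ Dv n) →₀ ℕ) (hs : expA s + expU s = v) :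
    mulTot v w (phiMon v s) (phiMon w s') - phiMon (v + w) (s + s') ∈ bnd 1 (v + w) := by
  have hss : expA (s + s') + expU (s + s') = v + (expA s' + expU s') := by
    rw [expA_add, expU_add, ← hs]; abel
  by_cases hs' : expA s' + expU s' = w
  · rw [phiMon, phiMon, if_pos hs, if_pos hs', mulTot_theta]
    refine theta_sub_phiMon_mem_bnd (by rw [hss, hs']) ?_
    rw [cnt_joinS, cnt_stdS (hs ▸ le_add_self), cnt_stdS (hs' ▸ le_add_self), expU_add]
  · have hne : ¬ expA (s + s') + expU (s + s') = v + w := by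
      rw [hss]
      exact fun h => hs' (add_left_cancel h)
    rw [phiMon, phiMon, phiMon, if_neg hs', if_neg hne, map_zero, sub_zero]
    exact zero_mem _

/-- The condition `hs` is needed because `Phi` ignores terms of other degrees: otherwise a monomial
of the wrong degree could be compensated by `q` in the product. -/
lemma mulTot_Phi (s : (Dv n ⊕ Dv n) →₀ ℕ) (hs : expA s + expU s = v) (q : Poly n) :
    mulTot v w (phiMon v s) (Phi w q) - Phi (v + w) (MvPolynomial.monomial s 1 * q) ∈
      bnd 1 (v + w) := by
  induction q using MvPolynomial.induction_on' with
  | monomial s' c =>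
    rw [MvPolynomial.monomial_mul, Phi_monomial, Phi_monomial, one_mul, map_smul, ← smul_sub]
    exact Submodule.smul_mem _ _ (mulTot_phiMon s s' hs)
  | add p q hp hq =>
    rw [mul_add, map_add, map_add, map_add, add_sub_add_comm]
    exact add_mem hp hq

lemma Phi_monomial_mul_eq_zero (s : (Dv n ⊕ Dv n) →₀ ℕ) (hs : ¬ expA s + expU s ≤ v) (q : Poly n) :
    Phi v (MvPolynomial.monomial s 1 * q) = 0 := by
  induction q using MvPolynomial.induction_on' with
  | monomial s' c =>
    rw [MvPolynomial.monomial_mul, Phi_monomial, phiMon, if_neg, smul_zero]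
    rintro rfl
    refine hs ?_
    rw [expA_add, expU_add, add_add_add_comm]
    exact le_self_add
  | add p q hp hq => rw [mul_add, map_add, hp, hq, add_zero]

end polynomials

/-! ### The relations hold in homology -/

section ideal
variable {n : ℕ} [NeZero n]

/-- The orbit Θ_b is generated by its base point, with stabilizer ⟨t^b⟩, so equivariant maps out of
ℤ⟨Θ_b⟩ are elements fixed by t^b. -/
lemma exists_orb_hom {b : ℕ} (hb : b ∣ n) {Y : Type} [MulAction (Cyc n) Y] (y : Y →₀ ℤ)
    (hy : permRep n Y (t n ^ b) y = y) : ∃ F : perm n (Orb n b) ⟶ perm n Y,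
      ∀ i, F.hom (Finsupp.single (orbPt n b i) 1) = permRep n Y (t n ^ i) y := by
  choose idx hidx using orbPt_surjective (n := n) (d := b)
  have hyk : ∀ k, permRep n Y (t n ^ (b * k)) y = y := by
    intro k
    induction k with
    | zero => simp
    | succ k ih => rw [Nat.mul_succ, pow_add, map_mul, Module.End.mul_apply, hy, ih]
  have hmod : ∀ i j, i ≡ j [MOD b] → permRep n Y (t n ^ i) y = permRep n Y (t n ^ j) y := by
    have h1 : ∀ i, permRep n Y (t n ^ i) y = permRep n Y (t n ^ (i % b)) y := by
      intro i
      conv_lhs => rw [← Nat.mod_add_div i b, pow_add, map_mul, Module.End.mul_apply, hyk]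
    intro i j hij
    rw [h1 i, hij, ← h1 j]
  refine ⟨permLift (fun o => permRep n Y (t n ^ idx o) y) fun g o => ?_, fun i => ?_⟩
  · obtain ⟨k, rfl⟩ := exists_t_pow g
    rw [← Module.End.mul_apply, ← map_mul, ← pow_add]
    refine hmod _ _ ((orbPt_eq_iff hb).1 ?_)
    rw [hidx, ← smul_orbPt, hidx]
  · rw [permLift_single]
    exact hmod _ _ ((orbPt_eq_iff hb).1 (hidx _))

/-- A bounding chain y over Θ_b is a map out of ℤ⟨Θ_b⟩; composing it with f gives a chain over Θ_a.
All translates of y bound the same invariant x, so the boundary is x times the coefficient sum of f.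
-/
lemma smul_mem_bnd_of_hom {v : Dv n → ℕ} {a b : BZ n} (f : a ⟶ b) {x : Cells v →₀ ℤ}
    (hx : x ∈ inv 1 v) (h : x ∈ bnd b.1 v) : deg f • x ∈ bnd a.1 v := by
  obtain ⟨y, hy, rfl⟩ := h
  obtain ⟨F, hF⟩ := exists_orb_hom (BZ.dvd b) y (mem_inv.1 hy)
  have hbd : ∀ z : Orb n b.1 →₀ ℤ, bd v (F.hom z) = (z.sum fun _ c => c) • bd v y := by
    intro z
    induction z using Finsupp.induction_linear with
    | zero =>
      rw [Finsupp.sum_zero_index, zero_smul]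
      exact (congrArg (bd v) (map_zero F.hom)).trans (map_zero _)
    | add f g hf hg =>
      rw [Finsupp.sum_add_index' (fun _ => rfl) (fun _ _ _ => rfl), add_smul, ← hf, ← hg]
      exact (congrArg (bd v) (map_add F.hom f g)).trans (map_add _ _ _)
    | single o c =>
      obtain ⟨i, rfl⟩ := orbPt_surjective o
      rw [Finsupp.sum_single_index rfl, single_eq_smul]
      refine (congrArg (bd v) (map_smul F.hom c _)).trans ?_
      rw [map_smul, hF, bd_permRep, permRep_eq_of_inv_one hx]
  refine ⟨F.hom (f.hom.hom (Finsupp.single ((1 : Cyc n) : Orb n a.1) 1)), ?_, hbd _⟩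
  change _ ∈ inv _ _
  rw [mem_inv]
  have h2 : t n ^ a.1 • ((1 : Cyc n) : Orb n a.1) = ((1 : Cyc n) : Orb n a.1) :=
    t_pow_smul_of_dvd dvd_rfl _
  have h3 := perm_hom_smul (f.hom ≫ F) (t n ^ a.1) ((1 : Cyc n) : Orb n a.1)
  rw [h2] at h3
  exact h3.symm

lemma cellOf_pt_eq_theta (d : Dv n) :
    cellOf d .pt = theta (Pi.single d 1 : Dv n → ℕ) fun _ => false :=
  (theta_single_false d _ rfl).symm

lemma sum_sec_eq_theta (d : Dv n) :
    ∑ o, cellOf d (.sec o) = theta (Pi.single d 1 : Dv n → ℕ) fun _ => true :=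
  (theta_single_true d _ rfl).symm

/-- Relations hold in homology. -/
lemma Phi_mem_bnd {e : BZ n} {p : Poly n} (h : MemJ e p) (v : Dv n → ℕ) : Phi v p ∈ bnd e.1 v := by
  induction h generalizing v with
  | zero e => rw [map_zero]; exact zero_mem _
  | add _ _ hp hq => rw [map_add]; exact add_mem (hp v) (hq v)
  | @mul e p q _ hq =>
    induction p using MvPolynomial.induction_on' with
    | monomial s c =>
      rw [show MvPolynomial.monomial s c = c • MvPolynomial.monomial s (1 : ℤ) by
        rw [MvPolynomial.smul_monomial, smul_eq_mul, mul_one], smul_mul_assoc, map_smul]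
      refine Submodule.smul_mem _ _ ?_
      -- If the monomial fits into v, then S^v splits accordingly and boundaries form an ideal; if
      -- not, no term of the product has degree v.
      by_cases hs : expA s + expU s ≤ v
      · obtain ⟨w, rfl⟩ := exists_add_of_le hs
        have h1 := bnd_mono (one_dvd e.1) (mulTot_Phi (w := w) s rfl q)
        have h2 : mulTot _ _ (phiMon (expA s + expU s) s) (Phi w q) ∈ bnd e.1 _ := by
          rw [show phiMon (expA s + expU s) s = Phi _ (MvPolynomial.monomial s 1) by
            rw [Phi_monomial, one_smul]]
          exact mulTot_mem_bnd_right (inv_of_inv_one (Phi_mem_inv _)) (bd_Phi _) (eps_Phi _) (hq w)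
        simpa using sub_mem h2 h1
      · rw [Phi_monomial_mul_eq_zero s hs]
        exact zero_mem _
    | add p p' hp hp' => rw [add_mul, map_add]; exact add_mem hp hp'
  | pull f _ hp =>
    rw [map_smul]
    exact smul_mem_bnd_of_hom f (Phi_mem_inv _) (hp v)
  | euler d =>
    rw [show polyA d = MvPolynomial.monomial (Finsupp.single (.inl d) 1) (1 : ℤ) from rfl,
      Phi_monomial, one_smul, phiMon]
    split_ifs with h
    · rw [expA_inl, expU_inl, add_zero] at h
      subst h
      -- The point bounds the ray through the base point of Θ_d, which t^d fixes.
      rw [expU_inl, theta_single_false d _ (by simp [stdS]), ← bd_cellOf_ray d (orbPt n d 0)]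
      refine ⟨_, ?_, rfl⟩
      change _ ∈ inv _ _
      rw [mem_inv, permRep_cellOf, Cell.smul_ray]
      change cellOf d (.ray (t n ^ d.1 • _)) = _
      rw [t_pow_smul_of_dvd dvd_rfl]
    · exact zero_mem _
  | gold d d' =>
    rw [map_sub, map_smul, map_smul, polyA_mul_polyU, polyA_mul_polyU, Phi_monomial, Phi_monomial,
      one_smul, one_smul]
    by_cases hv : (Pi.single d 1 : Dv n → ℕ) + Pi.single d' 1 = v
    · replace hv : (0 : Dv n → ℕ) + Pi.single d 1 + Pi.single d' 1 = v := by rw [zero_add, hv]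
      subst hv
      have hg := gold_mem_bnd (theta_mem_inv fun _ => false) (bd_theta 0 _) (eps_theta _) d d'
      rw [cellOf_pt_eq_theta, cellOf_pt_eq_theta, sum_sec_eq_theta, sum_sec_eq_theta, mulTot_theta,
        mulTot_theta, mulTot_theta, mulTot_theta] at hg
      have h0 : ∀ S : Factors (0 : Dv n → ℕ) → Bool, cnt S = 0 := fun S => le_antisymm (cnt_le S) bot_le
      have h1 := theta_sub_phiMon_mem_bnd (v := 0 + Pi.single d 1 + Pi.single d' 1)
        (s := Finsupp.single (.inl d) 1 + Finsupp.single (.inr d') 1)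
        (S := joinS (joinS (fun _ => false) fun _ => false) fun _ => true)
        (by rw [expA_add, expU_add, expA_inl, expA_inr, expU_inl, expU_inr]; abel)
        (by rw [cnt_joinS, cnt_joinS, h0, cnt_single, cnt_single, expU_add, expU_inl, expU_inr]; simp)
      have h2 := theta_sub_phiMon_mem_bnd (v := 0 + Pi.single d 1 + Pi.single d' 1)
        (s := Finsupp.single (.inl d') 1 + Finsupp.single (.inr d) 1)
        (S := joinS (joinS (fun _ => false) fun _ => true) fun _ => false)
        (by rw [expA_add, expU_add, expA_inl, expA_inr, expU_inl, expU_inr]; abel)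
        (by rw [cnt_joinS, cnt_joinS, h0, cnt_single, cnt_single, expU_add, expU_inl, expU_inr]; simp)
      have := sub_mem hg (sub_mem
        (Submodule.smul_mem _ ((d.1 / Nat.gcd d.1 d'.1 : ℕ) : ℤ) h1)
        (Submodule.smul_mem _ ((d'.1 / Nat.gcd d.1 d'.1 : ℕ) : ℤ) h2))
      change _ ∈ bnd 1 _
      convert this using 1
      module
    · rw [phiMon, phiMon, if_neg, if_neg]
      · simp
      · rw [expA_add, expU_add, expA_inl, expA_inr, expU_inl, expU_inr, add_zero, zero_add, add_comm]
        exact hv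
      · rw [expA_add, expU_add, expA_inl, expA_inr, expU_inl, expU_inr, add_zero, zero_add]
        exact hv

end ideal

/-! ### Splitting off the last factor: S^w □ S^{λ_d} as an iterated cone -/

section assemble
variable {n : ℕ} {w : Dv n → ℕ} {d : Dv n}

lemma shuffleSign_mul_self {v w : Dv n → ℕ} (x : Cells v) (y : Cells w) :
    shuffleSign x y * shuffleSign x y = 1 := by
  rw [shuffleSign, ← Finset.prod_mul_distrib]
  refine Finset.prod_eq_one fun i _ => ?_
  rw [← Finset.prod_mul_distrib]
  refine Finset.prod_eq_one fun j _ => ?_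
  split_ifs
  · rw [← pow_add, ← two_mul, pow_mul]
    simp
  · simp

lemma mulTot_cellOf_apply_self (a : Cells w →₀ ℤ) (c : Cell n d) (y : Cells w) :
    mulTot _ _ a (cellOf d c) (merge y (cellFun d c)) = a y * shuffleSign y (cellFun d c) := by
  rw [mulTot_apply, cellOf, Finsupp.single_eq_same, mul_one]

lemma mulTot_cellOf_apply_of_ne (a : Cells w →₀ ℤ) {c c' : Cell n d} (h : c' ≠ c) (y : Cells w) :
    mulTot _ _ a (cellOf d c) (merge y (cellFun d c')) = 0 := by
  rw [mulTot_apply, cellOf, Finsupp.single_eq_of_ne ((cellFun_injective d).ne h), mul_zero, zero_mul]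

lemma mulTot_zero_left {v w : Dv n → ℕ} (b : Cells w →₀ ℤ) : mulTot v w 0 b = 0 := by
  rw [map_zero, LinearMap.zero_apply]

lemma mulTot_add_left {v w : Dv n → ℕ} (a a' : Cells v →₀ ℤ) (b : Cells w →₀ ℤ) :
    mulTot v w (a + a') b = mulTot v w a b + mulTot v w a' b := by
  rw [map_add, LinearMap.add_apply]

variable [NeZero n]

/-- An element of the total module of `S^w □ S^{λ_d}`, given by its components at the cells of `S^{λ_d}`. -/
noncomputable def asm (x : Cells w →₀ ℤ) (r s : Orb n d → Cells w →₀ ℤ) :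
    Cells (w + Pi.single d 1) →₀ ℤ :=
  mulTot _ _ x (cellOf d .pt) + ∑ o, mulTot _ _ (eps w (r o)) (cellOf d (.ray o)) +
    ∑ o, mulTot _ _ (s o) (cellOf d (.sec o))

lemma asm_apply_pt (x : Cells w →₀ ℤ) (r s : Orb n d → Cells w →₀ ℤ) (y : Cells w) :
    asm x r s (merge y (cellFun d .pt)) = x y * shuffleSign y (cellFun d .pt) := by
  rw [asm, Finsupp.add_apply, Finsupp.add_apply, Finsupp.finsetSum_apply, Finsupp.finsetSum_apply,
    Finset.sum_eq_zero, Finset.sum_eq_zero, mulTot_cellOf_apply_self, add_zero, add_zero]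
  all_goals exact fun o _ => mulTot_cellOf_apply_of_ne _ (by simp) _

lemma asm_apply_ray (x : Cells w →₀ ℤ) (r s : Orb n d → Cells w →₀ ℤ) (y : Cells w) (o : Orb n d) :
    asm x r s (merge y (cellFun d (.ray o))) =
      eps w (r o) y * shuffleSign y (cellFun d (.ray o)) := by
  rw [asm, Finsupp.add_apply, Finsupp.add_apply, Finsupp.finsetSum_apply, Finsupp.finsetSum_apply,
    mulTot_cellOf_apply_of_ne _ (by simp), Finset.sum_eq_single o,
    mulTot_cellOf_apply_self, Finset.sum_eq_zero, add_zero, zero_add]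
  · exact fun o _ => mulTot_cellOf_apply_of_ne _ (by simp) _
  · exact fun o' _ h => mulTot_cellOf_apply_of_ne _ (by simpa using h.symm) _
  · simp

lemma asm_apply_sec (x : Cells w →₀ ℤ) (r s : Orb n d → Cells w →₀ ℤ) (y : Cells w) (o : Orb n d) :
    asm x r s (merge y (cellFun d (.sec o))) = s o y * shuffleSign y (cellFun d (.sec o)) := by
  rw [asm, Finsupp.add_apply, Finsupp.add_apply, Finsupp.finsetSum_apply, Finsupp.finsetSum_apply,
    mulTot_cellOf_apply_of_ne _ (by simp), Finset.sum_eq_zero, Finset.sum_eq_single o,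
    mulTot_cellOf_apply_self, add_zero, zero_add]
  · exact fun o' _ h => mulTot_cellOf_apply_of_ne _ (by simpa using h.symm) _
  · simp
  · exact fun o _ => mulTot_cellOf_apply_of_ne _ (by simp) _

lemma asm_injective {x x' : Cells w →₀ ℤ} {r r' s s' : Orb n d → Cells w →₀ ℤ}
    (h : asm x r s = asm x' r' s') : x = x' ∧ r = r' ∧ s = s' := by
  have hs : ∀ (y : Cells w) (c : Cell n d), shuffleSign y (cellFun d c) ≠ 0 := fun y c h0 => by
    simpa [h0] using shuffleSign_mul_self y (cellFun d c)
  refine ⟨?_, ?_, ?_⟩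
  · ext y
    have := congr($h (merge y (cellFun d .pt)))
    rw [asm_apply_pt, asm_apply_pt] at this
    exact mul_right_cancel₀ (hs _ _) this
  · funext o
    rw [← eps_eps (r o), ← eps_eps (r' o)]
    congr 1
    ext y
    have := congr($h (merge y (cellFun d (.ray o))))
    rw [asm_apply_ray, asm_apply_ray] at this
    exact mul_right_cancel₀ (hs _ _) this
  · funext o
    ext y
    have := congr($h (merge y (cellFun d (.sec o))))
    rw [asm_apply_sec, asm_apply_sec] at this
    exact mul_right_cancel₀ (hs _ _) this

lemma exists_asm (z : Cells (w + Pi.single d 1) →₀ ℤ) : ∃ x r s, asm (d := d) x r s = z := by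
  let sl : Cell n d → Cells w →₀ ℤ := fun c => Finsupp.equivFunOnFinite.symm fun y =>
    z (merge y (cellFun d c)) * shuffleSign y (cellFun d c)
  have hsl : ∀ c y, sl c y = z (merge y (cellFun d c)) * shuffleSign y (cellFun d c) :=
    fun _ _ => rfl
  refine ⟨sl .pt, fun o => eps w (sl (.ray o)), fun o => sl (.sec o), ?_⟩
  ext k
  obtain ⟨y, y', rfl⟩ := exists_merge k
  rw [← cellFun_eta d y']
  cases y' default with
  | pt => rw [asm_apply_pt, hsl, mul_assoc, shuffleSign_mul_self, mul_one]
  | ray o => rw [asm_apply_ray, eps_eps, hsl, mul_assoc, shuffleSign_mul_self, mul_one]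
  | sec o => rw [asm_apply_sec, hsl, mul_assoc, shuffleSign_mul_self, mul_one]

lemma asm_add (x x' : Cells w →₀ ℤ) (r r' s s' : Orb n d → Cells w →₀ ℤ) :
    asm x r s + asm x' r' s' = asm (x + x') (r + r') (s + s') := by
  simp only [asm, Pi.add_apply, map_add (eps w), mulTot_add_left, Finset.sum_add_distrib]
  abel

lemma asm_pt (x : Cells w →₀ ℤ) : asm (d := d) x 0 0 = mulTot _ _ x (cellOf d .pt) := by
  simp [asm]

lemma asm_sec (a : Cells w →₀ ℤ) :
    asm (d := d) 0 0 (fun _ => a) = mulTot _ _ a (∑ o, cellOf d (.sec o)) := by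
  simp [asm]

/-- The operator `eps` in the ray component of `asm` absorbs the Koszul signs. The differential then
takes the cone form that `cone_decomposition` handles, whatever the degrees of the components. -/
lemma bd_asm (x : Cells w →₀ ℤ) (r s : Orb n d → Cells w →₀ ℤ) :
    bd _ (asm x r s) = asm (bd w x + ∑ o, r o)
      (fun o => - bd w (r o) + s o - s ((t n)⁻¹ • o)) fun o => bd w (s o) := by
  have h1 : ∀ o, bd (w + Pi.single d 1) (mulTot _ _ (eps w (r o)) (cellOf d (.ray o))) =
      mulTot _ _ (r o) (cellOf d .pt) + mulTot _ _ (eps w (- bd w (r o))) (cellOf d (.ray o)) := by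
    intro o
    rw [bd_mulTot_eps, bd_eps, eps_eps, bd_cellOf_ray, map_neg (eps w)]
    abel
  have h2 : ∀ o, bd (w + Pi.single d 1) (mulTot _ _ (s o) (cellOf d (.sec o))) =
      mulTot _ _ (eps w (s o)) (cellOf d (.ray o)) -
        mulTot _ _ (eps w (s o)) (cellOf d (.ray (t n • o))) +
          mulTot _ _ (bd w (s o)) (cellOf d (.sec o)) := by
    intro o
    rw [bd_mulTot_eps, bd_cellOf_sec, mulTot_sub_right]
    abel
  have h3 : ∑ o : Orb n d, mulTot w _ (eps w (s o)) (cellOf d (.ray (t n • o))) =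
      ∑ o : Orb n d, mulTot w _ (eps w (s ((t n)⁻¹ • o))) (cellOf d (.ray o)) := by
    refine Fintype.sum_equiv (MulAction.toPerm (t n)) _ _ fun o => ?_
    simp
  have h4 : mulTot w (Pi.single d 1) (∑ o, r o) (cellOf d .pt) =
      ∑ o, mulTot _ _ (r o) (cellOf d .pt) := by
    rw [map_sum, LinearMap.sum_apply]
  simp only [asm, map_add (bd _), map_sum (bd _), h1, h2, bd_mulTot_eps, bd_cellOf_pt, map_zero,
    add_zero, Finset.sum_add_distrib, Finset.sum_sub_distrib, h3, mulTot_add_left, h4,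
    map_add (eps w), map_sub (eps w), mulTot_sub_left]
  abel

lemma permRep_asm (g : Cyc n) (x : Cells w →₀ ℤ) (r s : Orb n d → Cells w →₀ ℤ) :
    permRep n _ g (asm x r s) = asm (permRep n _ g x) (fun o => permRep n _ g (r (g⁻¹ • o)))
      fun o => permRep n _ g (s (g⁻¹ • o)) := by
  have hr : ∑ o : Orb n d, mulTot w _ (eps w (permRep n _ g (r o))) (cellOf d (.ray (g • o))) =
      ∑ o : Orb n d, mulTot w _ (eps w (permRep n _ g (r (g⁻¹ • o)))) (cellOf d (.ray o)) := by
    refine Fintype.sum_equiv (MulAction.toPerm g) _ _ fun o => ?_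
    simp
  have hs : ∑ o : Orb n d, mulTot w _ (permRep n _ g (s o)) (cellOf d (.sec (g • o))) =
      ∑ o : Orb n d, mulTot w _ (permRep n _ g (s (g⁻¹ • o))) (cellOf d (.sec o)) := by
    refine Fintype.sum_equiv (MulAction.toPerm g) _ _ fun o => ?_
    simp
  simp only [asm, map_add (permRep n _ g), map_sum (permRep n _ g), ← mulTot_permRep, ← eps_permRep,
    permRep_cellOf, Cell.smul_pt, Cell.smul_ray, Cell.smul_sec]
  rw [← hr, ← hs]

lemma asm_mem_inv_iff {e : ℕ} {x : Cells w →₀ ℤ} {r s : Orb n d → Cells w →₀ ℤ} :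
    asm x r s ∈ inv e _ ↔ x ∈ inv e w ∧ (∀ o, r (t n ^ e • o) = permRep n _ (t n ^ e) (r o)) ∧
      ∀ o, s (t n ^ e • o) = permRep n _ (t n ^ e) (s o) := by
  rw [mem_inv, mem_inv, permRep_asm]
  constructor
  · intro h
    obtain ⟨h1, h2, h3⟩ := asm_injective h
    exact ⟨h1, fun o => by
      rw [← congrFun h2, inv_smul_smul], fun o => by rw [← congrFun h3, inv_smul_smul]⟩
  · rintro ⟨h1, h2, h3⟩
    congr 1
    · funext o
      rw [← h2, smul_inv_smul]
    · funext o
      rw [← h3, smul_inv_smul]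

end assemble

/-! ### Fixed chains of S^w □ S^{λ_d} and the underlying homology of S^v -/

section decomposition
variable {n : ℕ} {v w : Dv n → ℕ} {d : Dv n}

lemma Dv.dvd (d : Dv n) : d.1 ∣ n := Nat.dvd_of_mem_divisors (Finset.mem_of_mem_erase d.2)

lemma exists_top_cell (v : Dv n → ℕ) : ∃ y : Cells v, ∀ i, (y i).dim = 2 :=
  ⟨fun i => .sec (orbPt n i.1 0), fun _ => rfl⟩

/-- There are no cells above the top dimension. The coefficient at a top cell is therefore a
functional on homology, and it takes the value 1 on the top class. -/
lemma bd_apply_eq_zero (x : Cells v →₀ ℤ) {y : Cells v} (hy : ∀ i, (y i).dim = 2) :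
    bd v x y = 0 := by
  induction x using Finsupp.induction_linear with
  | zero => simp
  | add f g hf hg => rw [map_add, Finsupp.add_apply, hf, hg, add_zero]
  | single z a =>
    rw [single_eq_smul, map_smul, Finsupp.smul_apply]
    by_contra h
    have h1 := bd_single_support z (Finsupp.mem_support_iff.2 fun h0 => h (by rw [h0, smul_zero]))
    have h2 : z.dim ≤ y.dim := by
      refine Finset.sum_le_sum fun i _ => ?_
      rw [hy]
      cases z i <;> simp
    omega

variable [NeZero n]

lemma theta_top_apply {y : Cells v} (hy : ∀ i, (y i).dim = 2) : theta v (fun _ => true) y = 1 := by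
  rw [theta_apply, if_pos]
  simpa using hy

lemma theta_top_succ (w : Dv n → ℕ) (d : Dv n) : theta (w + Pi.single d 1) (fun _ => true) =
    mulTot _ _ (theta w fun _ => true) (∑ o, cellOf d (.sec o)) := by
  rw [sum_sec_eq_theta, mulTot_theta]
  congr 1
  funext k
  rcases inl_or_inr k with ⟨a, rfl⟩ | ⟨b, rfl⟩
  · rw [joinS_inl]
  · rw [joinS_inr]

/-- The chains of `S^w □ S^{λ_d}` with boundary in `S^w`. -/
theorem chain_decomposition {e : ℕ}
    (hM : ∀ x, bd w x = 0 → ∃ (c : ℤ) (y : Cells w →₀ ℤ), x = c • theta w (fun _ => true) + bd w y)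
    (hstab : ∀ k, d.1 ∣ e * k → ∀ x, permRep n (Cells w) (t n ^ (e * k)) x = x)
    {z : Cells (w + Pi.single d 1) →₀ ℤ} (hz : z ∈ inv e _) {ξ : Cells w →₀ ℤ}
    (hbd : bd _ z = mulTot _ _ ξ (cellOf d .pt)) :
    ∃ (c C : ℤ), ∃ x ∈ inv e w, ∃ b ∈ bnd e (w + Pi.single d 1),
      ξ = bd w x + (C * ((d.1 / Nat.gcd d.1 e : ℕ) : ℤ)) • theta w (fun _ => true) ∧
      (C = 0 → z = mulTot _ _ x (cellOf d .pt) + c • theta _ (fun _ => true) + b) := by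
  obtain ⟨x, r, s, rfl⟩ := exists_asm z
  obtain ⟨hx, hr, hs⟩ := asm_mem_inv_iff.1 hz
  rw [bd_asm, ← asm_pt] at hbd
  obtain ⟨h1, h2, h3⟩ := asm_injective hbd
  obtain ⟨y, hy⟩ := exists_top_cell w
  -- Here M is the total complex of S^w, τ is the sum of its top cells, and `ev` is the coefficient
  -- at the top cell y.
  obtain ⟨c, C, p, q, hp, hq, hsq, hrq⟩ := cone_decomposition (Dv.dvd d) e (permRep n (Cells w)) hstab
    (bd w) bd_permRep (theta w fun _ => true) (permRep_eq_of_inv_one (theta_mem_inv _))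
    (Finsupp.lapply y) (fun x => bd_apply_eq_zero x hy) (theta_top_apply hy) hM (bd_theta _ _) r s
    hr hs (fun o => congrFun h3 o) (fun o => by
      have := congrFun h2 (t n • o)
      simp only [inv_smul_smul, Pi.zero_apply] at this
      rw [← sub_eq_zero, ← neg_eq_zero, ← this]
      abel)
  have hr' : ∀ o, r o = (C * mark n d e o) • theta w (fun _ => true) - bd w (p o) + q o -
      q ((t n)⁻¹ • o) := by
    intro o
    have := hrq ((t n)⁻¹ • o)
    rwa [smul_inv_smul] at this
  have hq' : ∑ o, q ((t n)⁻¹ • o) = ∑ o, q o :=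
    Equiv.sum_comp (MulAction.toPerm (t n)⁻¹) q
  -- Subtracting the boundary of (0, p, q) moves the sum of p into the point component. In ξ = bd x
  -- + ∑ r the q-terms cancel around the orbit, and the marks add up to d/(d,e).
  refine ⟨c, C, x - ∑ o, p o, ?_, bd _ (asm 0 p q), ⟨_, ?_, rfl⟩, ?_, ?_⟩
  · refine sub_mem hx ?_
    rw [mem_inv, map_sum, ← Equiv.sum_comp (MulAction.toPerm (t n ^ e)) p]
    exact Finset.sum_congr rfl fun o _ => (hp o).symm
  · exact asm_mem_inv_iff.2 ⟨zero_mem _, hp, hq⟩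
  · rw [← h1, ← sum_mark (Dv.dvd d), Finset.sum_congr rfl fun o _ => hr' o]
    simp only [Finset.sum_add_distrib, Finset.sum_sub_distrib, hq', map_sub, map_sum,
      ← Finset.sum_smul, Finset.mul_sum]
    abel
  · rintro rfl
    rw [bd_asm, theta_top_succ, ← asm_sec, ← asm_pt]
    have e1 : c • asm (d := d) 0 0 (fun _ => theta w fun _ => true) =
        asm 0 0 fun _ => c • theta w fun _ => true := by
      rw [asm_sec, asm_sec, map_smul, LinearMap.smul_apply]
    rw [e1, asm_add, asm_add]
    congr 1
    · rw [map_zero]; abel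
    · funext o
      rw [hr' o]
      simp only [Pi.add_apply, Pi.zero_apply]
      module
    · funext o
      rw [hsq o]
      simp

/-- The homology of the underlying complex of `S^v` is generated by the class of the sum of the top
cells. -/
theorem exists_eq_smul_theta_top (v : Dv n → ℕ) (x : Cells v →₀ ℤ) (hx : bd v x = 0) :
    ∃ (c : ℤ) (y : Cells v →₀ ℤ), x = c • theta v (fun _ => true) + bd v y := by
  induction v using factor_induction with
  | h0 =>
    refine ⟨x fun i => i.2.elim0, 0, ?_⟩
    ext y
    obtain rfl : y = fun i => i.2.elim0 := funext fun i => i.2.elim0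
    rw [map_zero, add_zero, Finsupp.smul_apply, theta_top_apply fun i => i.2.elim0]
    simp
  | h w d ih =>
    -- For e = n the acting group is trivial, so the stabilizer condition holds for any order of the
    -- factors.
    obtain ⟨c, C, x', -, _, ⟨b, -, rfl⟩, h1, h2⟩ := chain_decomposition (e := n) (ξ := 0) ih
      (fun k _ x => by
        rw [(t_pow_eq_one_iff _).2 (dvd_mul_right n k), map_one, Module.End.one_apply])
      (mem_inv_of_zero x) (by rw [hx, mulTot_zero_left])
    obtain ⟨y, hy⟩ := exists_top_cell w
    have hC : C = 0 := by
      have h3 := congr($h1 y)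
      rw [Finsupp.add_apply, bd_apply_eq_zero _ hy, Finsupp.smul_apply, theta_top_apply hy, zero_add,
        Finsupp.zero_apply, smul_eq_mul, mul_one, eq_comm, mul_eq_zero] at h3
      refine h3.resolve_right ?_
      have hd : 0 < d.1 := Nat.pos_of_dvd_of_pos (Dv.dvd d) (NeZero.pos n)
      exact_mod_cast (Nat.div_pos (Nat.gcd_le_left _ hd) (Nat.gcd_pos_of_pos_left _ hd)).ne'
    subst hC
    rw [zero_mul, zero_smul, add_zero] at h1
    obtain ⟨c', y', rfl⟩ := ih x' h1.symm
    -- Nonequivariantly the top class of S^w times the point bounds its product with a ray, so only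
    -- the new top class remains.
    refine ⟨c, c' • mulTot _ _ (theta w fun _ => true) (cellOf d (.ray (orbPt n d 0))) +
      mulTot _ _ y' (cellOf d .pt) + b, ?_⟩
    rw [h2 rfl, map_add (bd _), map_add (bd _), map_smul (bd _), bd_mulTot_of_even (eps_theta _) (bd_theta _ _),
      bd_cellOf_ray, bd_mulTot_eps, bd_cellOf_pt, map_zero, add_zero, mulTot_add_left, map_smul,
      LinearMap.smul_apply]
    abel

end decomposition

/-! ### Divisibility and the order of adding factors -/

section arithmetic

lemma coprime_div_gcd_of_padicValNat_le {p d d' : ℕ} (hp : p.Prime) (hd' : d' ≠ 0)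
    (h : padicValNat p d' ≤ padicValNat p d) : Nat.Coprime (d' / Nat.gcd d' d) p := by
  have := Fact.mk hp
  refine Nat.Coprime.symm ((Nat.Prime.coprime_iff_not_dvd hp).2 fun hdvd => ?_)
  have hg : p ^ padicValNat p d' ∣ Nat.gcd d' d :=
    Nat.dvd_gcd pow_padicValNat_dvd ((pow_dvd_pow p h).trans pow_padicValNat_dvd)
  have h2 : p ^ (padicValNat p d' + 1) ∣ d' := by
    have := mul_dvd_mul hg hdvd
    rwa [Nat.mul_div_cancel' (Nat.gcd_dvd_left d' d), ← pow_succ] at this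
  exact pow_succ_padicValNat_not_dvd hd' h2

/-- Away from p the number e has the full valuation of n, which bounds that of d'; at p the
valuation of d suffices. -/
lemma dvd_lcm_of_padicValNat_le {n p c e d d' : ℕ} (hp : p.Prime) (hn : n ≠ 0) (hne : n = e * p ^ c)
    (hd : d ∣ n) (hd' : d' ∣ n) (h : padicValNat p d' ≤ padicValNat p d) : d' ∣ Nat.lcm d e := by
  have hc := coprime_div_gcd_of_padicValNat_le hp (ne_zero_of_dvd_ne_zero hn hd') h
  have he : e ≠ 0 := by rintro rfl; simp at hne; exact hn hne
  obtain ⟨m, hm⟩ : Nat.lcm d e ∣ n := Nat.lcm_dvd hd (hne ▸ dvd_mul_right _ _)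
  obtain ⟨k, hk⟩ := Nat.dvd_lcm_right d e
  obtain ⟨L, hL⟩ := (Nat.gcd_dvd_right d' d).trans (Nat.dvd_lcm_left d e)
  have hm' : m ∣ p ^ c := by
    refine ⟨k, Nat.eq_of_mul_eq_mul_left (Nat.pos_of_ne_zero he) ?_⟩
    rw [← hne, hm, hk]
    ring
  have hG : Nat.gcd d' d ≠ 0 := fun h0 =>
    ne_zero_of_dvd_ne_zero hn hd' (Nat.eq_zero_of_gcd_eq_zero_left h0)
  have hN := Nat.mul_div_cancel' (Nat.gcd_dvd_left d' d)
  rw [hm, hL] at hd'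
  rw [hL]
  refine hN.symm.dvd.trans ?_
  refine Nat.mul_dvd_mul_left _ ?_
  refine (Nat.Coprime.coprime_dvd_right hm' (hc.pow_right c)).dvd_of_dvd_mul_right ?_
  refine Nat.dvd_of_mul_dvd_mul_left (Nat.pos_of_ne_zero hG) ?_
  rwa [hN, ← mul_assoc]

/-- Induction on `v` by adding factors in the order of the values of `f`. -/
lemma sorted_factor_induction {n : ℕ} (f : Dv n → ℕ) {P : (Dv n → ℕ) → Prop} (h0 : P 0)
    (h : ∀ w d, (∀ d', w d' ≠ 0 → f d' ≤ f d) → P w → P (w + Pi.single d 1)) (v : Dv n → ℕ) :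
    P v := by
  induction hN : ∑ d, v d generalizing v with
  | zero =>
    have : v = 0 := by
      funext d
      exact (Finset.sum_eq_zero_iff.1 hN) d (Finset.mem_univ d)
    rwa [this]
  | succ N ih =>
    have hne : (Finset.univ.filter fun d => v d ≠ 0).Nonempty := by
      by_contra hne
      rw [Finset.not_nonempty_iff_eq_empty, Finset.filter_eq_empty_iff] at hne
      rw [Finset.sum_eq_zero fun d _ => not_not.1 (hne (Finset.mem_univ d))] at hN
      omega
    obtain ⟨d, hd, hmax⟩ := Finset.exists_max_image _ f hne
    simp only [Finset.mem_filter, Finset.mem_univ, true_and] at hd hmax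
    have hv : v - Pi.single d 1 + Pi.single d 1 = v := by
      refine tsub_add_cancel_of_le fun d' => ?_
      by_cases h : d' = d
      · subst h; simp; omega
      · simp [h]
    rw [← hv]
    refine h _ _ (fun d' h' => hmax d' ?_) (ih _ ?_)
    · rintro h0
      simp [h0] at h'
    · rw [← hv] at hN
      simp only [Pi.add_apply, Finset.sum_add_distrib] at hN
      rw [Finset.sum_pi_single'] at hN
      simp at hN
      simpa using hN

end arithmetic

/-! ### Top monomials and polynomials of given degree -/

section weights
variable {n : ℕ} {v : Dv n → ℕ}

/-- The monomial `∏ u_d ^ v_d`. -/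
noncomputable def topMon (v : Dv n → ℕ) : (Dv n ⊕ Dv n) →₀ ℕ :=
  Finsupp.equivFunOnFinite.symm (Sum.elim 0 v)

lemma expA_topMon : expA (topMon v) = 0 := rfl
lemma expU_topMon : expU (topMon v) = v := rfl

/-- The polynomials of degree `v`, with the integer part of the degree arbitrary. -/
noncomputable def wtSpan (v : Dv n → ℕ) : Submodule ℤ (Poly n) :=
  Submodule.span ℤ ((fun s => MvPolynomial.monomial s 1) '' {s | expA s + expU s = v})

lemma monomial_mem_wtSpan {s : (Dv n ⊕ Dv n) →₀ ℕ} (hs : expA s + expU s = v) :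
    MvPolynomial.monomial s 1 ∈ wtSpan v := Submodule.subset_span ⟨s, hs, rfl⟩

end weights

/-! ### Monomials generate the homology for p-groups -/

section surjectivity
variable {n : ℕ} [NeZero n] {v w : Dv n → ℕ}

lemma permRep_eq_self_of_dvd {k : ℕ} (h : ∀ d', w d' ≠ 0 → d'.1 ∣ k) (x : Cells w →₀ ℤ) :
    permRep n (Cells w) (t n ^ k) x = x := by
  have hy : ∀ y : Cells w, t n ^ k • y = y := by
    intro y
    funext i
    have hi : i.1.1 ∣ k := h i.1 fun h0 => (h0 ▸ i.2).elim0
    rw [Pi.smul_apply]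
    cases y i with
    | pt => rfl
    | ray o => rw [Cell.smul_ray, t_pow_smul_of_dvd hi]
    | sec o => rw [Cell.smul_sec, t_pow_smul_of_dvd hi]
  induction x using Finsupp.induction_linear with
  | zero => simp
  | add f g hf hg => rw [map_add, hf, hg]
  | single y a => rw [permRep_single, hy]

lemma phiMon_topMon : phiMon v (topMon v) = theta v fun _ => true := by
  rw [phiMon, if_pos (by rw [expA_topMon, expU_topMon, zero_add]), expU_topMon]
  congr 1
  funext i
  simp [stdS]

lemma phiMon_inl (d : Dv n) :
    phiMon (Pi.single d 1) (Finsupp.single (.inl d) 1) = cellOf d .pt := by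
  rw [phiMon, if_pos (by rw [expA_inl, expU_inl, add_zero]), expU_inl]
  exact theta_single_false d _ (by simp [stdS])

lemma mulTot_Phi_right (q : Poly n) (s : (Dv n ⊕ Dv n) →₀ ℕ) (hs : expA s + expU s = w) :
    mulTot v w (Phi v q) (phiMon w s) - Phi (v + w) (q * MvPolynomial.monomial s 1) ∈
      bnd 1 (v + w) := by
  induction q using MvPolynomial.induction_on' with
  | monomial s' c =>
    rw [MvPolynomial.monomial_mul, Phi_monomial, Phi_monomial, mul_one, map_smul,
      LinearMap.smul_apply, ← smul_sub]
    refine Submodule.smul_mem _ _ ?_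
    by_cases hs' : expA s' + expU s' = v
    · exact mulTot_phiMon s' s hs'
    · have hne : ¬ expA (s' + s) + expU (s' + s) = v + w := by
        rw [expA_add, expU_add, add_add_add_comm, hs]
        exact fun h => hs' (add_right_cancel h)
      rw [phiMon, if_neg hs', mulTot_zero_left, phiMon, if_neg hne, sub_zero]
      exact zero_mem _
  | add p q hp hq =>
    rw [add_mul, map_add, map_add, map_add, LinearMap.add_apply, add_sub_add_comm]
    exact add_mem hp hq

lemma mulTot_Phi_pt (q : Poly n) (d : Dv n) :
    mulTot _ _ (Phi w q) (cellOf d .pt) - Phi (w + Pi.single d 1) (q * polyA d) ∈ bnd 1 _ := by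
  rw [← phiMon_inl]
  exact mulTot_Phi_right q _ (by rw [expA_inl, expU_inl, add_zero])

/-- The top class has infinite order: compare coefficients at a top cell. -/
lemma eq_zero_of_smul_theta_top_eq {a b : ℤ} (y : Cells v →₀ ℤ) (hb : b ≠ 0)
    (h : 0 = bd v y + (a * b) • theta v fun _ => true) : a = 0 := by
  obtain ⟨x, hx⟩ := exists_top_cell v
  have h3 := congr($h x)
  rw [Finsupp.add_apply, bd_apply_eq_zero _ hx, Finsupp.smul_apply, theta_top_apply hx, zero_add,
    Finsupp.zero_apply, smul_eq_mul, mul_one, eq_comm, mul_eq_zero] at h3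
  exact h3.resolve_right hb

lemma div_gcd_ne_zero (d : Dv n) (e : ℕ) : ((d.1 / Nat.gcd d.1 e : ℕ) : ℤ) ≠ 0 := by
  have hd : 0 < d.1 := Nat.pos_of_dvd_of_pos (Dv.dvd d) (NeZero.pos n)
  exact_mod_cast (Nat.div_pos (Nat.gcd_le_left _ hd) (Nat.gcd_pos_of_pos_left _ hd)).ne'

/-- Elements of ⟨t^e⟩ that fix a point of Θ_d are powers of t^{lcm(d,e)}. Every d' occurring in w
divides this lcm because the valuation of d at p is maximal, so they fix all cells of S^w. -/
lemma stabilizer_trivial {p c e : ℕ} (hp : p.Prime) (hne : n = e * p ^ c) {d : Dv n}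
    (hd : ∀ d', w d' ≠ 0 → padicValNat p d'.1 ≤ padicValNat p d.1) (k : ℕ) (hk : d.1 ∣ e * k)
    (x : Cells w →₀ ℤ) : permRep n (Cells w) (t n ^ (e * k)) x = x :=
  permRep_eq_self_of_dvd (fun d' h' =>
    (dvd_lcm_of_padicValNat_le hp (NeZero.ne n) hne (Dv.dvd d) (Dv.dvd d') (hd d' h')).trans
      (Nat.lcm_dvd hk (dvd_mul_right e k))) x

/-- Over a `p`-group, the homology of the fixed points of `S^v` is generated by the monomials. -/
theorem exists_Phi_of_cycle {p c e : ℕ} (hp : p.Prime) (hne : n = e * p ^ c) (v : Dv n → ℕ)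
    {z : Cells v →₀ ℤ} (hz : z ∈ inv e v) (hbd : bd v z = 0) : ∃ q, z - Phi v q ∈ bnd e v := by
  induction v using sorted_factor_induction (fun d => padicValNat p d.1) with
  | h0 =>
    obtain ⟨a, y, rfl⟩ := exists_eq_smul_theta_top _ z hbd
    refine ⟨MvPolynomial.monomial (topMon 0) a, ?_⟩
    have h0 : bd (0 : Dv n → ℕ) y = 0 := by
      have : IsEmpty (Factors (0 : Dv n → ℕ)) := ⟨fun i => i.2.elim0⟩
      simp [bd]
    rw [Phi_monomial, phiMon_topMon, h0, add_zero, sub_self]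
    exact zero_mem _
  | h w d hd ih =>
    obtain ⟨c, C, x, hx, b, hb, h1, h2⟩ := chain_decomposition (ξ := 0) (exists_eq_smul_theta_top w)
      (stabilizer_trivial hp hne hd) hz (by rw [hbd, mulTot_zero_left])
    -- With ξ = 0 the obstruction C vanishes, and the S^w-component x is a cycle to which the
    -- induction applies; multiplication by the point is multiplication by a_d.
    obtain rfl := eq_zero_of_smul_theta_top_eq x (div_gcd_ne_zero d e) h1
    rw [zero_mul, zero_smul, add_zero] at h1
    obtain ⟨q, hq⟩ := ih hx h1.symm
    refine ⟨q * polyA d + MvPolynomial.monomial (topMon (w + Pi.single d 1)) c, ?_⟩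
    rw [h2 rfl, map_add, Phi_monomial, phiMon_topMon]
    have h3 := mulTot_mem_bnd_left hq (inv_of_inv_one (e := e)
      (cellOf_pt_eq_theta d ▸ theta_mem_inv _)) (bd_cellOf_pt d)
    rw [mulTot_sub_left] at h3
    have h4 := add_mem (add_mem h3 (bnd_mono (one_dvd e) (mulTot_Phi_pt (w := w) q d))) hb
    convert h4 using 1
    abel

end surjectivity

/-! ### Bounding polynomials are relations for p-groups, up to factors prime to p -/

section injectivity
variable {n : ℕ} [NeZero n] {v w : Dv n → ℕ}

/-- The base point of Θ_a is sent to the sum over the ⟨t^a⟩-orbit of the base point of Θ_b. This is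
a restriction if b divides a and a transfer if a divides b. -/
lemma exists_deg_eq (a b : BZ n) : ∃ f : a ⟶ b, deg f = ((b.1 / Nat.gcd b.1 a.1 : ℕ) : ℤ) := by
  obtain ⟨F, hF⟩ := exists_orb_hom (BZ.dvd a)
    (Finsupp.equivFunOnFinite.symm (mark n b.1 a.1) : Orb n b.1 →₀ ℤ) (by
      ext o
      rw [permRep_apply]
      have := mark_smul (BZ.dvd b) a.1 ((t n ^ a.1)⁻¹ • o)
      rw [smul_inv_smul] at this
      exact this.symm)
  refine ⟨⟨F⟩, ?_⟩
  have h0 := hF 0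
  rw [orbPt, pow_zero, map_one, Module.End.one_apply] at h0
  rw [← sum_mark (BZ.dvd b)]
  refine (congrArg (fun z : Orb n b.1 →₀ ℤ => z.sum fun _ c => c) h0).trans ?_
  rw [Finsupp.sum_fintype _ _ fun _ => rfl]
  rfl

lemma euler_mem_J (d : Dv n) (e : BZ n) : ((d.1 / Nat.gcd d.1 e.1 : ℕ) : ℤ) • polyA d ∈ J e := by
  obtain ⟨f, hf⟩ := exists_deg_eq e d.toDivisor
  have := MemJ.pull f (MemJ.euler d)
  rw [hf] at this
  exact this

lemma gold_mem_J (d d' : Dv n) (e : BZ n) :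
    ((d.1 / Nat.gcd d.1 d'.1 : ℕ) : ℤ) • (polyA d * polyU d') -
        ((d'.1 / Nat.gcd d.1 d'.1 : ℕ) : ℤ) • (polyA d' * polyU d) ∈ J e := by
  obtain ⟨f, hf⟩ := exists_deg_eq e (onePoint n)
  have := MemJ.pull f (MemJ.gold d d')
  rw [hf, show (onePoint n).1 / Nat.gcd (onePoint n).1 e.1 = 1 by simp [onePoint], Nat.cast_one,
    one_smul] at this
  exact this

/-- Reduction of polynomials, using the gold relations, to multiples of one `a_d` and a power of the
`u_d`. -/
lemma exists_reduction {p : ℕ} (hp : p.Prime) (e : BZ n) {d : Dv n}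
    (hd : ∀ d', w d' ≠ 0 → padicValNat p d'.1 ≤ padicValNat p d.1) {q : Poly n}
    (hq : q ∈ wtSpan (w + Pi.single d 1)) : ∃ (N : ℕ) (q' : Poly n) (c : ℤ), Nat.Coprime N p ∧
      q' ∈ wtSpan w ∧
      (N : ℤ) • q - (q' * polyA d + c • MvPolynomial.monomial (topMon (w + Pi.single d 1)) (1 : ℤ)) ∈ J e := by
  induction hq using Submodule.span_induction with
  | zero => exact ⟨1, 0, 0, Nat.coprime_one_left p, zero_mem _, by simp⟩
  | add q₁ q₂ _ _ h₁ h₂ =>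
    obtain ⟨N₁, q₁', c₁, hN₁, hq₁, hJ₁⟩ := h₁
    obtain ⟨N₂, q₂', c₂, hN₂, hq₂, hJ₂⟩ := h₂
    refine ⟨N₁ * N₂, (N₂ : ℤ) • q₁' + (N₁ : ℤ) • q₂', N₂ * c₁ + N₁ * c₂, hN₁.mul_left hN₂,
      add_mem (Submodule.smul_mem _ _ hq₁) (Submodule.smul_mem _ _ hq₂), ?_⟩
    have := add_mem (zsmul_mem hJ₁ N₂) (zsmul_mem hJ₂ N₁)
    convert this using 1
    simp only [zsmul_eq_mul]
    push_cast
    ring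
  | smul a q _ h =>
    obtain ⟨N, q', c, hN, hq, hJ⟩ := h
    refine ⟨N, a • q', a * c, hN, Submodule.smul_mem _ _ hq, ?_⟩
    have := zsmul_mem hJ a
    convert this using 1
    simp only [zsmul_eq_mul]
    push_cast
    ring
  | mem q h =>
    obtain ⟨s, hs, rfl⟩ := h
    by_cases h1 : 1 ≤ s (.inl d)
    · have hle : Finsupp.single (.inl d) 1 ≤ s := by simpa using h1
      obtain ⟨s₀, rfl⟩ := exists_add_of_le hle
      refine ⟨1, MvPolynomial.monomial s₀ 1, 0, Nat.coprime_one_left p, monomial_mem_wtSpan ?_, ?_⟩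
      · change _ = _ at hs
        rw [expA_add, expU_add, expA_inl, expU_inl, zero_add, add_comm (Pi.single d 1), add_right_comm] at hs
        exact add_right_cancel hs
      · beta_reduce
        have e1 : MvPolynomial.monomial s₀ (1 : ℤ) * polyA d =
            MvPolynomial.monomial (Finsupp.single (.inl d) 1 + s₀) 1 := by
          rw [polyA, MvPolynomial.X, MvPolynomial.monomial_mul, one_mul, add_comm]
        rw [e1]
        simp
    · by_cases h2 : expA s = 0
      · refine ⟨1, 0, 1, Nat.coprime_one_left p, zero_mem _, ?_⟩
        have : s = topMon (w + Pi.single d 1) := by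
          change _ = _ at hs
          rw [h2, zero_add] at hs
          ext i
          rcases i with i | i
          · exact congrFun h2 i
          · exact congrFun hs i
        rw [← this]
        simp
      · obtain ⟨d', hd'⟩ : ∃ d', s (.inl d') ≠ 0 := by
          by_contra! h
          exact h2 (funext h)
        have hs' : ∀ x, s (.inl x) + s (.inr x) = w x + (Pi.single d 1 : Dv n → ℕ) x :=
          fun x => congrFun hs x
        -- As a_d does not occur but d has positive total exponent, u_d divides the monomial. The
        -- gold relation then replaces a_{d'}·u_d by a_d·u_{d'}, at the cost of the factor
        -- d'/(d',d), which is prime to p by the maximality of d.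
        have hne : d' ≠ d := by
          rintro rfl
          omega
        have hw : w d' ≠ 0 := by
          have := hs' d'
          rw [Pi.single_eq_of_ne hne] at this
          omega
        have hud : 1 ≤ s (.inr d) := by
          have := hs' d
          rw [Pi.single_eq_same] at this
          omega
        obtain ⟨s₀, rfl⟩ : ∃ s₀, s = Finsupp.single (.inl d') 1 + Finsupp.single (.inr d) 1 + s₀ := by
          refine exists_add_of_le fun i => ?_
          classical
          rw [Finsupp.add_apply, Finsupp.single_apply, Finsupp.single_apply]
          rcases i with i | i
          · by_cases h : d' = i
            · subst h; simp; omega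
            · simp [h]
          · by_cases h : d = i
            · subst h; simpa using hud
            · simp [h]
        refine ⟨d'.1 / Nat.gcd d'.1 d.1,
          ((d.1 / Nat.gcd d'.1 d.1 : ℕ) : ℤ) • MvPolynomial.monomial (Finsupp.single (.inr d') 1 + s₀) 1, 0,
          coprime_div_gcd_of_padicValNat_le hp (ne_zero_of_dvd_ne_zero (NeZero.ne n) (Dv.dvd d')) (hd d' hw),
          Submodule.smul_mem _ _ (monomial_mem_wtSpan ?_), ?_⟩
        · change _ = _ at hs
          simp only [expA_add, expU_add, expA_inl, expU_inl, expA_inr, expU_inr] at hs ⊢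
          refine add_right_cancel (b := Pi.single d 1) (Eq.trans ?_ hs)
          abel
        · have := (J e).mul_mem_left (MvPolynomial.monomial s₀ 1) (gold_mem_J d' d e)
          convert this using 1
          have e1 : MvPolynomial.monomial (Finsupp.single (.inl d') 1 + Finsupp.single (.inr d) 1 + s₀)
              (1 : ℤ) = polyA d' * polyU d * MvPolynomial.monomial s₀ 1 := by
            rw [polyA_mul_polyU, MvPolynomial.monomial_mul, one_mul]
          have e2 : MvPolynomial.monomial (Finsupp.single (.inr d') 1 + s₀) (1 : ℤ) =
              polyU d' * MvPolynomial.monomial s₀ 1 := by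
            rw [polyU, MvPolynomial.X, MvPolynomial.monomial_mul, one_mul]
          beta_reduce
          rw [e1, e2, zero_smul, add_zero]
          simp only [zsmul_eq_mul]
          ring

/-- Over a `p`-group, up to factors prime to `p`, polynomials that vanish in homology are consequences of
the relations. -/
theorem exists_smul_mem_J {p c : ℕ} (hp : p.Prime) {e : BZ n} (hne : n = e.1 * p ^ c)
    (v : Dv n → ℕ) {q : Poly n} (hq : q ∈ wtSpan v) (hbd : Phi v q ∈ bnd e.1 v) :
    ∃ N : ℕ, Nat.Coprime N p ∧ (N : ℤ) • q ∈ J e := by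
  induction v using sorted_factor_induction (fun d => padicValNat p d.1) generalizing q with
  | h0 =>
    have h : ∃ a : ℤ, q = a • MvPolynomial.monomial (topMon 0) 1 := by
      rw [wtSpan, show {s : (Dv n ⊕ Dv n) →₀ ℕ | expA s + expU s = 0} = {topMon 0} by
        ext s
        constructor
        · intro hs
          have hs' : ∀ d, s (.inl d) + s (.inr d) = 0 := fun d => congrFun hs d
          ext (i | i)
          · exact (Nat.add_eq_zero_iff.1 (hs' i)).1
          · exact (Nat.add_eq_zero_iff.1 (hs' i)).2
        · rintro rfl
          rfl, Set.image_singleton, Submodule.mem_span_singleton] at hq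
      exact hq.imp fun _ h => h.symm
    obtain ⟨a, rfl⟩ := h
    obtain ⟨y, -, hy⟩ := hbd
    rw [map_smul, Phi_monomial, one_smul, phiMon_topMon] at hy
    have := eq_zero_of_smul_theta_top_eq (a := -a) (b := 1) y one_ne_zero (by
      rw [hy]; module)
    rw [neg_eq_zero.1 this, zero_smul]
    exact ⟨1, Nat.coprime_one_left p, by rw [smul_zero]; exact zero_mem _⟩
  | h w d hd ih =>
    -- Modulo relations, N·q is q'·a_d plus a multiple of the top monomial. Relations bound by
    -- `Phi_mem_bnd`, so this expression bounds too.
    obtain ⟨N, q', a, hN, hq', hJ⟩ := exists_reduction hp e hd hq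
    have h1 := Submodule.smul_mem _ (N : ℤ) hbd
    have h2 := sub_mem h1 (Phi_mem_bnd hJ (w + Pi.single d 1))
    rw [map_sub, map_add, map_smul, map_smul, Phi_monomial, one_smul, phiMon_topMon, sub_sub_cancel]
      at h2
    have h3 := add_mem h2 (bnd_mono (one_dvd e.1) (mulTot_Phi_pt (w := w) q' d))
    obtain ⟨z, hz, hbz⟩ := h3
    have hbz' : bd _ z = mulTot _ _ (Phi w q') (cellOf d .pt) +
        a • theta (w + Pi.single d 1) fun _ => true := by
      rw [hbz]; abel
    obtain ⟨x, hx⟩ := exists_top_cell w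
    -- At a top cell neither boundaries nor multiples of the point contribute, so only the top class
    -- is seen.
    have ha : a = 0 := by
      have h4 := congr($hbz' (merge x (cellFun d (.sec (orbPt n d 0)))))
      have htop : ∀ i, (merge x (cellFun d (.sec (orbPt n d 0))) i).dim = 2 := by
        refine forall_factors.2 ⟨fun i => ?_, fun j => ?_⟩
        · rw [merge_inl, hx]
        · rw [merge_inr]
          obtain rfl := Subsingleton.elim default j
          rfl
      rw [Finsupp.add_apply, bd_apply_eq_zero _ htop, Finsupp.smul_apply, theta_top_apply htop,
        mulTot_cellOf_apply_of_ne _ (by simp)] at h4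
      simpa using h4.symm
    subst ha
    rw [zero_smul, add_zero] at hbz' hJ
    obtain ⟨_, C, y, hy, _, -, h5, -⟩ := chain_decomposition (exists_eq_smul_theta_top w)
      (stabilizer_trivial hp hne hd) hz hbz'
    -- By `h5` the cycle of q' is C·m times the top class up to a boundary. Subtracting C·m times
    -- the top monomial makes the induction applicable, and the subtracted term returns multiplied
    -- by a_d, where m·a_d is a relation.
    set m : ℤ := ((d.1 / Nat.gcd d.1 e.1 : ℕ) : ℤ) with hm
    obtain ⟨M, hM, hMJ⟩ := ih (q := q' - (C * m) • MvPolynomial.monomial (topMon w) 1)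
      (sub_mem hq' (Submodule.smul_mem _ _ (monomial_mem_wtSpan (zero_add _)))) ⟨y, hy, by
        rw [map_sub, map_smul, Phi_monomial, one_smul, phiMon_topMon, h5]; abel⟩
    refine ⟨M * N, hM.mul_left hN, ?_⟩
    have h6 := (J e).mul_mem_left ((M : Poly n) * (C : Poly n) * MvPolynomial.monomial (topMon w) 1)
      (euler_mem_J d e)
    rw [← hm] at h6
    have h7 := add_mem (add_mem ((J e).mul_mem_left (polyA d) hMJ) (zsmul_mem hJ M)) h6
    convert h7 using 1
    simp only [zsmul_eq_mul]
    push_cast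
    ring

end injectivity

/-! ### From p-groups to all subgroups by transfer -/

section local_global
variable {n : ℕ} [NeZero n] {v : Dv n → ℕ}

/-- The integers that multiply z into S form an ideal contained in no (p), hence the unit ideal. -/
lemma mem_of_forall_prime {M : Type*} [AddCommGroup M] (S : Submodule ℤ M) (z : M)
    (h : ∀ p : ℕ, p.Prime → ∃ N : ℕ, Nat.Coprime N p ∧ (N : ℤ) • z ∈ S) : z ∈ S := by
  let I : Ideal ℤ := S.comap (LinearMap.toSpanSingleton ℤ M z)
  obtain ⟨g, hg⟩ := (IsPrincipalIdealRing.principal I).principal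
  have hI : ∀ a : ℤ, a • z ∈ S ↔ g ∣ a := by
    intro a
    rw [← Ideal.mem_span_singleton, ← Ideal.submodule_span_eq, ← hg]
    rfl
  have hg1 : g.natAbs = 1 := by
    by_contra hne
    obtain ⟨p, hp, hpg⟩ := Nat.exists_prime_and_dvd hne
    obtain ⟨N, hN, hNz⟩ := h p hp
    have : p ∣ N := hpg.trans (Int.natCast_dvd_natCast.1 (by
      rw [Int.natCast_natAbs, abs_dvd]; exact (hI N).1 hNz))
    exact hp.one_lt.ne' (Nat.eq_one_of_dvd_coprimes hN this dvd_rfl)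
  have := (hI 1).2 (Int.natAbs_dvd_natAbs.1 (by rw [hg1]; exact one_dvd _))
  rwa [one_smul] at this

/-- So t^{eM} generates the Sylow p-subgroup of ⟨t^e⟩, and M is its index. -/
lemma exists_prime_power_quotient {p e : ℕ} (hp : p.Prime) (he : e ∣ n) :
    ∃ M c, n = e * M * p ^ c ∧ Nat.Coprime M p := by
  obtain ⟨k, hk⟩ := he
  have hk0 : k ≠ 0 := by
    rintro rfl
    exact NeZero.ne n hk
  obtain ⟨c, M, hM, rfl⟩ := Nat.exists_eq_pow_mul_and_not_dvd hk0 p hp.ne_one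
  exact ⟨M, c, by rw [hk]; ring, ((Nat.Prime.coprime_iff_not_dvd hp).2 hM).symm⟩

/-- The transfer of fixed points. -/
lemma sum_permRep_mem_inv {e M : ℕ} {y : Cells v →₀ ℤ} (hy : y ∈ inv (e * M) v) :
    ∑ i ∈ Finset.range M, permRep n _ (t n ^ (e * i)) y ∈ inv e v := by
  rw [mem_inv, map_sum, ← sum_range_succ_eq fun i => permRep n (Cells v) (t n ^ (e * i)) y]
  · refine Finset.sum_congr rfl fun i _ => ?_
    rw [← Module.End.mul_apply, ← map_mul, ← pow_add, mul_add, mul_one, add_comm]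
  · rw [mem_inv.1 hy]
    simp

/-- The transfer of a bounding chain has boundary the transfer of x, which is M·x because x is
already fixed by t^e. -/
lemma smul_mem_bnd_of_mul {e M : ℕ} {x : Cells v →₀ ℤ} (hx : x ∈ inv e v)
    (h : x ∈ bnd (e * M) v) : (M : ℤ) • x ∈ bnd e v := by
  obtain ⟨y, hy, rfl⟩ := h
  refine ⟨_, sum_permRep_mem_inv hy, ?_⟩
  rw [map_sum, Finset.sum_congr rfl fun i _ => by
    rw [bd_permRep, mem_inv.1 (inv_mono (dvd_mul_right e i) hx)], Finset.sum_const,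
    Finset.card_range, natCast_zsmul]

/-- The homology of the fixed points of `S^v` is generated by the monomials. -/
theorem exists_Phi_sub_mem_bnd {e : ℕ} (he : e ∣ n) {z : Cells v →₀ ℤ} (hz : z ∈ inv e v)
    (hbd : bd v z = 0) : ∃ q, z - Phi v q ∈ bnd e v := by
  have key : z ∈ bnd e v ⊔ LinearMap.range (Phi v) := by
    refine mem_of_forall_prime _ z fun p hp => ?_
    obtain ⟨M, c, hn, hM⟩ := exists_prime_power_quotient hp he
    obtain ⟨q, hq⟩ := exists_Phi_of_cycle hp hn v (inv_mono (dvd_mul_right e M) hz) hbd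
    refine ⟨M, hM, ?_⟩
    have h1 := smul_mem_bnd_of_mul (sub_mem hz (inv_of_inv_one (Phi_mem_inv q))) hq
    exact Submodule.mem_sup.2 ⟨_, h1, _, ⟨(M : ℤ) • q, rfl⟩, by rw [map_smul]; module⟩
  obtain ⟨b, hb, _, ⟨q, rfl⟩, h⟩ := Submodule.mem_sup.1 key
  exact ⟨q, by rwa [← h, add_sub_cancel_right]⟩

/-- Polynomials that vanish in homology are consequences of the relations. -/
theorem mem_J_of_Phi_mem_bnd {e : BZ n} {q : Poly n} (hq : q ∈ wtSpan v)
    (hbd : Phi v q ∈ bnd e.1 v) : q ∈ J e := by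
  refine mem_of_forall_prime ((J e).restrictScalars ℤ) q fun p hp => ?_
  obtain ⟨M, c, hn, hM⟩ := exists_prime_power_quotient hp (BZ.dvd e)
  -- The boundary is restricted to Θ_{eM}, where the p-group case applies, and the resulting
  -- relation is transferred back, which multiplies it by M.
  let e' : BZ n := (⟨e.1 * M, Nat.mem_divisors.2 ⟨⟨p ^ c, hn⟩, NeZero.ne n⟩⟩ : n.divisors)
  obtain ⟨N, hN, hNq⟩ := exists_smul_mem_J hp (e := e') hn v hq (bnd_mono (dvd_mul_right e.1 M) hbd)
  obtain ⟨f, hf⟩ := exists_deg_eq e e'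
  have h1 : e'.1 / Nat.gcd e'.1 e.1 = M := by
    change e.1 * M / Nat.gcd (e.1 * M) e.1 = M
    rw [Nat.gcd_mul_right_left, Nat.mul_div_cancel_left _ (Nat.pos_of_mem_divisors e.2)]
  refine ⟨M * N, hM.mul_left hN, ?_⟩
  have h2 := MemJ.pull f hNq
  rw [hf, h1, smul_smul] at h2
  rw [Nat.cast_mul]
  exact h2

end local_global

/-! ### Homogeneous components -/

section degrees
variable {n : ℕ} {v : Dv n → ℕ}

lemma proj_single (m : ℤ) (x : Cells v) (h : -(x.dim : ℤ) = m) (a : ℤ) :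
    proj v m (Finsupp.single x a) = Finsupp.single ⟨x, h⟩ a := by
  rw [← proj_incl m (Finsupp.single ⟨x, h⟩ a), incl_single]

lemma diff_proj (m : ℤ) (x : Cells v →₀ ℤ) :
    (diff v m (m + 1)).hom (proj v m x) = proj v (m + 1) (bd v x) := by
  rw [diff_apply]
  induction x using Finsupp.induction_linear with
  | zero => simp
  | add f g hf hg => simp only [map_add, hf, hg]
  | single x a =>
    by_cases h : -(x.dim : ℤ) = m
    · rw [proj_single m x h, incl_single]
    · rw [proj_eq_zero (m := m), map_zero, map_zero, map_zero]
      · symm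
        refine proj_eq_zero fun y hy hy' => h ?_
        have := bd_support (m := -(x.dim : ℤ)) (fun z hz => by
          rw [Finset.mem_singleton.1 (Finsupp.support_single_subset hz)]) hy
        omega
      · intro y hy
        rwa [Finset.mem_singleton.1 (Finsupp.support_single_subset hy)]

/-- The component of degree `m`. -/
noncomputable def comp (m : ℤ) : (Cells v →₀ ℤ) →ₗ[ℤ] (Cells v →₀ ℤ) := incl v m ∘ₗ proj v m

lemma comp_apply (m : ℤ) (x : Cells v →₀ ℤ) : comp m x = incl v m (proj v m x) := rfl

lemma comp_incl (m : ℤ) (x : CellsDeg v m →₀ ℤ) : comp m (incl v m x) = incl v m x := by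
  rw [comp_apply, proj_incl]

lemma bd_comp (m : ℤ) (x : Cells v →₀ ℤ) : bd v (comp m x) = comp (m + 1) (bd v x) := by
  rw [comp_apply, comp_apply, ← diff_proj, incl_diff]

lemma comp_mem_inv {e : ℕ} {x : Cells v →₀ ℤ} (m : ℤ) (hx : x ∈ inv e v) : comp m x ∈ inv e v := by
  rw [mem_inv] at *
  rw [comp_apply, ← incl_permRep, ← proj_permRep, hx]

/-- This lets the earlier arguments run on total complexes, with the degree selected at the end. -/
lemma comp_mem_bnd {e : ℕ} {x : Cells v →₀ ℤ} (m : ℤ) (hx : x ∈ bnd e v) : comp m x ∈ bnd e v := by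
  obtain ⟨y, hy, rfl⟩ := hx
  refine ⟨_, comp_mem_inv (m - 1) hy, ?_⟩
  rw [bd_comp, sub_add_cancel]

lemma weight_wt_snd (s : (Dv n ⊕ Dv n) →₀ ℕ) : (Finsupp.weight wt s).2 = expA s + expU s := by
  induction s using Finsupp.induction_linear with
  | zero => rw [map_zero]; rfl
  | add f g hf hg => rw [map_add, Prod.snd_add, hf, hg, expA_add, expU_add]; abel
  | single i k =>
    rw [Finsupp.weight_single]
    funext d
    classical
    rcases i with i | i <;>
      simp [wt, expA, expU, Finsupp.single_apply, Pi.single_apply, eq_comm]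

lemma weight_wt_fst (s : (Dv n ⊕ Dv n) →₀ ℕ) :
    (Finsupp.weight wt s).1 = -2 * ((∑ d, expU s d : ℕ) : ℤ) := by
  induction s using Finsupp.induction_linear with
  | zero => rw [map_zero]; simp [expU]
  | add f g hf hg =>
    rw [map_add, Prod.fst_add, hf, hg, expU_add]
    simp only [Pi.add_apply, Finset.sum_add_distrib]
    push_cast
    ring
  | single i k =>
    rw [Finsupp.weight_single]
    classical
    rcases i with i | i <;> simp [wt, expU, Finsupp.single_apply, mul_comm]

variable [NeZero n]

lemma dim_of_theta_ne_zero {S : Factors v → Bool} {x : Cells v} (h : theta v S x ≠ 0) :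
    x.dim = 2 * ∑ d, cnt S d := by
  rw [theta_apply] at h
  have hx : ∀ i, (x i).dim = if S i then 2 else 0 := by
    by_contra hx
    exact h (if_neg hx)
  unfold Cells.dim cnt
  simp only [hx]
  rw [Fintype.sum_sigma, Finset.mul_sum]
  refine Finset.sum_congr rfl fun d _ => ?_
  rw [Finset.mul_sum]
  refine Finset.sum_congr rfl fun j _ => ?_
  split_ifs <;> rfl

lemma dim_of_phiMon_ne_zero {s : (Dv n ⊕ Dv n) →₀ ℕ} {x : Cells v} (h : phiMon v s x ≠ 0) :
    Finsupp.weight wt s = (-(x.dim : ℤ), v) := by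
  rw [phiMon] at h
  split_ifs at h with hs
  · refine Prod.ext ?_ ((weight_wt_snd s).trans hs)
    rw [weight_wt_fst, dim_of_theta_ne_zero h, cnt_stdS (hs ▸ le_add_self)]
    push_cast
    ring
  · exact absurd rfl h

lemma comp_phiMon {m : ℤ} {s : (Dv n ⊕ Dv n) →₀ ℕ} (hs : Finsupp.weight wt s = (m, v)) :
    comp m (phiMon v s) = phiMon v s :=
  incl_proj fun x hx => by
    have := (dim_of_phiMon_ne_zero (Finsupp.mem_support_iff.1 hx)).symm.trans hs
    exact congrArg Prod.fst this

lemma comp_phiMon_of_ne {m : ℤ} {s : (Dv n ⊕ Dv n) →₀ ℕ} (hs : Finsupp.weight wt s ≠ (m, v)) :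
    comp m (phiMon v s) = 0 := by
  rw [comp_apply, proj_eq_zero, map_zero]
  rintro x hx rfl
  exact hs (dim_of_phiMon_ne_zero (Finsupp.mem_support_iff.1 hx))

lemma comp_Phi (m : ℤ) (q : Poly n) :
    comp m (Phi v q) = Phi v (MvPolynomial.weightedHomogeneousComponent wt (m, v) q) := by
  induction q using MvPolynomial.induction_on' with
  | monomial s c =>
    have h := MvPolynomial.isWeightedHomogeneous_monomial (σ := Dv n ⊕ Dv n) wt s c rfl
    by_cases hs : Finsupp.weight wt s = (m, v)
    · rw [hs] at h
      rw [h.weightedHomogeneousComponent_same, Phi_monomial,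
        map_smul, comp_phiMon hs]
    · rw [h.weightedHomogeneousComponent_ne _ (Ne.symm hs),
        Phi_monomial, map_smul, comp_phiMon_of_ne hs, smul_zero, map_zero]
  | add p q hp hq => simp only [map_add, hp, hq]

lemma comp_Phi_of_homogeneous {α : Deg n} {p : Poly n}
    (hp : p ∈ MvPolynomial.weightedHomogeneousSubmodule ℤ wt α) :
    comp α.1 (Phi α.2 p) = Phi α.2 p := by
  rw [comp_Phi, MvPolynomial.IsWeightedHomogeneous.weightedHomogeneousComponent_same]
  exact hp

lemma mem_wtSpan_of_homogeneous {α : Deg n} {p : Poly n}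
    (hp : p ∈ MvPolynomial.weightedHomogeneousSubmodule ℤ wt α) : p ∈ wtSpan α.2 := by
  rw [p.as_sum]
  refine sum_mem fun s hs => ?_
  rw [show MvPolynomial.monomial s (p.coeff s) = p.coeff s • MvPolynomial.monomial s (1 : ℤ) by
    rw [MvPolynomial.smul_monomial, smul_eq_mul, mul_one]]
  refine Submodule.smul_mem _ _ (monomial_mem_wtSpan ?_)
  rw [← weight_wt_snd, show Finsupp.weight wt s = α from hp (MvPolynomial.mem_support_iff.1 hs)]

lemma mulTot_Phi_Phi {w : Dv n → ℕ} {p : Poly n} (hp : p ∈ wtSpan v) (q : Poly n) :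
    mulTot v w (Phi v p) (Phi w q) - Phi (v + w) (p * q) ∈ bnd 1 (v + w) := by
  induction hp using Submodule.span_induction with
  | mem p h =>
    obtain ⟨s, hs, rfl⟩ := h
    beta_reduce
    rw [Phi_monomial, one_smul]
    exact mulTot_Phi s hs q
  | zero => rw [map_zero, mulTot_zero_left, zero_mul, map_zero, sub_zero]; exact zero_mem _
  | add p p' _ _ h h' =>
    rw [map_add, mulTot_add_left, add_mul, map_add, add_sub_add_comm]
    exact add_mem h h'
  | smul a p _ h =>
    rw [map_smul, map_smul, LinearMap.smul_apply, smul_mul_assoc, map_smul, ← smul_sub]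
    exact Submodule.smul_mem _ _ h

end degrees

/-! ### Derived classes as homology of fixed points -/

section evaluation
variable {n : ℕ} {v : Dv n → ℕ}

/-- The value of a cochain on `Θ_e` at the base point. -/
noncomputable def value {e : n.divisors} {m : ℤ} (z : perm n (Orb n e) ⟶ perm n (CellsDeg v m)) :
    Cells v →₀ ℤ := incl v m (z.hom (Finsupp.single (orbPt n e 0) 1))

lemma value_sub {α : Deg n} {e : n.divisors} (z z' : Cocycles α e) :
    value (z - z').1 = value z.1 - value z'.1 := by
  rw [value, value, value, ← map_sub]
  rfl

lemma bd_value {α : Deg n} {e : n.divisors} (z : Cocycles α e) : bd α.2 (value z.1) = 0 := by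
  rw [value, ← incl_diff]
  have h : (z.1 ≫ diff α.2 α.1 (α.1 + 1)).hom (Finsupp.single (orbPt n e 0) 1) = 0 := by
    rw [show z.1 ≫ diff α.2 α.1 (α.1 + 1) = 0 from z.2]; rfl
  exact (congrArg (incl _ _) h).trans (map_zero _)

variable [NeZero n]

lemma value_mem_inv {e : n.divisors} {m : ℤ} (z : perm n (Orb n e) ⟶ perm n (CellsDeg v m)) :
    value z ∈ inv e v := by
  rw [mem_inv, value, ← incl_permRep, ← perm_hom_smul, t_pow_smul_of_dvd dvd_rfl]

lemma perm_orb_hom_ext {e : ℕ} {Y : Type} [MulAction (Cyc n) Y] {f g : perm n (Orb n e) ⟶ perm n Y}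
    (h : f.hom (Finsupp.single (orbPt n e 0) 1) = g.hom (Finsupp.single (orbPt n e 0) 1)) : f = g := by
  refine perm_hom_ext fun s => ?_
  obtain ⟨i, rfl⟩ := orbPt_surjective s
  rw [← add_zero i, ← smul_orbPt, perm_hom_smul, perm_hom_smul, h]

/-- A cocycle represents zero if and only if its value is a boundary. -/
lemma cls_eq_zero_iff_mem_bnd {α : Deg n} {e : n.divisors} (z : Cocycles α e) :
    cls z = 0 ↔ value z.1 ∈ bnd e α.2 := by
  obtain ⟨k, v⟩ := α
  obtain ⟨m, rfl⟩ : ∃ m, k = m + 1 := ⟨k - 1, by ring⟩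
  rw [cls_eq_zero_iff (m := m) rfl]
  constructor
  · rintro ⟨y, hy⟩
    refine ⟨_, value_mem_inv y, ?_⟩
    rw [hy, value, ← incl_diff]
    rfl
  · rintro ⟨y, hy, hyz⟩
    obtain ⟨F, hF⟩ := exists_orb_hom (BZ.dvd e) (proj v m y) (by
      rw [← proj_permRep, mem_inv.1 hy])
    refine ⟨F, perm_orb_hom_ext ?_⟩
    refine Eq.trans ?_ (congrArg (diff v m (m + 1)).hom (hF 0)).symm
    rw [pow_zero, map_one, Module.End.one_apply, diff_proj, hyz, value, proj_incl]

end evaluation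

section
variable {C : Type 1} [Category.{0} C] [Abelian C]

lemma single_map_comp_mkHomFromSingle {P P' : C} {K : CochainComplex C ℤ} {m : ℤ} (g : P' ⟶ P)
    (f : P ⟶ K.X m) (h : ∀ j, (ComplexShape.up ℤ).Rel m j → f ≫ K.d m j = 0) (f' : P' ⟶ K.X m)
    (h' : ∀ j, (ComplexShape.up ℤ).Rel m j → f' ≫ K.d m j = 0) (hf : g ≫ f = f') :
    (HomologicalComplex.single C (ComplexShape.up ℤ) m).map g ≫
      HomologicalComplex.mkHomFromSingle f h = HomologicalComplex.mkHomFromSingle f' h' := by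
  subst hf
  exact HomologicalComplex.from_single_hom_ext (by
    simp [HomologicalComplex.single_map_f_self])

end

/-! ### The comparison map and its bijectivity -/

section comparison
variable {n : ℕ} [NeZero n]

lemma proj_Phi_eq_permRep (m : ℤ) (v : Dv n → ℕ) (p : Poly n) (g : Cyc n) :
    proj v m (Phi v p) = permRep n _ g (proj v m (Phi v p)) := by
  rw [← proj_permRep, permRep_eq_of_inv_one (Phi_mem_inv p)]

/-- The cocycle on `Θ_e` given by a polynomial. -/
noncomputable def polyCocycle (α : Deg n) (e : n.divisors) (p : Poly n) : Cocycles α e :=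
  ⟨permLift (fun _ => proj α.2 α.1 (Phi α.2 p)) fun g _ => proj_Phi_eq_permRep _ _ p g,
    perm_hom_ext fun s => by
      refine (congrArg (diff α.2 α.1 (α.1 + 1)).hom (permLift_single _ _ s)).trans ?_
      rw [diff_proj, bd_Phi, map_zero]
      rfl⟩

lemma polyCocycle_single (α : Deg n) (e : n.divisors) (p : Poly n) (s : Orb n e) :
    (polyCocycle α e p).1.hom (Finsupp.single s 1) = proj α.2 α.1 (Phi α.2 p) :=
  permLift_single _ (fun g _ => proj_Phi_eq_permRep _ _ p g) s

lemma value_polyCocycle (α : Deg n) (e : n.divisors) (p : Poly n) :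
    value (polyCocycle α e p).1 = comp α.1 (Phi α.2 p) := by
  rw [value, polyCocycle_single, comp_apply]

lemma polyCocycle_sub (α : Deg n) (e : n.divisors) (p q : Poly n) :
    polyCocycle α e (p - q) = polyCocycle α e p - polyCocycle α e q := by
  refine Subtype.ext (perm_hom_ext fun s => ?_)
  refine (polyCocycle_single α e _ s).trans ?_
  rw [map_sub, map_sub]
  exact (congrArg₂ (· - ·) (polyCocycle_single α e p s) (polyCocycle_single α e q s)).symm

/-- The class on `Θ_e` given by a polynomial. -/
noncomputable def polyClass (α : Deg n) (e : n.divisors) : Poly n →+ H α e :=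
  AddMonoidHom.ofMapSub (fun p => cls (polyCocycle α e p)) fun p q => by
    rw [polyCocycle_sub, cls_sub]

lemma polyClass_apply (α : Deg n) (e : n.divisors) (p : Poly n) :
    polyClass α e p = cls (polyCocycle α e p) := rfl

lemma polyClass_eq_zero_of_mem {α : Deg n} {e : BZ n} {p : Poly n} (hp : p ∈ J e) :
    polyClass α e p = 0 := by
  rw [polyClass_apply, cls_eq_zero_iff_mem_bnd, value_polyCocycle]
  exact comp_mem_bnd _ (Phi_mem_bnd hp _)

/-- The comparison map. -/
noncomputable def comparison (α : Deg n) (e : n.divisors) : QDeg α e →+ H α e :=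
  (QuotientAddGroup.lift (J (e : BZ n)).toAddSubgroup (polyClass α e) fun _ hp =>
    polyClass_eq_zero_of_mem hp).comp (QDeg α (e : BZ n)).subtype

lemma Hpull_cls (α : Deg n) {a b : BZ n} (f : a ⟶ b) (z : Cocycles α b) :
    Hpull α f (cls z) = cls ⟨f.hom ≫ z.1, by
      change (f.hom ≫ z.1) ≫ _ = 0
      rw [Category.assoc, show z.1 ≫ _ = 0 from z.2, Limits.comp_zero]⟩ := by
  refine (Functor.map_comp (DerivedCategory.Q (C := ZModule n)) _ _).symm.trans ?_
  exact congrArg _ (single_map_comp_mkHomFromSingle _ _ _ _ _ ((freeModule n).map_comp _ _).symm)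

/-- The cocycle of a polynomial takes the same value at every point of the orbit, so f acts through
its coefficient sum. -/
lemma comp_polyCocycle (α : Deg n) {a b : BZ n} (f : a ⟶ b) (p : Poly n) :
    f.hom ≫ (polyCocycle α b p).1 = (polyCocycle α a (deg f • p)).1 := by
  have h : ∀ z : Orb n b.1 →₀ ℤ, (polyCocycle α b p).1.hom z =
      (z.sum fun _ c => c) • proj α.2 α.1 (Phi α.2 p) := by
    intro z
    induction z using Finsupp.induction_linear with
    | zero =>
      rw [Finsupp.sum_zero_index, zero_smul]
      exact map_zero _
    | add f g hf hg =>
      rw [Finsupp.sum_add_index' (fun _ => rfl) (fun _ _ _ => rfl), add_smul, ← hf, ← hg]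
      exact map_add _ _ _
    | single o c =>
      rw [Finsupp.sum_single_index rfl, single_eq_smul, ← polyCocycle_single α b p o]
      exact map_smul _ _ _
  refine perm_orb_hom_ext ?_
  refine Eq.trans ?_ (polyCocycle_single α a _ _).symm
  rw [map_smul, map_smul, show orbPt n a.1 0 = ((1 : Cyc n) : Orb n a.1) by rw [orbPt, pow_zero]]
  exact h _

lemma Phi_one_apply_of_expU_eq_zero {v : Dv n → ℕ} {s : (Dv n ⊕ Dv n) →₀ ℕ} (h : expA s = v)
    (h' : expU s = 0) : Phi v (MvPolynomial.monomial s 1) = Finsupp.single (fun _ => Cell.pt) 1 := by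
  rw [Phi_monomial, one_smul, phiMon, if_pos (by rw [h, h', add_zero]), h']
  classical
  ext x
  rw [theta_apply, Finsupp.single_apply]
  refine if_congr ?_ rfl rfl
  simp only [stdS, Pi.zero_apply, not_lt_zero, decide_false, Bool.false_eq_true, if_false]
  rw [eq_comm, funext_iff]
  refine forall_congr' fun i => ?_
  cases x i <;> simp

lemma cls_polyCocycle_of_expU_eq_zero {v : Dv n → ℕ} {s : (Dv n ⊕ Dv n) →₀ ℕ} (h : expA s = v)
    (h' : expU s = 0) (e : n.divisors) :
    cls (polyCocycle (0, v) e (MvPolynomial.monomial s 1)) = cls (pointCocycle v e) := by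
  congr 1
  refine Subtype.ext (perm_hom_ext fun o => ?_)
  refine (polyCocycle_single _ _ _ o).trans (Eq.trans ?_ (permLift_single _ (fun g x => by
    rw [permRep_single]; rfl) o).symm)
  change proj v 0 (Phi v _) = _
  rw [Phi_one_apply_of_expU_eq_zero h h']
  exact proj_single _ _ _ _

lemma cls_polyCocycle_polyU (d : Dv n) (e : n.divisors) :
    cls (polyCocycle (-2, Pi.single d 1) e (polyU d)) = cls (topCocycle d e) := by
  congr 1
  refine Subtype.ext (perm_hom_ext fun o => ?_)
  refine (polyCocycle_single _ _ _ o).trans (Eq.trans ?_ (permLift_single _ (fun g x => by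
    rw [permRep_const]) o).symm)
  change proj (Pi.single d 1) (-2) (Phi (Pi.single d 1) (MvPolynomial.monomial _ 1)) = _
  rw [Phi_monomial, one_smul, phiMon, if_pos (by rw [expA_inr, expU_inr, zero_add]), expU_inr]
  ext x
  rw [proj_apply, theta_apply]
  refine if_pos fun i => ?_
  obtain rfl := Subsingleton.elim default i
  have hx := x.2
  simp only [Cells.dim, Fintype.sum_unique] at hx
  rw [if_pos]
  · omega
  · exact decide_eq_true (show 0 < (Pi.single d 1 : Dv n → ℕ) d by simp)

/-- Homogeneity ensures that projecting the cycles of p and q to the degrees α and β loses nothing;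
then `mulTot_Phi_Phi` applies. -/
lemma cls_prodCocycle_polyCocycle {α β : Deg n} {e : n.divisors} {p q : Poly n}
    (hp : p ∈ MvPolynomial.weightedHomogeneousSubmodule ℤ wt α)
    (hq : q ∈ MvPolynomial.weightedHomogeneousSubmodule ℤ wt β) :
    cls (prodCocycle (polyCocycle α e p) (polyCocycle β e q)) =
      cls (polyCocycle (α + β) e (p * q)) := by
  rw [← sub_eq_zero, ← cls_sub, cls_eq_zero_iff_mem_bnd, value_sub, value_polyCocycle]
  have phi_eq {α : Deg n} {p : Poly n} (hp : p ∈ MvPolynomial.weightedHomogeneousSubmodule ℤ wt α) :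
      Phi α.2 p = incl α.2 α.1 ((polyCocycle α e p).1.hom (Finsupp.single (orbPt n e 0) 1)) := by
    rw [polyCocycle_single, ← comp_apply, comp_Phi_of_homogeneous hp]
  have h : value (prodCocycle (polyCocycle α e p) (polyCocycle β e q)).1 =
      comp (α.1 + β.1) (mulTot _ _ (Phi α.2 p) (Phi β.2 q)) := by
    rw [phi_eq hp, phi_eq hq, comp_apply]
    exact congrArg _ (prodCochain_single _ _ _)
  rw [h]
  change comp (α.1 + β.1) _ - comp (α.1 + β.1) (Phi (α.2 + β.2) (p * q)) ∈ bnd e (α.2 + β.2)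
  rw [← map_sub]
  exact comp_mem_bnd _ (bnd_mono (one_dvd _) (mulTot_Phi_Phi (mem_wtSpan_of_homogeneous hp) q))

theorem comparison_isGradedMap : IsGradedMap (comparison (n := n)) where
  pull α a b f := by
    rintro ⟨_, p, hp, rfl⟩
    refine Eq.trans ?_ (Hpull_cls α f (polyCocycle α b p)).symm
    change cls (polyCocycle α a (deg f • p)) = _
    congr 1
    exact Subtype.ext (comp_polyCocycle α f p).symm
  one e := cls_polyCocycle_of_expU_eq_zero (s := 0) rfl rfl e
  mul α β e := by
    rintro ⟨_, p, hp, rfl⟩ ⟨_, q, hq, rfl⟩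
    refine Eq.trans ?_ (mul_cls _ _).symm
    exact (cls_prodCocycle_polyCocycle hp hq).symm
  a d := cls_polyCocycle_of_expU_eq_zero (expA_inl d) (expU_inl d) _
  u d := cls_polyCocycle_polyU d _

theorem comparison_injective (α : Deg n) (e : BZ n) : Function.Injective (comparison α e) := by
  rw [injective_iff_map_eq_zero]
  rintro ⟨_, p, hp, rfl⟩ h
  change cls (polyCocycle α e p) = 0 at h
  rw [cls_eq_zero_iff_mem_bnd, value_polyCocycle, comp_Phi_of_homogeneous hp] at h
  exact Subtype.ext (Ideal.Quotient.eq_zero_iff_mem.2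
    (mem_J_of_Phi_mem_bnd (mem_wtSpan_of_homogeneous hp) h))

theorem comparison_surjective (α : Deg n) (e : BZ n) : Function.Surjective (comparison α e) := by
  intro x
  obtain ⟨z, rfl⟩ := cls_surjective x
  obtain ⟨q, hq⟩ := exists_Phi_sub_mem_bnd (BZ.dvd e) (value_mem_inv z.1) (bd_value z)
  refine ⟨⟨_, MvPolynomial.weightedHomogeneousComponent wt α q,
    MvPolynomial.weightedHomogeneousComponent_mem _ _ _, rfl⟩, ?_⟩
  change cls (polyCocycle α e _) = _
  rw [eq_comm, ← sub_eq_zero, ← cls_sub, cls_eq_zero_iff_mem_bnd, value_sub, value_polyCocycle,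
    comp_Phi_of_homogeneous (MvPolynomial.weightedHomogeneousComponent_mem _ _ _)]
  have h := comp_mem_bnd α.1 hq
  rw [map_sub, comp_Phi, value, comp_incl] at h
  exact h

end comparison

/-! ### Uniqueness of the comparison map -/

section uniqueness
variable {n : ℕ} [NeZero n]

lemma deg_one_pull {a b : BZ n} {f : a ⟶ b} (hf : deg f = 1) (α : Deg n) (p : Poly n)
    (h : Ideal.Quotient.mk (J b) p ∈ QDeg α b) :
    (QPull α f ⟨Ideal.Quotient.mk (J b) p, h⟩).1 = Ideal.Quotient.mk (J a) p := by
  change Ideal.Quotient.mk (J a) (deg f • p) = _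
  rw [hf, one_smul]

/-- Two maps agree on the classes of a polynomial. -/
def AgreeOn (φ ψ : ∀ (α : Deg n) (e : n.divisors), QDeg α e →+ H α e) (p : Poly n) : Prop :=
  ∀ (α : Deg n) (e : BZ n) (x : QDeg α e), p ∈ MvPolynomial.weightedHomogeneousSubmodule ℤ wt α →
    x.1 = Ideal.Quotient.mk (J e) p → φ α e x = ψ α e x

variable {φ ψ : ∀ (α : Deg n) (e : n.divisors), QDeg α e →+ H α e}

/-- At any orbit the generator is the restriction of the one at Θ_1 along a map of degree 1. -/
lemma agreeOn_generator (hφ : IsGradedMap φ) (hψ : IsGradedMap ψ) (i : Dv n ⊕ Dv n) :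
    AgreeOn φ ψ (MvPolynomial.X i) := by
  intro α e x hα hx
  have hw : wt i = α := by
    have h := hα (d := Finsupp.single i 1) (by simp [MvPolynomial.X])
    rwa [Finsupp.weight_single, one_smul] at h
  subst hw
  obtain ⟨f, hf⟩ := exists_deg_eq e (onePoint n)
  have hf' : deg f = 1 := by rw [hf]; simp [onePoint]
  rcases i with d | d
  · have : x = QPull _ f (QA d) := Subtype.ext (hx.trans (deg_one_pull hf' _ _ (QA d).2).symm)
    rw [this]
    exact ((hφ.pull _ f _).trans (congrArg _ ((hφ.a d).trans (hψ.a d).symm))).trans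
      (hψ.pull _ f _).symm
  · have : x = QPull _ f (QU d) := Subtype.ext (hx.trans (deg_one_pull hf' _ _ (QU d).2).symm)
    rw [this]
    exact ((hφ.pull _ f _).trans (congrArg _ ((hφ.u d).trans (hψ.u d).symm))).trans
      (hψ.pull _ f _).symm

lemma agreeOn_one (hφ : IsGradedMap φ) (hψ : IsGradedMap ψ) : AgreeOn φ ψ 1 := by
  intro α e x hα hx
  have hw : 0 = α := by
    have h := hα (d := 0) (by simp)
    rwa [map_zero] at h
  subst hw
  have : x = QOne e := Subtype.ext (hx.trans (map_one _))
  rw [this]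
  exact (hφ.one e).trans (hψ.one e).symm

lemma AgreeOn.monomial_mul (hφ : IsGradedMap φ) (hψ : IsGradedMap ψ) {s s' : (Dv n ⊕ Dv n) →₀ ℕ}
    (h : AgreeOn φ ψ (MvPolynomial.monomial s 1)) (h' : AgreeOn φ ψ (MvPolynomial.monomial s' 1)) :
    AgreeOn φ ψ (MvPolynomial.monomial (s + s') 1) := by
  intro α e x hα hx
  have hw : Finsupp.weight wt s + Finsupp.weight wt s' = α := by
    rw [← map_add]
    exact hα (d := s + s') (by simp)
  subst hw
  have m := MvPolynomial.isWeightedHomogeneous_monomial (R := ℤ) wt s 1 rfl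
  have m' := MvPolynomial.isWeightedHomogeneous_monomial (R := ℤ) wt s' 1 rfl
  have : x = QMul (e := e) ⟨_, _, m, rfl⟩ ⟨_, _, m', rfl⟩ := Subtype.ext (hx.trans (by
    rw [show MvPolynomial.monomial (s + s') (1 : ℤ) = MvPolynomial.monomial s 1 *
      MvPolynomial.monomial s' 1 by rw [MvPolynomial.monomial_mul, one_mul], map_mul]
    rfl))
  rw [this]
  refine ((hφ.mul _ _ e _ _).trans ?_).trans (hψ.mul _ _ e _ _).symm
  rw [h _ e _ m rfl, h' _ e _ m' rfl]

lemma agreeOn_monomial (hφ : IsGradedMap φ) (hψ : IsGradedMap ψ) (s : (Dv n ⊕ Dv n) →₀ ℕ) :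
    AgreeOn φ ψ (MvPolynomial.monomial s 1) := by
  induction s using Finsupp.induction_linear with
  | zero => exact agreeOn_one hφ hψ
  | add f g hf hg => exact hf.monomial_mul hφ hψ hg
  | single i k =>
    induction k with
    | zero => rw [Finsupp.single_zero]; exact agreeOn_one hφ hψ
    | succ k ih =>
      rw [Finsupp.single_add]
      exact ih.monomial_mul hφ hψ (agreeOn_generator hφ hψ i)

theorem IsGradedMap.unique (hφ : IsGradedMap φ) (hψ : IsGradedMap ψ) : φ = ψ := by
  funext α e
  let ι : MvPolynomial.weightedHomogeneousSubmodule ℤ (wt (n := n)) α →+ QDeg α (e : BZ n) :=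
    { toFun p := ⟨Ideal.Quotient.mk (J (e : BZ n)) p.1, p.1, p.2, rfl⟩
      map_zero' := Subtype.ext (map_zero _)
      map_add' p q := Subtype.ext (map_add _ _ _) }
  -- The group of homogeneous polynomials on which the two maps agree; it contains all monomials of
  -- degree α, hence everything of that degree.
  let E := (((φ α e).comp ι).eqLocus ((ψ α e).comp ι)).map
    (MvPolynomial.weightedHomogeneousSubmodule ℤ (wt (n := n)) α).subtype.toAddMonoidHom
  ext ⟨_, p, hp, rfl⟩
  have h : p ∈ E := by
    rw [p.as_sum]
    refine sum_mem fun s hs => ?_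
    rw [show MvPolynomial.monomial s (p.coeff s) = p.coeff s • MvPolynomial.monomial s (1 : ℤ) by
      rw [MvPolynomial.smul_monomial, smul_eq_mul, mul_one]]
    have m := MvPolynomial.isWeightedHomogeneous_monomial (R := ℤ) wt s 1
      (hp (MvPolynomial.mem_support_iff.1 hs))
    have hs : MvPolynomial.monomial s (1 : ℤ) ∈ E :=
      ⟨⟨_, m⟩, agreeOn_monomial hφ hψ s α e _ m rfl, rfl⟩
    exact zsmul_mem hs _
  obtain ⟨⟨q, hq⟩, h, rfl⟩ := h
  exact h

end uniqueness
end Bredon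
theorem mainTheorem2 (n : ℕ) [NeZero n] (hn : Odd n) :
    ∃ φ : ∀ (α : Bredon.Deg n) (e : n.divisors), Bredon.QDeg α e →+ Bredon.H α e,
      Bredon.IsGradedMap φ ∧ (∀ ψ, Bredon.IsGradedMap ψ → ψ = φ) ∧
        ∀ α e, Function.Bijective (φ α e) :=
  ⟨Bredon.comparison, Bredon.comparison_isGradedMap,
    fun _ hψ => hψ.unique Bredon.comparison_isGradedMap,
    fun α e => ⟨Bredon.comparison_injective α e, Bredon.comparison_surjective α e⟩⟩
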